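/- Identify $\mathbb{R}^2$ with $\mathbb{C}$, and let $u:\mathbb{R}^2\to[0,\infty)$ be one of the following two global solutions of the one-phase free boundary problem: * the disk-complement solution $L(z)=(\log|z|)^+$; * the double hairpin solution $H$, given by $H(w+\sinh w)=\operatorname{Re}\cosh w$ for $w$ in the strip $S=\{|\operatorname{Im}w|<\pi/2\}$ (on which $w\mapsto w+\sinh w$ is injective, with image the region between the catenaries $x_2=\pm(\pi/2+\cosh x_1)$), and by $H=0$ off this image. Let $\Omega=\{u>0\}$ and $F(u)=\partial\Omega$, and let $\kappa=\operatorname{div}(\nabla u/|\nabla u|)$ be the mean curvature of $F(u)$ with respect to the normal $\nu=-\nabla u$, with derivatives taken from the side of $\Omega$. Let $\operatorname{ind}(u)\in\{0,1,2,\dots,\infty\}$ be the Morse index of $u$, i.e. the supremum of the dimensions of the linear subspaces of $C_c^\infty(\Omega\cup F(u))$ (functions smooth up to $F(u)$, with compact support in $\overline\Omega$) on which the form $$Q(\phi,\psi)=\int_\Omega\nabla\phi\cdot\nabla\psi\,dx-\int_{F(u)}\kappa\,\phi\,\psi\,d\mathcal{H}^1$$ is negative definite. Let $\mathbb{D}$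 be the open unit disk, $T:H^1(\mathbb{D})\to L^2(\partial\mathbb{D})$ the trace operator, and $$Q_0(\psi,\chi)=\int_{\mathbb{D}}\nabla\psi\cdot\nabla\chi\,d\xi-\int_{\partial\mathbb{D}}(T\psi)(T\chi)\,d\mathcal{H}^1,\qquad \psi,\chi\in H^1(\mathbb{D}).$$ Then $\operatorname{ind}(u)$ equals the index of $Q_0$ in $H^1(\mathbb{D})$, i.e. the supremum of the dimensions of the linear subspaces of $H^1(\mathbb{D})$ on which $Q_0$ is negative definite. -/

import Mathlib

open MeasureTheory Filter Topology
open scoped ContDiff ENNReal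

noncomputable section

namespace OnePhase

/-! The plane `ℝ²` is identified with `ℂ`; all derivatives are real derivatives, `volume` on `ℂ` is
Lebesgue measure and `μH[1]` is the one-dimensional Hausdorff measure (arclength on curves). -/

/-! ### Index of a symmetric bilinear form -/

/-- The index of a form `B`: the supremum of the dimensions of the subspaces on which `B` is
negative definite, as an element of `{0, 1, 2, …, ∞}`. -/
def formIndex {E : Type*} [AddCommGroup E] [Module ℝ E] (B : E → E → ℝ) : ℕ∞ :=
  ⨆ (V : Submodule ℝ E) (_ : ∀ v ∈ V, v ≠ 0 → B v v < 0), Cardinal.toENat (Module.rank ℝ V)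

/-! ### Second variation and Morse index of a solution of the one-phase problem -/

/-- The positive phase `{u > 0}`. -/
def posPhase (u : ℂ → ℝ) : Set ℂ := {z | 0 < u z}

/-- The free boundary `F(u) = ∂{u > 0}`. -/
def freeBoundary (u : ℂ → ℝ) : Set ℂ := frontier (posPhase u)

/-- The unit vector field `∇u / |∇u|` on the closed positive phase, the gradient being taken from
the positive side. -/
def unitGrad (u : ℂ → ℝ) (z : ℂ) : ℂ :=
  ‖gradientWithin u (closure (posPhase u)) z‖⁻¹ • gradientWithin u (closure (posPhase u)) z

/-- The mean curvature `div (∇u / |∇u|)` of the free boundary with respect to `ν = -∇u`, the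
derivatives being taken from the positive side. The sign is such that it equals `1` on the unit
circle when the positive phase is the exterior of the unit disk. -/
def meanCurvature (u : ℂ → ℝ) (z : ℂ) : ℝ :=
  LinearMap.trace ℝ ℂ (fderivWithin ℝ (unitGrad u) (closure (posPhase u)) z : ℂ →ₗ[ℝ] ℂ)

/-- The space `C_c^∞({u > 0} ∪ F(u))`: functions smooth up to the free boundary, with compact
support in the closed positive phase. A function on the closed positive phase is represented by its
extension by zero to the plane. -/
def testSpace (u : ℂ → ℝ) : Submodule ℝ (ℂ → ℝ) where
  carrier := {φ | ContDiffOn ℝ ∞ φ (closure (posPhase u)) ∧ HasCompactSupport φ ∧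
    ∀ z ∉ closure (posPhase u), φ z = 0}
  add_mem' := fun ha hb =>
    ⟨ha.1.add hb.1, ha.2.1.add hb.2.1, fun z hz => by simp [ha.2.2 z hz, hb.2.2 z hz]⟩
  zero_mem' := ⟨contDiffOn_const, HasCompactSupport.zero, fun _ _ => rfl⟩
  smul_mem' := fun c φ h =>
    ⟨h.1.const_smul c, h.2.1.smul_left (f := fun _ => c), fun z hz => by simp [h.2.2 z hz]⟩

/-- The second variation form
`Q(φ, ψ) = ∫_{u > 0} ∇φ · ∇ψ dx - ∫_{F(u)} H φ ψ dℋ¹`. -/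
def secondVariation (u : ℂ → ℝ) (φ ψ : testSpace u) : ℝ :=
  (∫ z in posPhase u, inner ℝ (gradient (φ : ℂ → ℝ) z) (gradient (ψ : ℂ → ℝ) z)) -
    ∫ z in freeBoundary u, meanCurvature u z * (φ : ℂ → ℝ) z * (ψ : ℂ → ℝ) z ∂μH[1]

/-- The Morse index of `u` with respect to the Alt–Caffarelli energy. -/
def morseIndex (u : ℂ → ℝ) : ℕ∞ := formIndex (secondVariation u)

/-! ### The two solutions -/

/-- The disk-complement solution `L(z) = (log |z|)⁺`. -/
def diskComplement (z : ℂ) : ℝ := max (Real.log ‖z‖) 0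

/-- The open strip `|Im w| < π/2`. -/
def strip : Set ℂ := {w | |w.im| < Real.pi / 2}

/-- The conformal parametrization `w ↦ w + sinh w` of the region between the two catenaries
`x₂ = ±(π/2 + cosh x₁)` by the strip; it maps `t ± iπ/2` to `t ± i(π/2 + cosh t)`. -/
def hairpinMap (w : ℂ) : ℂ := w + Complex.sinh w

open Classical in
/-- The double hairpin solution: `H(w + sinh w) = Re (cosh w)` for `w` in the strip, and `H = 0`
off the image of the strip. -/
def doubleHairpin (z : ℂ) : ℝ :=
  if z ∈ hairpinMap '' strip then (Complex.cosh (Function.invFunOn hairpinMap strip z)).re else 0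

theorem hairpinMap_injOn : Set.InjOn hairpinMap strip := by
  intro a ha b hb hab
  by_contra hne
  have hd : b - a ≠ 0 := sub_ne_zero.mpr (Ne.symm hne)
  set d := b - a with hd_def
  let g : ℝ → ℝ := fun t => ((starRingEnd ℂ) d * hairpinMap (a + t * d)).re
  have hg : ∀ t : ℝ, HasDerivAt g
      (((starRingEnd ℂ) d * ((1 + Complex.cosh (a + t * d)) * d)).re) t := by
    intro t
    have h1 : HasDerivAt (fun s : ℂ => a + s * d) d (t : ℂ) := by
      simpa using ((hasDerivAt_id (t : ℂ)).mul_const d).const_add a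
    have h2 : HasDerivAt hairpinMap (1 + Complex.cosh (a + t * d)) (a + t * d) :=
      (hasDerivAt_id _).add (Complex.hasDerivAt_sinh _)
    have h3 := (h2.comp (t : ℂ) h1).const_mul ((starRingEnd ℂ) d)
    exact h3.real_of_complex
  have hpos : ∀ t ∈ Set.Icc (0 : ℝ) 1, 0 < deriv g t := by
    intro t ht
    rw [(hg t).deriv]
    have hre : (((starRingEnd ℂ) d * ((1 + Complex.cosh (a + t * d)) * d)).re)
        = Complex.normSq d * (1 + Complex.cosh (a + t * d)).re := by
      have : (starRingEnd ℂ) d * ((1 + Complex.cosh (a + t * d)) * d)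
          = (Complex.normSq d : ℂ) * (1 + Complex.cosh (a + t * d)) := by
        rw [← Complex.mul_conj]; ring
      rw [this, Complex.re_ofReal_mul]
    rw [hre]
    apply mul_pos (Complex.normSq_pos.mpr hd)
    have him : |(a + t * d).im| < Real.pi / 2 := by
      have h1 : -(Real.pi / 2) < a.im ∧ a.im < Real.pi / 2 := abs_lt.mp ha
      have h2 : -(Real.pi / 2) < b.im ∧ b.im < Real.pi / 2 := abs_lt.mp hb
      have : (a + t * d).im = (1 - t) * a.im + t * b.im := by
        simp [hd_def]; ring
      rw [this, abs_lt]
      obtain ⟨h0, h1'⟩ := ht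
      have := convex_Ioo (-(Real.pi / 2)) (Real.pi / 2) h1 h2 (sub_nonneg.mpr h1') h0 (by ring)
      simpa using this
    have hc : (Complex.cosh (a + t * d)).re
        = Real.cosh (a + t * d).re * Real.cos (a + t * d).im := by
      generalize a + t * d = w
      obtain ⟨x, y⟩ := w
      rw [Complex.mk_eq_add_mul_I, Complex.cosh_add, Complex.cosh_mul_I, Complex.sinh_mul_I]
      simp
      exact Or.inl (Complex.cos_ofReal_re y)
    rw [Complex.add_re, hc, Complex.one_re]
    have := Real.cos_pos_of_mem_Ioo (abs_lt.mp him)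
    have := Real.cosh_pos (a + t * d).re
    positivity
  have hmono : StrictMonoOn g (Set.Icc 0 1) :=
    strictMonoOn_of_deriv_pos (convex_Icc 0 1)
      (fun t _ => (hg t).continuousAt.continuousWithinAt)
      (fun t ht => hpos t (interior_subset ht))
  have := hmono (by simp) (by simp) (zero_lt_one' ℝ)
  simp [g, hd_def, hab] at this

theorem doubleHairpin_hairpinMap {w : ℂ} (hw : w ∈ strip) :
    doubleHairpin (hairpinMap w) = (Complex.cosh w).re := by
  have h : hairpinMap w ∈ hairpinMap '' strip := ⟨w, hw, rfl⟩
  rw [doubleHairpin, if_pos h, hairpinMap_injOn (Function.invFunOn_mem h) hw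
    (Function.invFunOn_eq h)]

/-! ### The Sobolev space `H¹` of the unit disk and the form `Q₀` -/

/-- The open unit disk. -/
def unitDisk : Set ℂ := Metric.ball 0 1

/-- Lebesgue measure on the unit disk. -/
def diskMeasure : Measure ℂ := volume.restrict unitDisk

/-- Arclength on the unit circle. -/
def circleMeasure : Measure ℂ := (μH[1]).restrict (Metric.sphere (0 : ℂ) 1)

/-- `g` is the weak gradient of `f` in the unit disk. -/
def IsWeakGradient (f : ℂ → ℝ) (g : ℂ → ℂ) : Prop :=
  ∀ η : ℂ → ℝ, ContDiff ℝ ∞ η → HasCompactSupport η → tsupport η ⊆ unitDisk → ∀ e : ℂ,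
    ∫ z, f z * fderiv ℝ η z e ∂diskMeasure = -∫ z, inner ℝ (g z) e * η z ∂diskMeasure

theorem integrable_mul_deriv (f : Lp ℝ 2 diskMeasure) {η : ℂ → ℝ} (h : ContDiff ℝ ∞ η)
    (hc : HasCompactSupport η) (e : ℂ) :
    Integrable (fun z => f z * fderiv ℝ η z e) diskMeasure := by
  have h2 : MemLp (fun z => fderiv ℝ η z e) 2 diskMeasure :=
    (((h.continuous_fderiv (by simp)).clm_apply continuous_const).memLp_of_hasCompactSupport
      (hc.fderiv_apply (𝕜 := ℝ) e)).restrict _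
  exact (Lp.memLp f).integrable_mul h2

theorem integrable_inner_mul (g : Lp ℂ 2 diskMeasure) {η : ℂ → ℝ} (h : ContDiff ℝ ∞ η)
    (hc : HasCompactSupport η) (e : ℂ) :
    Integrable (fun z => inner ℝ (g z) e * η z) diskMeasure := by
  have h2 : MemLp η 2 diskMeasure := (h.continuous.memLp_of_hasCompactSupport hc).restrict _
  exact ((Lp.memLp g).inner_const e).integrable_mul h2

/-- The Sobolev space `H¹` of the unit disk, as the space of pairs `(ψ, ∇ψ)` of an `L²` function
and its `L²` weak gradient (which is unique). -/
def H1Disk : Submodule ℝ (Lp ℝ 2 diskMeasure × Lp ℂ 2 diskMeasure) where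
  carrier := {p | IsWeakGradient p.1 p.2}
  add_mem' := by
    intro p q hp hq η h hc hs e
    have e1 : ∫ z, (p + q).1 z * fderiv ℝ η z e ∂diskMeasure
        = ∫ z, (p.1 z * fderiv ℝ η z e + q.1 z * fderiv ℝ η z e) ∂diskMeasure := by
      refine integral_congr_ae ?_
      filter_upwards [Lp.coeFn_add p.1 q.1] with z hz
      rw [Prod.fst_add, hz, Pi.add_apply, add_mul]
    have e2 : ∫ z, inner ℝ ((p + q).2 z) e * η z ∂diskMeasure
        = ∫ z, (inner ℝ (p.2 z) e * η z + inner ℝ (q.2 z) e * η z) ∂diskMeasure := by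
      refine integral_congr_ae ?_
      filter_upwards [Lp.coeFn_add p.2 q.2] with z hz
      rw [Prod.snd_add, hz, Pi.add_apply, inner_add_left, add_mul]
    rw [e1, e2, integral_add (integrable_mul_deriv _ h hc e) (integrable_mul_deriv _ h hc e),
      integral_add (integrable_inner_mul _ h hc e) (integrable_inner_mul _ h hc e),
      hp η h hc hs e, hq η h hc hs e, neg_add]
  zero_mem' := by
    intro η h hc hs e
    have e1 : ∫ z, (0 : Lp ℝ 2 diskMeasure × Lp ℂ 2 diskMeasure).1 z * fderiv ℝ η z e ∂diskMeasure
        = 0 := by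
      refine integral_eq_zero_of_ae ?_
      filter_upwards [Lp.coeFn_zero ℝ 2 diskMeasure] with z hz
      rw [Prod.fst_zero, hz]; simp
    have e2 : ∫ z, inner ℝ ((0 : Lp ℝ 2 diskMeasure × Lp ℂ 2 diskMeasure).2 z) e * η z ∂diskMeasure
        = 0 := by
      refine integral_eq_zero_of_ae ?_
      filter_upwards [Lp.coeFn_zero ℂ 2 diskMeasure] with z hz
      rw [Prod.snd_zero, hz]; simp
    rw [e1, e2, neg_zero]
  smul_mem' := by
    intro c p hp η h hc hs e
    have e1 : ∫ z, (c • p).1 z * fderiv ℝ η z e ∂diskMeasure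
        = ∫ z, c * (p.1 z * fderiv ℝ η z e) ∂diskMeasure := by
      refine integral_congr_ae ?_
      filter_upwards [Lp.coeFn_smul c p.1] with z hz
      rw [Prod.smul_fst, hz, Pi.smul_apply, smul_eq_mul, mul_assoc]
    have e2 : ∫ z, inner ℝ ((c • p).2 z) e * η z ∂diskMeasure
        = ∫ z, c * (inner ℝ (p.2 z) e * η z) ∂diskMeasure := by
      refine integral_congr_ae ?_
      filter_upwards [Lp.coeFn_smul c p.2] with z hz
      rw [Prod.smul_snd, hz, Pi.smul_apply, real_inner_smul_left, mul_assoc]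
    rw [e1, e2, integral_const_mul, integral_const_mul, hp η h hc hs e, mul_neg]

/-- `τ` is the boundary trace of `ψ ∈ H¹`: it is the limit in `L²(∂𝔻)` of the boundary values of
functions in `C^∞` of the closed disk that converge to `ψ` in `H¹`. -/
def IsTrace (ψ : H1Disk) (τ : Lp ℝ 2 circleMeasure) : Prop :=
  ∃ f : ℕ → ℂ → ℝ, (∀ n, ContDiffOn ℝ ∞ (f n) (Metric.closedBall 0 1)) ∧
    Tendsto (fun n => eLpNorm (fun z => f n z - ψ.1.1 z) 2 diskMeasure) atTop (𝓝 0) ∧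
    Tendsto (fun n => eLpNorm (fun z => gradient (f n) z - ψ.1.2 z) 2 diskMeasure) atTop (𝓝 0) ∧
    Tendsto (fun n => eLpNorm (fun z => f n z - τ z) 2 circleMeasure) atTop (𝓝 0)

open Classical in
/-- The trace operator `T : H¹(𝔻) → L²(∂𝔻)`. By the trace theorem a trace exists and is unique
for every `ψ`, so the second branch never occurs. -/
def traceOp (ψ : H1Disk) : Lp ℝ 2 circleMeasure :=
  if h : ∃ τ, IsTrace ψ τ then h.choose else 0

/-- The form `Q₀(ψ, χ) = ∫_𝔻 ∇ψ · ∇χ dξ - ∫_{∂𝔻} Tψ Tχ dℋ¹` on `H¹(𝔻)`. -/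
def Q0 (ψ χ : H1Disk) : ℝ :=
  (∫ z, inner ℝ (ψ.1.2 z) (χ.1.2 z) ∂diskMeasure) -
    ∫ z, traceOp ψ z * traceOp χ z ∂circleMeasure

end OnePhase

end

open MeasureTheory Filter Topology
open scoped ContDiff ENNReal

noncomputable section

namespace OnePhase

/-! Both indices equal 1. A form has index one as soon as it is nonnegative on the kernel of a
linear functional and negative on the nonzero points of a line (`formIndex_eq_one`); for `Q0` and
for both solutions the functional is a boundary mean.

Nonnegativity rests on one estimate. On the half-cylinder with coordinates s ≥ 0 and t mod 2π, let
D(s) be the squared L² distance of v(s,·) from its mean m. Then D' = 2∫(v-m)v_s ≥ -∫(v-m)² - ∫v_s²,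
and Wirtinger's inequality bounds ∫(v-m)² by ∫v_t². So D decreases no faster than the Dirichlet
energy accumulates (`deviation_sub_le_setIntegral`). Dirichlet energy is conformally invariant
(`setIntegral_image_sq_gradient`). Transport by exp(-w) gives the sharp trace inequality ∫f² -
(∫f)²/2π ≤ ∫|∇f|² on the disk (`integral_circle_sq_sub_le`); transport by exp(w) gives it on the
exterior of the disk, where κ = 1.

For the double hairpin, the disk is mapped conformally onto Ω through the strip, with ±1 going to
the two ends. At the edge point t ± iπ/2 the curvature is 1/cosh² t and the boundary speed is cosh
t, so κ dℋ¹ = dt/cosh t, which is also the arclength of the corresponding arc of the circle. Hence Q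
on a test function is the disk form on its pull-back, and the disk inequality applies again.

Constants are negative directions on the disk. On the unbounded phases they are replaced by cut-offs
at scale 1/ε in the logarithmic or strip coordinate: their energy is O(ε), while the boundary term
stays bounded below.

On H¹ neither existence nor uniqueness of traces is needed: the mean of any trace is a fixed
continuous functional of (ψ, ∇ψ) (`IsTrace.inner_circleOne`), and a missing trace only makes the
form larger. -/

/-! ### Forms of index one -/

/-- A negative definite subspace meets the kernel of `l` only in 0, so `l` embeds it in the line;
the span of `v` attains dimension one. `B` is not assumed bilinear, hence the hypothesis on all
multiples of `v`: the form `Q0` goes through a chosen trace, whose linearity would require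
uniqueness. -/
theorem formIndex_eq_one {E : Type*} [AddCommGroup E] [Module ℝ E] {B : E → E → ℝ}
    (l : E →ₗ[ℝ] ℝ) (hl : ∀ v, l v = 0 → 0 ≤ B v v) {v : E}
    (hv : ∀ c : ℝ, c ≠ 0 → B (c • v) (c • v) < 0) : formIndex B = 1 := by
  have h0 : 0 ≤ B 0 0 := hl 0 (map_zero l)
  have hv0 : v ≠ 0 := by
    rintro rfl
    have := hv 1 one_ne_zero
    simp only [smul_zero] at this
    linarith
  apply le_antisymm
  · refine iSup₂_le fun V hV => ?_
    have hinj : Function.Injective (l.comp V.subtype) := by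
      rw [← LinearMap.ker_eq_bot, LinearMap.ker_eq_bot']
      intro w hw
      by_contra hne
      exact (hV w w.2 (by simpa using hne)).not_ge (hl w hw)
    have := LinearMap.lift_rank_le_of_injective _ hinj
    rw [Module.rank_self, Cardinal.lift_one, Cardinal.lift_le_one_iff] at this
    simpa using Cardinal.toENat.monotone' this
  · have hV : ∀ w ∈ Submodule.span ℝ {v}, w ≠ 0 → B w w < 0 := by
      intro w hw hw0
      obtain ⟨c, rfl⟩ := Submodule.mem_span_singleton.1 hw
      exact hv c (by rintro rfl; simp at hw0)
    refine le_trans ?_ (le_iSup₂ (f := fun (V : Submodule ℝ E)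
      (_ : ∀ v ∈ V, v ≠ 0 → B v v < 0) => Cardinal.toENat (Module.rank ℝ V)) _ hV)
    rw [(rank_submodule_eq_one_iff _).2 ⟨v, Submodule.mem_span_singleton_self v, hv0, le_rfl⟩]
    simp

/-! ### Wirtinger's inequality through Fourier series -/

theorem memLp_restrict_of_isCompact {X F : Type*} [TopologicalSpace X] [T2Space X]
    [MeasurableSpace X] [BorelSpace X] [NormedAddCommGroup F] {μ : Measure X} {K : Set X} {f : X → F}
    {p : ℝ≥0∞} (hK : IsCompact K) (hμ : μ K ≠ ⊤) (hf : ContinuousOn f K) :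
    MemLp f p (μ.restrict K) := by
  have : IsFiniteMeasure (μ.restrict K) := ⟨by simpa using hμ.lt_top⟩
  obtain ⟨C, hC⟩ := hK.exists_bound_of_continuousOn hf
  refine MemLp.of_bound (hf.aestronglyMeasurable_of_isCompact hK hK.measurableSet) C ?_
  exact (ae_restrict_iff' hK.measurableSet).2 (Eventually.of_forall hC)

/-- **Wirtinger's inequality** on an interval of length `2π`. -/
theorem integral_sq_sub_le_integral_deriv_sq {f f' : ℝ → ℝ} (hf : ∀ x, HasDerivAt f (f' x) x)
    (hf' : Continuous f') (hper : f Real.pi = f (-Real.pi)) :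
    (∫ x in -Real.pi..Real.pi, f x ^ 2) - (∫ x in -Real.pi..Real.pi, f x) ^ 2 / (2 * Real.pi)
      ≤ ∫ x in -Real.pi..Real.pi, f' x ^ 2 := by
  have hpi := Real.pi_pos
  have hab : -Real.pi < Real.pi := by linarith
  have hfc : Continuous f := continuous_iff_continuousAt.2 fun x => (hf x).continuousAt
  have hmem : ∀ {g : ℝ → ℝ}, Continuous g → MemLp (fun x => (g x : ℂ)) 2
      (volume.restrict (Set.Ioc (-Real.pi) Real.pi)) := fun hg =>
    (memLp_restrict_of_isCompact isCompact_Icc isCompact_Icc.measure_ne_top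
      (Complex.continuous_ofReal.comp hg).continuousOn).mono_measure
        (Measure.restrict_mono Set.Ioc_subset_Icc_self le_rfl)
  have h1 := hasSum_sq_fourierCoeffOn hab (hmem hfc)
  have h2 := hasSum_sq_fourierCoeffOn hab (hmem hf')
  -- Integration by parts has no boundary term by periodicity, so the n-th coefficient of f' is in
  -- times that of f, and |n| ≥ 1.
  have hcoef : ∀ n : ℤ, n ≠ 0 → ‖fourierCoeffOn hab (fun x => (f x : ℂ)) n‖ ^ 2
      ≤ ‖fourierCoeffOn hab (fun x => (f' x : ℂ)) n‖ ^ 2 := by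
    intro n hn
    rw [fourierCoeffOn_of_hasDerivAt hab hn (fun x _ => (hf x).ofReal_comp)
      ((Complex.continuous_ofReal.comp hf').intervalIntegrable _ _), hper]
    refine pow_le_pow_left₀ (norm_nonneg _) ?_ 2
    have hn1 : (1 : ℝ) ≤ ‖(n : ℂ)‖ := by
      rw [Complex.norm_intCast]; exact_mod_cast Int.one_le_abs hn
    have e : (1 : ℂ) / (-2 * Real.pi * Complex.I * n) *
        (fourier (-n) ((-Real.pi : ℝ) : AddCircle (Real.pi - -Real.pi)) *
          ((f (-Real.pi) : ℂ) - f (-Real.pi)) - (((Real.pi : ℝ) : ℂ) - ((-Real.pi : ℝ) : ℂ)) *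
            fourierCoeffOn hab (fun x => (f' x : ℂ)) n)
        = (Complex.I * n)⁻¹ * fourierCoeffOn hab (fun x => (f' x : ℂ)) n := by
      have : (Real.pi : ℂ) ≠ 0 := by exact_mod_cast hpi.ne'
      have : (n : ℂ) ≠ 0 := by exact_mod_cast hn
      push_cast
      field_simp
      ring
    rw [e, norm_mul, norm_inv, norm_mul, Complex.norm_I, one_mul]
    exact mul_le_of_le_one_left (norm_nonneg _) (inv_le_one_of_one_le₀ hn1)
  -- The zero mode is removed from Parseval's identity for f; its square is the mean term on the
  -- left-hand side.
  have h3 : HasSum (fun i : ℤ => if i = 0 then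
      ‖fourierCoeffOn hab (fun x => (f x : ℂ)) 0‖ ^ 2 else 0)
      (‖fourierCoeffOn hab (fun x => (f x : ℂ)) 0‖ ^ 2) := hasSum_ite_eq 0 _
  have h4 := hasSum_le (fun i => ?_) (h1.sub h3) h2
  · have hc0 : fourierCoeffOn hab (fun x => (f x : ℂ)) 0
        = (((2 * Real.pi)⁻¹ * ∫ x in -Real.pi..Real.pi, f x : ℝ) : ℂ) := by
      rw [fourierCoeffOn_eq_integral]
      simp only [neg_zero, fourier_zero, one_smul]
      rw [intervalIntegral.integral_ofReal, Complex.real_smul]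
      push_cast
      congr 1
      rw [one_div]; congr 1; ring
    rw [hc0, Complex.norm_real, Real.norm_eq_abs, sq_abs] at h4
    simp only [Complex.norm_real, Real.norm_eq_abs, sq_abs, smul_eq_mul, sub_neg_eq_add,
      ← two_mul] at h4
    have := mul_le_mul_of_nonneg_left h4 (by positivity : 0 ≤ 2 * Real.pi)
    rw [mul_sub, mul_inv_cancel_left₀ (by positivity), mul_inv_cancel_left₀ (by positivity)] at this
    have e : ∀ X : ℝ, X ^ 2 / (2 * Real.pi) = 2 * Real.pi * ((2 * Real.pi)⁻¹ * X) ^ 2 := fun X => by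
      field_simp
    rw [e]
    exact this
  · by_cases hi : i = 0
    · subst hi; simp
    · simpa [hi] using hcoef i hi

/-! ### Conformal changes of variables -/

/-- The real derivative of g is multiplication by g', whose adjoint is multiplication by its
conjugate; so the gradient of φ ∘ g is conj(g') · (∇φ ∘ g). -/
theorem norm_gradient_comp {g : ℂ → ℂ} {g' w : ℂ} {φ : ℂ → ℝ} (hg : HasDerivAt g g' w)
    (hφ : DifferentiableAt ℝ φ (g w)) :
    ‖gradient (φ ∘ g) w‖ = ‖g'‖ * ‖gradient φ (g w)‖ := by
  have h : HasGradientAt (φ ∘ g) ((starRingEnd ℂ) g' * gradient φ (g w)) w := by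
    rw [hasGradientAt_iff_hasFDerivAt]
    have h1 := hφ.hasFDerivAt.comp w hg.complexToReal_fderiv
    have e : InnerProductSpace.toDual ℝ ℂ ((starRingEnd ℂ) g' * gradient φ (g w))
        = (fderiv ℝ φ (g w)).comp (g' • (1 : ℂ →L[ℝ] ℂ)) := by
      ext v
      change _ = fderiv ℝ φ (g w) (g' * v)
      rw [InnerProductSpace.toDual_apply_apply, ← inner_gradient_left, Complex.inner,
        Complex.inner]
      simp
      ring
    rw [e]
    exact h1
  rw [h.gradient, norm_mul, RCLike.norm_conj]

theorem det_smul_one_complex (c : ℂ) : (c • (1 : ℂ →L[ℝ] ℂ)).det = ‖c‖ ^ 2 := by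
  have e : ((c • (1 : ℂ →L[ℝ] ℂ) : ℂ →L[ℝ] ℂ) : ℂ →ₗ[ℝ] ℂ)
      = (LinearMap.lsmul ℂ ℂ c).restrictScalars ℝ := by ext <;> simp
  rw [ContinuousLinearMap.det, e, LinearMap.det_restrictScalars]
  simp [Algebra.norm_complex_eq, Complex.normSq_eq_norm_sq]

theorem setIntegral_image_sq_norm {g g' : ℂ → ℂ} {s : Set ℂ} (hs : MeasurableSet s)
    (hg : ∀ w ∈ s, HasDerivAt g (g' w) w) (hinj : Set.InjOn g s) (F : ℂ → ℝ) :
    ∫ z in g '' s, F z = ∫ w in s, ‖g' w‖ ^ 2 * F (g w) := by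
  rw [integral_image_eq_integral_abs_det_fderiv_smul volume hs
    (fun w hw => ((hg w hw).complexToReal_fderiv).hasFDerivWithinAt) hinj]
  refine setIntegral_congr_fun hs fun w _ => ?_
  simp only [det_smul_one_complex, smul_eq_mul, abs_of_nonneg (sq_nonneg ‖g' w‖)]

/-- Conformal invariance of the Dirichlet integral: the Jacobian |g'|² is exactly the factor by
which the squared gradient scales. -/
theorem setIntegral_image_sq_gradient {g g' : ℂ → ℂ} {s : Set ℂ} (hs : MeasurableSet s)
    (hg : ∀ w ∈ s, HasDerivAt g (g' w) w) (hinj : Set.InjOn g s) {φ : ℂ → ℝ}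
    (hφ : ∀ w ∈ s, DifferentiableAt ℝ φ (g w)) :
    ∫ z in g '' s, ‖gradient φ z‖ ^ 2 = ∫ w in s, ‖gradient (φ ∘ g) w‖ ^ 2 := by
  rw [setIntegral_image_sq_norm hs hg hinj]
  refine setIntegral_congr_fun hs fun w hw => ?_
  simp only [norm_gradient_comp (hg w hw) (hφ w hw), mul_pow]

theorem setIntegral_reProdIm {a b c d : ℝ} (hab : a ≤ b) (hcd : c ≤ d) {F : ℂ → ℝ}
    (hF : IntegrableOn F (Set.Ioc a b ×ℂ Set.Ioc c d)) :
    ∫ w in Set.Ioc a b ×ℂ Set.Ioc c d, F w = ∫ x in a..b, ∫ y in c..d, F (x + y * Complex.I) := by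
  have hpre : Set.Ioc a b ×ℂ Set.Ioc c d
      = Complex.measurableEquivRealProd ⁻¹' (Set.Ioc a b ×ˢ Set.Ioc c d) := by
    ext w; simp [Complex.mem_reProdIm, Complex.measurableEquivRealProd_apply]
  have e : ∀ w, F w = (fun p : ℝ × ℝ => F (p.1 + p.2 * Complex.I))
      (Complex.measurableEquivRealProd w) := by
    intro w; simp [Complex.measurableEquivRealProd_apply]
  have hmp := Complex.volume_preserving_equiv_real_prod
  have hF' : IntegrableOn (fun p : ℝ × ℝ => F (p.1 + p.2 * Complex.I))
      (Set.Ioc a b ×ˢ Set.Ioc c d) := by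
    rw [← hmp.integrableOn_comp_preimage Complex.measurableEquivRealProd.measurableEmbedding,
      ← hpre]
    exact hF.congr_fun (fun w _ => e w) ((measurableSet_Ioc.preimage Complex.measurable_re).inter
      (measurableSet_Ioc.preimage Complex.measurable_im))
  rw [hpre, setIntegral_congr_fun (hpre ▸ ((measurableSet_Ioc.preimage Complex.measurable_re).inter
      (measurableSet_Ioc.preimage Complex.measurable_im))) (fun w _ => e w),
    hmp.setIntegral_preimage_emb Complex.measurableEquivRealProd.measurableEmbedding
      (fun p : ℝ × ℝ => F (p.1 + p.2 * Complex.I)), Measure.volume_eq_prod, setIntegral_prod _ hF',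
    intervalIntegral.integral_of_le hab]
  simp only [intervalIntegral.integral_of_le hcd]

/-! ### The energy estimate on a half-cylinder -/

/-- Continuity is global but differentiability only local: below, functions on a half-plane are
extended continuously past its edge, where the derivative formula fails. The dominating constant is
a bound for F' on a compact box. -/
theorem hasDerivAt_intervalIntegral_of_continuous {F F' : ℝ → ℝ → ℝ} {a b x₀ : ℝ} {s : Set ℝ}
    (hs : s ∈ 𝓝 x₀) (hF : Continuous F.uncurry) (hF' : Continuous F'.uncurry)
    (h : ∀ x ∈ s, ∀ t, HasDerivAt (fun x => F x t) (F' x t) x) :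
    HasDerivAt (fun x => ∫ t in a..b, F x t) (∫ t in a..b, F' x₀ t) x₀ := by
  obtain ⟨C, hC⟩ := ((isCompact_closedBall x₀ 1).prod
    (isCompact_uIcc (a := a) (b := b))).exists_bound_of_continuousOn hF'.continuousOn
  have hs' : s ∩ Metric.closedBall x₀ 1 ∈ 𝓝 x₀ :=
    inter_mem hs (Metric.closedBall_mem_nhds _ one_pos)
  have hFx : ∀ x, Continuous (F x) := fun x => hF.comp (by fun_prop : Continuous fun t => (x, t))
  have hFx' : ∀ x, Continuous (F' x) := fun x => hF'.comp (by fun_prop : Continuous fun t => (x, t))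
  refine (intervalIntegral.hasDerivAt_integral_of_dominated_loc_of_deriv_le (bound := fun _ => C)
    hs' (Eventually.of_forall fun x => (hFx x).aestronglyMeasurable)
    ((hFx x₀).intervalIntegrable _ _) (hFx' x₀).aestronglyMeasurable
    (Eventually.of_forall fun t ht x hx => hC (x, t) ⟨hx.2, Set.uIoc_subset_uIcc ht⟩)
    intervalIntegrable_const
    (Eventually.of_forall fun t _ x hx => h x hx.1 t)).2

/-- The integral of the square of the deviation of `f` from its mean over `[-π, π]`. -/
def deviation (f : ℝ → ℝ) : ℝ :=
  (∫ x in -Real.pi..Real.pi, f x ^ 2) - (∫ x in -Real.pi..Real.pi, f x) ^ 2 / (2 * Real.pi)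

/-- The s-derivative of the deviation is 2∫(V-m)V_s, at least -∫(V-m)² - ∫V_s², and Wirtinger
controls the first integral by ∫V_t². Derivatives are used only for s > 0; continuity covers the end
s = 0. -/
theorem deviation_sub_le_of_hasDerivAt {V Vs Vt : ℝ → ℝ → ℝ} (hV : Continuous V.uncurry)
    (hVs : Continuous Vs.uncurry) (hVt : Continuous Vt.uncurry)
    (hs : ∀ s > 0, ∀ t, HasDerivAt (fun s => V s t) (Vs s t) s)
    (ht : ∀ s > 0, ∀ t, HasDerivAt (V s) (Vt s t) t)
    (hper : ∀ s > 0, V s Real.pi = V s (-Real.pi)) {S : ℝ} (hS : 0 ≤ S) :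
    deviation (V 0) - deviation (V S)
      ≤ ∫ s in (0 : ℝ)..S, ∫ t in -Real.pi..Real.pi, (Vs s t ^ 2 + Vt s t ^ 2) := by
  have hpi := Real.pi_pos
  have hcont : ∀ {F : ℝ → ℝ → ℝ}, Continuous F.uncurry → ∀ x, Continuous (F x) :=
    fun hF x => hF.comp (by fun_prop : Continuous fun t => (x, t))
  have hV2 : Continuous (fun s t => V s t ^ 2).uncurry := hV.pow 2
  have hD : Continuous (fun s t => Vs s t ^ 2 + Vt s t ^ 2).uncurry := (hVs.pow 2).add (hVt.pow 2)
  have hE : Continuous fun s => deviation (V s) :=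
    (intervalIntegral.continuous_parametric_intervalIntegral_of_continuous' hV2 _ _).sub
      (((intervalIntegral.continuous_parametric_intervalIntegral_of_continuous' hV _ _).pow
        2).div_const _)
  have hderiv : ∀ s > 0, HasDerivAt (fun s => deviation (V s))
      ((∫ t in -Real.pi..Real.pi, 2 * V s t * Vs s t)
        - 2 * (∫ t in -Real.pi..Real.pi, V s t) * (∫ t in -Real.pi..Real.pi, Vs s t)
          / (2 * Real.pi)) s := by
    intro s hs0
    have h1 := hasDerivAt_intervalIntegral_of_continuous (a := -Real.pi) (b := Real.pi)
      (F' := fun s t => 2 * V s t * Vs s t) (Ioi_mem_nhds hs0) hV2 ((hV.const_mul 2).mul hVs)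
      (fun x hx t => by simpa using (hs x hx t).fun_pow 2)
    have h2 := hasDerivAt_intervalIntegral_of_continuous (a := -Real.pi) (b := Real.pi)
      (Ioi_mem_nhds hs0) hV hVs (fun x hx t => hs x hx t)
    simpa [deviation] using h1.fun_sub ((h2.fun_pow 2).div_const (2 * Real.pi))
  have key : ∀ s > 0, -((∫ t in -Real.pi..Real.pi, 2 * V s t * Vs s t)
        - 2 * (∫ t in -Real.pi..Real.pi, V s t) * (∫ t in -Real.pi..Real.pi, Vs s t)
          / (2 * Real.pi)) ≤ ∫ t in -Real.pi..Real.pi, (Vs s t ^ 2 + Vt s t ^ 2) := by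
    intro s hs0
    have cV := hcont hV s
    have cVs := hcont hVs s
    have cVt := hcont hVt s
    have hW := integral_sq_sub_le_integral_deriv_sq (ht s hs0) cVt (hper s hs0)
    set m := (∫ t in -Real.pi..Real.pi, V s t) / (2 * Real.pi) with hm
    -- Expanding this square is the arithmetic-geometric mean step; the cross term is the derivative
    -- of the deviation.
    have h0 : 0 ≤ ∫ t in -Real.pi..Real.pi, (V s t - m + Vs s t) ^ 2 :=
      intervalIntegral.integral_nonneg (by linarith) fun t _ => sq_nonneg _
    have e : ∫ t in -Real.pi..Real.pi, (V s t - m + Vs s t) ^ 2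
        = (∫ t in -Real.pi..Real.pi, V s t ^ 2) + (∫ t in -Real.pi..Real.pi, Vs s t ^ 2)
          + (∫ t in -Real.pi..Real.pi, 2 * V s t * Vs s t)
          + 2 * Real.pi * m ^ 2 - 2 * m * (∫ t in -Real.pi..Real.pi, V s t)
          - 2 * m * (∫ t in -Real.pi..Real.pi, Vs s t) := by
      have ii : ∀ {F : ℝ → ℝ}, Continuous F → IntervalIntegrable F volume (-Real.pi) Real.pi :=
        fun hF => hF.intervalIntegrable _ _
      have i1 := ii (by fun_prop : Continuous fun t => V s t ^ 2)
      have i2 := ii (by fun_prop : Continuous fun t => Vs s t ^ 2)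
      have i3 := ii (by fun_prop : Continuous fun t => 2 * V s t * Vs s t)
      have i4 := ii (by fun_prop : Continuous fun _ => m ^ 2)
      have i5 := ii (by fun_prop : Continuous fun t => 2 * m * V s t)
      have i6 := ii (by fun_prop : Continuous fun t => 2 * m * Vs s t)
      have e1 : ∀ t, (V s t - m + Vs s t) ^ 2 = V s t ^ 2 + Vs s t ^ 2 + 2 * V s t * Vs s t + m ^ 2
          - 2 * m * V s t - 2 * m * Vs s t := fun t => by ring
      simp only [e1]
      rw [intervalIntegral.integral_sub (((((i1.add i2).add i3).add i4).sub i5)) i6,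
        intervalIntegral.integral_sub ((((i1.add i2).add i3).add i4)) i5,
        intervalIntegral.integral_add (((i1.add i2).add i3)) i4,
        intervalIntegral.integral_add ((i1.add i2)) i3,
        intervalIntegral.integral_add i1 i2, intervalIntegral.integral_const_mul,
        intervalIntegral.integral_const_mul, intervalIntegral.integral_const, smul_eq_mul]
      ring
    rw [intervalIntegral.integral_add ((cVs.fun_pow 2).intervalIntegrable _ _)
      ((cVt.fun_pow 2).intervalIntegrable _ _)]
    have hI : (∫ t in -Real.pi..Real.pi, V s t) = 2 * Real.pi * m := by
      rw [hm]; field_simp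
    rw [e, hI] at h0
    rw [hI] at hW ⊢
    have e2 : (2 * Real.pi * m) ^ 2 / (2 * Real.pi) = 2 * Real.pi * m ^ 2 := by field_simp
    have e3 : 2 * (2 * Real.pi * m) * (∫ t in -Real.pi..Real.pi, Vs s t) / (2 * Real.pi)
        = 2 * m * ∫ t in -Real.pi..Real.pi, Vs s t := by field_simp
    rw [e2] at hW
    rw [e3]
    linarith
  have := intervalIntegral.sub_le_integral_of_hasDeriv_right_of_le hS hE.neg.continuousOn
    (fun x hx => (hderiv x hx.1).neg.hasDerivWithinAt)
    ((intervalIntegral.continuous_parametric_intervalIntegral_of_continuous' hD (-Real.pi)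
      Real.pi).continuousOn.integrableOn_Icc) (fun x hx => key x hx.1)
  simp only [Pi.neg_apply] at this
  linarith

/-- The closed right half-plane. -/
def rightHalfPlane : Set ℂ := {w | 0 ≤ w.re}

theorem rightHalfPlane_mem_nhds {w : ℂ} (hw : 0 < w.re) : rightHalfPlane ∈ 𝓝 w :=
  mem_of_superset ((isOpen_lt continuous_const Complex.continuous_re).mem_nhds hw)
    fun w (h : 0 < w.re) => h.le

theorem uniqueDiffOn_rightHalfPlane : UniqueDiffOn ℝ rightHalfPlane := by
  refine uniqueDiffOn_convex (convex_halfSpace_re_ge 0) ⟨1, ?_⟩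
  exact mem_interior_iff_mem_nhds.2 (rightHalfPlane_mem_nhds (by simp))

theorem sq_norm_gradient (f : ℂ → ℝ) (w : ℂ) :
    ‖gradient f w‖ ^ 2 = fderiv ℝ f w 1 ^ 2 + fderiv ℝ f w Complex.I ^ 2 := by
  rw [← inner_gradient_left, ← inner_gradient_left, Complex.inner, Complex.inner, Complex.sq_norm,
    Complex.normSq_apply]
  simp
  ring

section HalfCylinder

variable {v : ℂ → ℝ}

/-- Clamping s at 0 freezes the boundary values for s < 0, which turns data on the closed half-plane
into functions continuous on all of ℝ². -/
theorem continuous_fderivWithin_clamp (hv : ContDiffOn ℝ 1 v rightHalfPlane) (e : ℂ) :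
    Continuous (fun s t : ℝ =>
      fderivWithin ℝ v rightHalfPlane ((max s 0 : ℝ) + t * Complex.I) e).uncurry := by
  have h := (hv.continuousOn_fderivWithin uniqueDiffOn_rightHalfPlane le_rfl).clm_apply
    (continuousOn_const (c := e))
  exact h.comp_continuous (f := fun p : ℝ × ℝ => ((max p.1 0 : ℝ) : ℂ) + p.2 * Complex.I)
    (by fun_prop) (fun p => by simp [rightHalfPlane])

theorem continuous_clamp (hv : ContinuousOn v rightHalfPlane) :
    Continuous (fun s t : ℝ => v ((max s 0 : ℝ) + t * Complex.I)).uncurry :=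
  hv.comp_continuous (f := fun p : ℝ × ℝ => ((max p.1 0 : ℝ) : ℂ) + p.2 * Complex.I)
    (by fun_prop) (fun p => by simp [rightHalfPlane])

theorem hasFDerivAt_of_re_pos (hv : ContDiffOn ℝ 1 v rightHalfPlane) {w : ℂ} (hw : 0 < w.re) :
    HasFDerivAt v (fderiv ℝ v w) w :=
  ((hv.contDiffAt (rightHalfPlane_mem_nhds hw)).differentiableAt one_ne_zero).hasFDerivAt

theorem hasDerivAt_clamp_fst (hv : ContDiffOn ℝ 1 v rightHalfPlane) {s : ℝ} (hs : 0 < s) (t : ℝ) :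
    HasDerivAt (fun s : ℝ => v ((max s 0 : ℝ) + t * Complex.I))
      (fderivWithin ℝ v rightHalfPlane ((max s 0 : ℝ) + t * Complex.I) 1) s := by
  have hre : 0 < ((s : ℂ) + t * Complex.I).re := by simpa using hs
  rw [max_eq_left hs.le, fderivWithin_of_mem_nhds (rightHalfPlane_mem_nhds hre)]
  have h1 : HasDerivAt (fun s : ℝ => (s : ℂ) + t * Complex.I) 1 s :=
    (Complex.ofRealCLM.hasDerivAt (x := s)).add_const _
  refine ((hasFDerivAt_of_re_pos hv hre).comp_hasDerivAt s h1).congr_of_eventuallyEq ?_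
  filter_upwards [Ioi_mem_nhds hs] with x hx
  simp [max_eq_left (le_of_lt (Set.mem_Ioi.1 hx))]

theorem hasDerivAt_clamp_snd (hv : ContDiffOn ℝ 1 v rightHalfPlane) {s : ℝ} (hs : 0 < s) (t : ℝ) :
    HasDerivAt (fun t : ℝ => v ((max s 0 : ℝ) + t * Complex.I))
      (fderivWithin ℝ v rightHalfPlane ((max s 0 : ℝ) + t * Complex.I) Complex.I) t := by
  have hre : 0 < ((s : ℂ) + t * Complex.I).re := by simpa using hs
  rw [max_eq_left hs.le, fderivWithin_of_mem_nhds (rightHalfPlane_mem_nhds hre)]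
  have h1 : HasDerivAt (fun t : ℝ => (s : ℂ) + t * Complex.I) Complex.I t := by
    simpa using ((Complex.ofRealCLM.hasDerivAt (x := t)).mul_const Complex.I).const_add (s : ℂ)
  exact (hasFDerivAt_of_re_pos hv hre).comp_hasDerivAt t h1

/-- The fundamental domain `0 < Re w ≤ S`, `-π < Im w ≤ π` of a half-cylinder. -/
def cylinderRect (S : ℝ) : Set ℂ := Set.Ioc 0 S ×ℂ Set.Ioc (-Real.pi) Real.pi

theorem measurableSet_cylinderRect (S : ℝ) : MeasurableSet (cylinderRect S) :=
  (measurableSet_Ioc.preimage Complex.measurable_re).inter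
    (measurableSet_Ioc.preimage Complex.measurable_im)

theorem integrableOn_cylinderRect {S : ℝ} {F G : ℂ → ℝ} (hF : ContinuousOn F rightHalfPlane)
    (hFG : ∀ w, 0 < w.re → F w = G w) : IntegrableOn G (cylinderRect S) := by
  have hK : IsCompact (Set.Icc 0 S ×ℂ Set.Icc (-Real.pi) Real.pi) :=
    IsCompact.reProdIm isCompact_Icc isCompact_Icc
  have h1 := (hF.mono (fun w (hw : w ∈ Set.Icc 0 S ×ℂ Set.Icc (-Real.pi) Real.pi) =>
    hw.1.1)).integrableOn_compact (μ := volume) hK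
  refine (h1.mono_set fun w hw => ⟨Set.Ioc_subset_Icc_self hw.1,
    Set.Ioc_subset_Icc_self hw.2⟩).congr_fun ?_ (measurableSet_cylinderRect S)
  exact fun w hw => hFG w hw.1.1

theorem deviation_sub_le_setIntegral (hv : ContDiffOn ℝ 1 v rightHalfPlane)
    (hper : ∀ w, v (w + 2 * Real.pi * Complex.I) = v w) {S : ℝ} (hS : 0 ≤ S) :
    deviation (fun t => v (t * Complex.I)) - deviation (fun t => v (S + t * Complex.I))
      ≤ ∫ w in cylinderRect S, ‖gradient v w‖ ^ 2 := by
  have hpi := Real.pi_pos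
  have h := deviation_sub_le_of_hasDerivAt (continuous_clamp hv.continuousOn)
    (continuous_fderivWithin_clamp hv 1) (continuous_fderivWithin_clamp hv Complex.I)
    (fun s hs t => hasDerivAt_clamp_fst hv hs t) (fun s hs t => hasDerivAt_clamp_snd hv hs t)
    (fun s hs => by
      rw [← hper ((max s 0 : ℝ) + (-Real.pi : ℝ) * Complex.I)]
      congr 1; push_cast; ring) hS
  have hFint : IntegrableOn (fun w => ‖gradient v w‖ ^ 2) (cylinderRect S) := by
    refine integrableOn_cylinderRect (F := fun w => fderivWithin ℝ v rightHalfPlane w 1 ^ 2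
      + fderivWithin ℝ v rightHalfPlane w Complex.I ^ 2) ?_ ?_
    · have h := hv.continuousOn_fderivWithin uniqueDiffOn_rightHalfPlane le_rfl
      exact ((h.clm_apply continuousOn_const).pow 2).add ((h.clm_apply continuousOn_const).pow 2)
    · intro w hw
      rw [sq_norm_gradient, fderivWithin_of_mem_nhds (rightHalfPlane_mem_nhds hw)]
  rw [cylinderRect, setIntegral_reProdIm hS (by linarith) hFint]
  simp only [max_self, max_eq_left hS, Complex.ofReal_zero, zero_add] at h
  refine h.trans (le_of_eq ?_)
  refine intervalIntegral.integral_congr_ae (Eventually.of_forall fun s hs => ?_)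
  rw [Set.uIoc_of_le hS] at hs
  refine intervalIntegral.integral_congr fun t _ => ?_
  have hre : 0 < ((s : ℂ) + t * Complex.I).re := by simpa using hs.1
  simp only [max_eq_left hs.1.le, sq_norm_gradient,
    fderivWithin_of_mem_nhds (rightHalfPlane_mem_nhds hre)]

end HalfCylinder

/-! ### Arclength of regular curves as Hausdorff measure -/

/-- Strict differentiability: near x the curve is, up to a factor K in both directions, a similarity
of ratio |γ'(x)|, and the speed is nearly constant. -/
theorem exists_nhds_bilipschitz {γ : ℝ → ℂ} {γ' : ℝ → ℂ} (hγ : ∀ t, HasDerivAt γ (γ' t) t)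
    (hc : Continuous γ') (h0 : ∀ t, γ' t ≠ 0) {K : ℝ} (hK : 1 < K) (x : ℝ) :
    ∃ U ∈ 𝓝 x, (∀ y ∈ U, ∀ z ∈ U, ‖γ y - γ z‖ ≤ K * ‖γ' x‖ * ‖y - z‖ ∧
      ‖γ' x‖ * ‖y - z‖ ≤ K * ‖γ y - γ z‖) ∧
      ∀ y ∈ U, ‖γ' y‖ ≤ K * ‖γ' x‖ ∧ ‖γ' x‖ ≤ K * ‖γ' y‖ := by
  have hK0 : 0 < K := by linarith
  have hcx : 0 < ‖γ' x‖ := norm_pos_iff.2 (h0 x)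
  have hstrict : HasStrictDerivAt γ (γ' x) x :=
    hasStrictDerivAt_of_hasDerivAt_of_continuousAt (Eventually.of_forall hγ) hc.continuousAt
  -- This tolerance makes the lower Lipschitz constant exactly |γ'(x)|/K; the upper one, (2 -
  -- 1/K)|γ'(x)|, is at most K|γ'(x)| because K + 1/K ≥ 2.
  have hε : 0 < (1 - K⁻¹) * ‖γ' x‖ := mul_pos (by linarith [inv_lt_one_of_one_lt₀ hK]) hcx
  have h1 := hstrict.hasStrictFDerivAt.isLittleO.def hε
  rw [nhds_prod_eq, eventually_prod_self_iff'] at h1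
  have h2 : ∀ᶠ y in 𝓝 x, ‖γ' y‖ < K * ‖γ' x‖ :=
    hc.norm.continuousAt.eventually_lt continuousAt_const (by nlinarith)
  have h3 : ∀ᶠ y in 𝓝 x, ‖γ' x‖ < K * ‖γ' y‖ :=
    continuousAt_const.eventually_lt (hc.norm.const_mul K).continuousAt (by nlinarith)
  obtain ⟨U, hU, hU'⟩ := h1
  refine ⟨U ∩ {y | ‖γ' y‖ < K * ‖γ' x‖ ∧ ‖γ' x‖ < K * ‖γ' y‖}, inter_mem hU (h2.and h3), ?_,
    fun y hy => ⟨hy.2.1.le, hy.2.2.le⟩⟩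
  intro y hy z hz
  have h := hU' y hy.1 z hz.1
  dsimp only at h
  have e : ‖(ContinuousLinearMap.toSpanSingleton ℝ (γ' x)) (y - z)‖ = ‖γ' x‖ * ‖y - z‖ := by
    rw [ContinuousLinearMap.toSpanSingleton_apply, norm_smul, mul_comm]
  have h4 := norm_sub_norm_le (γ y - γ z) ((ContinuousLinearMap.toSpanSingleton ℝ (γ' x)) (y - z))
  have h5 := norm_sub_norm_le ((ContinuousLinearMap.toSpanSingleton ℝ (γ' x)) (y - z)) (γ y - γ z)
  rw [norm_sub_rev _ (γ y - γ z)] at h5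
  rw [e] at h4 h5
  have hd : 0 ≤ ‖γ' x‖ * ‖y - z‖ := by positivity
  have hKK : 2 - K⁻¹ ≤ K := by
    have : K * K⁻¹ = 1 := mul_inv_cancel₀ hK0.ne'
    nlinarith [sq_nonneg (K - 1), inv_pos.2 hK0]
  constructor
  · have : ‖γ y - γ z‖ ≤ (2 - K⁻¹) * (‖γ' x‖ * ‖y - z‖) := by linarith
    calc _ ≤ _ := this
      _ ≤ K * (‖γ' x‖ * ‖y - z‖) := mul_le_mul_of_nonneg_right hKK hd
      _ = _ := by ring
  · have : K⁻¹ * (‖γ' x‖ * ‖y - z‖) ≤ ‖γ y - γ z‖ := by linarith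
    calc _ = K * (K⁻¹ * (‖γ' x‖ * ‖y - z‖)) := by rw [mul_inv_cancel_left₀ hK0.ne']
      _ ≤ _ := mul_le_mul_of_nonneg_left this hK0.le

theorem hausdorffMeasure_image_le_of_norm_sub_le {E F : Type*} [NormedAddCommGroup E]
    [MeasurableSpace E] [BorelSpace E] [NormedAddCommGroup F] [MeasurableSpace F] [BorelSpace F]
    {f : E → F} {A : Set E} {c : ℝ} (hc : 0 ≤ c)
    (h : ∀ y ∈ A, ∀ z ∈ A, ‖f y - f z‖ ≤ c * ‖y - z‖) :
    μH[1] (f '' A) ≤ ENNReal.ofReal c * μH[1] A := by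
  have hL : LipschitzOnWith c.toNNReal f A := LipschitzOnWith.of_dist_le_mul fun y hy z hz => by
    rw [dist_eq_norm, dist_eq_norm, Real.coe_toNNReal _ hc]
    exact h y hy z hz
  have := hL.hausdorffMeasure_image_le zero_le_one
  rwa [ENNReal.rpow_one] at this

/-- Both quantities are compared with |γ'(x)| times the Lebesgue measure of A, each at the cost of a
factor K; the lower bound on the image uses the Lipschitz inverse. -/
theorem hausdorffMeasure_image_comparable {γ : ℝ → ℂ} {γ' : ℝ → ℂ} {U A : Set ℝ} {x K : ℝ}
    (hK : 1 < K) (hx : 0 < ‖γ' x‖) (hA : MeasurableSet A) (hAU : A ⊆ U)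
    (h1 : ∀ y ∈ U, ∀ z ∈ U, ‖γ y - γ z‖ ≤ K * ‖γ' x‖ * ‖y - z‖ ∧
      ‖γ' x‖ * ‖y - z‖ ≤ K * ‖γ y - γ z‖)
    (h2 : ∀ y ∈ U, ‖γ' y‖ ≤ K * ‖γ' x‖ ∧ ‖γ' x‖ ≤ K * ‖γ' y‖) :
    μH[1] (γ '' A) ≤ ENNReal.ofReal K ^ 2 * ∫⁻ t in A, ‖γ' t‖ₑ ∧
      ∫⁻ t in A, ‖γ' t‖ₑ ≤ ENNReal.ofReal K ^ 2 * μH[1] (γ '' A) := by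
  have hK0 : 0 < K := by linarith
  set c := ‖γ' x‖
  have a1 : μH[1] (γ '' A) ≤ ENNReal.ofReal K * (ENNReal.ofReal c * volume A) := by
    have := hausdorffMeasure_image_le_of_norm_sub_le (f := γ) (A := A) (c := K * c) (by positivity)
      fun y hy z hz => (h1 y (hAU hy) z (hAU hz)).1
    rwa [hausdorffMeasure_real, ENNReal.ofReal_mul hK0.le, mul_assoc] at this
  have hinj : Set.InjOn γ A := by
    intro y hy z hz hyz
    have := (h1 y (hAU hy) z (hAU hz)).2
    rw [hyz, sub_self, norm_zero, mul_zero] at this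
    have h := nonpos_of_mul_nonpos_right this hx
    exact sub_eq_zero.1 (norm_le_zero_iff.1 h)
  have a2 : ENNReal.ofReal c * volume A ≤ ENNReal.ofReal K * μH[1] (γ '' A) := by
    have := hausdorffMeasure_image_le_of_norm_sub_le (f := Function.invFunOn γ A) (A := γ '' A)
      (c := K / c) (by positivity) (by
        rintro _ ⟨y, hy, rfl⟩ _ ⟨z, hz, rfl⟩
        rw [hinj.leftInvOn_invFunOn hy, hinj.leftInvOn_invFunOn hz, div_mul_eq_mul_div,
          le_div_iff₀ hx, mul_comm]
        exact (h1 y (hAU hy) z (hAU hz)).2)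
    rw [hinj.leftInvOn_invFunOn.image_image, hausdorffMeasure_real] at this
    calc _ ≤ ENNReal.ofReal c * (ENNReal.ofReal (K / c) * μH[1] (γ '' A)) := by gcongr
      _ = _ := by
        rw [← mul_assoc, ← ENNReal.ofReal_mul hx.le, mul_div_cancel₀ _ hx.ne']
  have a3 : ∫⁻ t in A, ‖γ' t‖ₑ ≤ ENNReal.ofReal K * (ENNReal.ofReal c * volume A) := by
    calc _ ≤ ∫⁻ _ in A, ENNReal.ofReal K * ENNReal.ofReal c :=
          setLIntegral_mono' hA fun t ht => by
            rw [← ENNReal.ofReal_mul hK0.le, ← ofReal_norm]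
            exact ENNReal.ofReal_le_ofReal (h2 t (hAU ht)).1
      _ = _ := by rw [setLIntegral_const, mul_assoc]
  have a4 : ENNReal.ofReal c * volume A ≤ ENNReal.ofReal K * ∫⁻ t in A, ‖γ' t‖ₑ := by
    rw [← lintegral_const_mul' _ _ ENNReal.ofReal_ne_top, ← setLIntegral_const]
    refine setLIntegral_mono' hA fun t ht => ?_
    rw [← ofReal_norm, ← ENNReal.ofReal_mul hK0.le]
    exact ENNReal.ofReal_le_ofReal (h2 t (hAU ht)).2
  constructor
  · calc _ ≤ _ := a1
      _ ≤ ENNReal.ofReal K * (ENNReal.ofReal K * ∫⁻ t in A, ‖γ' t‖ₑ) := by gcongr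
      _ = _ := by rw [← mul_assoc, sq]
  · calc _ ≤ _ := a3
      _ ≤ ENNReal.ofReal K * (ENNReal.ofReal K * μH[1] (γ '' A)) := by gcongr
      _ = _ := by rw [← mul_assoc, sq]

theorem le_of_forall_one_lt_ofReal_sq_mul {a b : ℝ≥0∞}
    (h : ∀ K : ℝ, 1 < K → a ≤ ENNReal.ofReal K ^ 2 * b) : a ≤ b := by
  have ht : Tendsto (fun K : ℝ => ENNReal.ofReal K ^ 2 * b) (𝓝[>] 1) (𝓝 (ENNReal.ofReal 1 ^ 2 * b)) :=
    ENNReal.Tendsto.mul_const (((ENNReal.continuous_pow 2).comp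
      ENNReal.continuous_ofReal).continuousWithinAt) (Or.inl (by simp))
  rw [ENNReal.ofReal_one, one_pow, one_mul] at ht
  exact ge_of_tendsto ht (eventually_mem_nhdsWithin.mono fun K hK => h K hK)

/-- The length of an injective regular `C¹` curve, restricted to a measurable set of parameters. -/
theorem hausdorffMeasure_image_curve {γ : ℝ → ℂ} {γ' : ℝ → ℂ} (hγ : ∀ t, HasDerivAt γ (γ' t) t)
    (hc : Continuous γ') (h0 : ∀ t, γ' t ≠ 0) {A : Set ℝ} (hA : MeasurableSet A)
    (hinj : Set.InjOn γ A) : μH[1] (γ '' A) = ∫⁻ t in A, ‖γ' t‖ₑ := by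
  have hγc : Continuous γ := continuous_iff_continuousAt.2 fun t => (hγ t).continuousAt
  suffices H : ∀ K : ℝ, 1 < K → μH[1] (γ '' A) ≤ ENNReal.ofReal K ^ 2 * ∫⁻ t in A, ‖γ' t‖ₑ ∧
      ∫⁻ t in A, ‖γ' t‖ₑ ≤ ENNReal.ofReal K ^ 2 * μH[1] (γ '' A) from
    le_antisymm (le_of_forall_one_lt_ofReal_sq_mul fun K hK => (H K hK).1)
      (le_of_forall_one_lt_ofReal_sq_mul fun K hK => (H K hK).2)
  intro K hK
  choose U hU hU1 hU2 using exists_nhds_bilipschitz hγ hc h0 hK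
  obtain ⟨s, hs, hcov⟩ := TopologicalSpace.countable_cover_nhds
    (f := fun x => interior (U x)) (fun x => interior_mem_nhds.2 (hU x))
  have hne : s.Nonempty := by
    rcases s.eq_empty_or_nonempty with rfl | h
    · simp only [Set.biUnion_empty] at hcov
      exact absurd (hcov ▸ Set.mem_univ (0 : ℝ)) (Set.notMem_empty _)
    · exact h
  obtain ⟨u, rfl⟩ := hs.exists_eq_range hne
  rw [Set.biUnion_range] at hcov
  -- The countably many good neighbourhoods are made disjoint, so that both sides are countably
  -- additive over the pieces and K can tend to 1 afterwards.
  set D : ℕ → Set ℝ := fun n => A ∩ disjointed (fun n => interior (U (u n))) n with hD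
  have hDm : ∀ n, MeasurableSet (D n) := fun n =>
    hA.inter (MeasurableSet.disjointed (fun _ => isOpen_interior.measurableSet) n)
  have hDd : Pairwise (Function.onFun Disjoint D) := fun i j hij =>
    (disjoint_disjointed (fun n => interior (U (u n))) hij).mono Set.inter_subset_right
      Set.inter_subset_right
  have hDA : ⋃ n, D n = A := by
    rw [hD, ← Set.inter_iUnion, iUnion_disjointed, hcov, Set.inter_univ]
  have hDU : ∀ n, D n ⊆ U (u n) := fun n =>
    Set.inter_subset_right.trans ((disjointed_subset _ n).trans interior_subset)
  have hcomp := fun n => hausdorffMeasure_image_comparable hK (norm_pos_iff.2 (h0 (u n))) (hDm n)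
    (hDU n) (hU1 (u n)) (hU2 (u n))
  have e1 : μH[1] (γ '' A) = ∑' n, μH[1] (γ '' D n) := by
    rw [← hDA, Set.image_iUnion, measure_iUnion]
    · intro i j hij
      exact (hDd hij).image hinj (hDA ▸ Set.subset_iUnion D i) (hDA ▸ Set.subset_iUnion D j)
    · exact fun n => (hDm n).image_of_continuousOn_injOn hγc.continuousOn
        (hinj.mono (hDA ▸ Set.subset_iUnion D n))
  have e2 : ∫⁻ t in A, ‖γ' t‖ₑ = ∑' n, ∫⁻ t in D n, ‖γ' t‖ₑ := by
    rw [← hDA, lintegral_iUnion hDm hDd]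
  rw [e1, e2, ← ENNReal.tsum_mul_left, ← ENNReal.tsum_mul_left]
  exact ⟨ENNReal.tsum_le_tsum fun n => (hcomp n).1, ENNReal.tsum_le_tsum fun n => (hcomp n).2⟩

/-- Arclength on an injective regular `C¹` curve is the image of `‖γ'‖ dt`. -/
theorem restrict_hausdorffMeasure_image_curve {γ : ℝ → ℂ} {γ' : ℝ → ℂ}
    (hγ : ∀ t, HasDerivAt γ (γ' t) t) (hc : Continuous γ') (h0 : ∀ t, γ' t ≠ 0) {S : Set ℝ}
    (hS : MeasurableSet S) (hinj : Set.InjOn γ S) :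
    (μH[1]).restrict (γ '' S)
      = Measure.map γ ((volume.restrict S).withDensity fun t => ‖γ' t‖ₑ) := by
  have hγc : Continuous γ := continuous_iff_continuousAt.2 fun t => (hγ t).continuousAt
  ext T hT
  rw [Measure.restrict_apply hT, Measure.map_apply hγc.measurable hT,
    withDensity_apply _ (hγc.measurable hT), Measure.restrict_restrict (hγc.measurable hT),
    Set.inter_comm, ← Set.image_inter_preimage, Set.inter_comm,
    hausdorffMeasure_image_curve hγ hc h0 ((hγc.measurable hT).inter hS)
      (hinj.mono Set.inter_subset_right)]

/-- The curve is a measurable embedding only on S. Passing to the subtype lets the change of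
variables hold for arbitrary integrands, with no measurability hypothesis. -/
theorem restrict_hausdorffMeasure_image_curve_eq_map_domRestrict {γ : ℝ → ℂ} {γ' : ℝ → ℂ}
    (hγ : ∀ t, HasDerivAt γ (γ' t) t) (hc : Continuous γ') (h0 : ∀ t, γ' t ≠ 0) {S : Set ℝ}
    (hS : MeasurableSet S) (hinj : Set.InjOn γ S) :
    (μH[1]).restrict (γ '' S) = Measure.map (S.domRestrict γ)
      (Measure.comap Subtype.val ((volume.restrict S).withDensity fun t => ‖γ' t‖ₑ)) := by
  have hγc : Continuous γ := continuous_iff_continuousAt.2 fun t => (hγ t).continuousAt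
  rw [restrict_hausdorffMeasure_image_curve hγ hc h0 hS hinj, Set.domRestrict_eq,
    ← Measure.map_map hγc.measurable measurable_subtype_coe, map_comap_subtype_coe hS,
    restrict_withDensity hS, Measure.restrict_restrict hS, Set.inter_self]

theorem setIntegral_image_curve {γ : ℝ → ℂ} {γ' : ℝ → ℂ}
    (hγ : ∀ t, HasDerivAt γ (γ' t) t) (hc : Continuous γ') (h0 : ∀ t, γ' t ≠ 0) {S : Set ℝ}
    (hS : MeasurableSet S) (hinj : Set.InjOn γ S) (f : ℂ → ℝ) :
    ∫ z in γ '' S, f z ∂μH[1] = ∫ t in S, ‖γ' t‖ * f (γ t) := by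
  have hγc : Continuous γ := continuous_iff_continuousAt.2 fun t => (hγ t).continuousAt
  rw [restrict_hausdorffMeasure_image_curve_eq_map_domRestrict hγ hc h0 hS hinj,
    (hγc.continuousOn.measurableEmbedding hS hinj).integral_map]
  refine ((MeasurableEmbedding.subtype_coe hS).integral_map (fun t => f (γ t))).symm.trans ?_
  rw [map_comap_subtype_coe hS]
  change ∫ t in S, f (γ t) ∂((volume.restrict S).withDensity fun t => (‖γ' t‖₊ : ℝ≥0∞)) = _
  rw [setIntegral_withDensity_eq_setIntegral_smul hc.measurable.nnnorm _ hS,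
    Measure.restrict_restrict hS, Set.inter_self]
  rfl

theorem integrableOn_image_curve {γ : ℝ → ℂ} {γ' : ℝ → ℂ}
    (hγ : ∀ t, HasDerivAt γ (γ' t) t) (hc : Continuous γ') (h0 : ∀ t, γ' t ≠ 0) {S : Set ℝ}
    (hS : MeasurableSet S) (hinj : Set.InjOn γ S) (f : ℂ → ℝ) :
    IntegrableOn f (γ '' S) μH[1] ↔ IntegrableOn (fun t => ‖γ' t‖ * f (γ t)) S := by
  have hγc : Continuous γ := continuous_iff_continuousAt.2 fun t => (hγ t).continuousAt
  rw [IntegrableOn, restrict_hausdorffMeasure_image_curve_eq_map_domRestrict hγ hc h0 hS hinj,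
    (hγc.continuousOn.measurableEmbedding hS hinj).integrable_map_iff]
  change Integrable ((fun t => f (γ t)) ∘ Subtype.val) _ ↔ _
  rw [← (MeasurableEmbedding.subtype_coe hS).integrable_map_iff, map_comap_subtype_coe hS,
    restrict_withDensity hS, Measure.restrict_restrict hS, Set.inter_self]
  exact integrable_withDensity_iff_integrable_smul hc.measurable.nnnorm

/-! ### The circle and the punctured disk as a half-cylinder -/

/-- The unit circle is parametrized by the angle in `(-π, π]`. -/
theorem image_exp_mul_I_Ioc :
    (fun t : ℝ => Complex.exp (t * Complex.I)) '' Set.Ioc (-Real.pi) Real.pi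
      = Metric.sphere 0 1 := by
  ext z
  simp only [Set.mem_image, mem_sphere_zero_iff_norm]
  constructor
  · rintro ⟨t, -, rfl⟩
    exact Complex.norm_exp_ofReal_mul_I t
  · intro hz
    refine ⟨z.arg, Complex.arg_mem_Ioc z, ?_⟩
    simpa [hz] using Complex.norm_mul_exp_arg_mul_I z

theorem hasDerivAt_exp_mul_I (t : ℝ) : HasDerivAt (fun t : ℝ => Complex.exp (t * Complex.I))
    (Complex.exp (t * Complex.I) * Complex.I) t := by
  have h : HasDerivAt (fun t : ℝ => (t : ℂ) * Complex.I) Complex.I t := by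
    simpa using (Complex.ofRealCLM.hasDerivAt (x := t)).mul_const Complex.I
  exact h.cexp

theorem injOn_exp_mul_I :
    Set.InjOn (fun t : ℝ => Complex.exp (t * Complex.I)) (Set.Ioc (-Real.pi) Real.pi) := by
  intro s hs t ht h
  have h1 := congrArg Complex.arg h
  simpa only [Complex.arg_exp_mul_I, (toIocMod_eq_self _).2 (by
    rwa [show -Real.pi + 2 * Real.pi = Real.pi by ring] : s ∈ Set.Ioc (-Real.pi) (-Real.pi + 2 * Real.pi)),
    (toIocMod_eq_self _).2 (by
    rwa [show -Real.pi + 2 * Real.pi = Real.pi by ring] : t ∈ Set.Ioc (-Real.pi) (-Real.pi + 2 * Real.pi))]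
    using h1

theorem integral_sphere_eq (f : ℂ → ℝ) :
    ∫ z in Metric.sphere (0 : ℂ) 1, f z ∂μH[1]
      = ∫ t in -Real.pi..Real.pi, f (Complex.exp (t * Complex.I)) := by
  rw [← image_exp_mul_I_Ioc, setIntegral_image_curve hasDerivAt_exp_mul_I (by fun_prop) (by simp)
    measurableSet_Ioc injOn_exp_mul_I, intervalIntegral.integral_of_le (by linarith [Real.pi_pos])]
  simp

theorem hausdorffMeasure_sphere_ne_top : μH[1] (Metric.sphere (0 : ℂ) 1) ≠ ⊤ := by
  rw [← image_exp_mul_I_Ioc, hausdorffMeasure_image_curve hasDerivAt_exp_mul_I (by fun_prop)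
    (by simp) measurableSet_Ioc injOn_exp_mul_I]
  simp [← ofReal_norm]

theorem deviation_const (c : ℝ) : deviation (fun _ => c) = 0 := by
  have := Real.pi_pos
  simp only [deviation, intervalIntegral.integral_const, smul_eq_mul]
  field_simp
  ring

/-- Needed because exp(-w) runs around the circle backwards. -/
theorem deviation_comp_neg (f : ℝ → ℝ) : deviation (fun t => f (-t)) = deviation f := by
  simp only [deviation]
  rw [intervalIntegral.integral_comp_neg (fun t => f t),
    intervalIntegral.integral_comp_neg (fun t => f t ^ 2), neg_neg]

theorem continuous_deviation {F : ℝ → ℝ → ℝ} (hF : Continuous F.uncurry) :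
    Continuous fun s => deviation (F s) :=
  (intervalIntegral.continuous_parametric_intervalIntegral_of_continuous'
    (f := fun s t => F s t ^ 2) (hF.fun_pow 2) _ _).sub
    (((intervalIntegral.continuous_parametric_intervalIntegral_of_continuous' hF _ _).pow
      2).div_const _)

theorem deviation_exp_mul_I (f : ℂ → ℝ) : deviation (fun t => f (Complex.exp (t * Complex.I)))
    = (∫ z in Metric.sphere (0 : ℂ) 1, f z ^ 2 ∂μH[1])
      - (∫ z in Metric.sphere (0 : ℂ) 1, f z ∂μH[1]) ^ 2 / (2 * Real.pi) := by
  rw [integral_sphere_eq, integral_sphere_eq, deviation]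

/-- The map `w ↦ exp (-w)` from the right half-plane onto the punctured unit disk. -/
def expNeg (w : ℂ) : ℂ := Complex.exp (-w)

theorem norm_expNeg (w : ℂ) : ‖expNeg w‖ = Real.exp (-w.re) := by
  simp [expNeg, Complex.norm_exp]

theorem hasDerivAt_expNeg (w : ℂ) : HasDerivAt expNeg (-expNeg w) w := by
  have : HasDerivAt (fun x => Complex.exp (-x)) (Complex.exp (-w) * -1) w :=
    (hasDerivAt_neg w).cexp
  rwa [mul_neg_one] at this

theorem contDiff_expNeg : ContDiff ℝ ∞ expNeg :=
  ((Complex.contDiff_exp (𝕜 := ℂ)).comp contDiff_neg).restrict_scalars ℝ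

theorem expNeg_add_two_pi_mul_I (w : ℂ) : expNeg (w + 2 * Real.pi * Complex.I) = expNeg w := by
  rw [expNeg, neg_add, ← sub_eq_add_neg, Complex.exp_sub, Complex.exp_two_pi_mul_I, div_one, expNeg]

theorem mapsTo_expNeg_rightHalfPlane :
    Set.MapsTo expNeg rightHalfPlane (Metric.closedBall 0 1) := by
  intro w hw
  rw [mem_closedBall_zero_iff, norm_expNeg, Real.exp_le_one_iff]
  exact neg_nonpos.2 hw

theorem injOn_exp_im_Ioc {s : Set ℂ} (hs : ∀ w ∈ s, w.im ∈ Set.Ioc (-Real.pi) Real.pi) :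
    Set.InjOn Complex.exp s := by
  intro a ha b hb h
  rw [← Complex.log_exp (hs a ha).1 (hs a ha).2, h, Complex.log_exp (hs b hb).1 (hs b hb).2]

theorem injOn_expNeg_im_Ioc {s : Set ℂ} (hs : ∀ w ∈ s, w.im ∈ Set.Ioc (-Real.pi) Real.pi) :
    Set.InjOn expNeg s := by
  intro a ha b hb h
  refine injOn_exp_im_Ioc hs ha hb ?_
  rw [expNeg, expNeg, Complex.exp_neg, Complex.exp_neg] at h
  exact inv_injective h

theorem injOn_expNeg (S : ℝ) : Set.InjOn expNeg (cylinderRect S) :=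
  injOn_expNeg_im_Ioc fun _ hw => hw.2

theorem image_expNeg_subset (S : ℝ) : expNeg '' cylinderRect S ⊆ Metric.ball 0 1 := by
  rintro _ ⟨w, hw, rfl⟩
  rw [mem_ball_zero_iff, norm_expNeg, Real.exp_lt_one_iff]
  exact neg_lt_zero.2 hw.1.1

/-! ### The sharp trace inequality on the disk -/

section Disk

variable {f : ℂ → ℝ}

theorem differentiableAt_of_mem_unitDisk (hf : ContDiffOn ℝ 1 f (Metric.closedBall 0 1)) {z : ℂ}
    (hz : z ∈ Metric.ball (0 : ℂ) 1) : DifferentiableAt ℝ f z :=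
  (hf.contDiffAt (mem_of_superset (Metric.isOpen_ball.mem_nhds hz)
    Metric.ball_subset_closedBall)).differentiableAt one_ne_zero

theorem contDiffOn_comp_expNeg (hf : ContDiffOn ℝ 1 f (Metric.closedBall 0 1)) :
    ContDiffOn ℝ 1 (f ∘ expNeg) rightHalfPlane :=
  hf.comp (contDiff_expNeg.of_le (by exact_mod_cast le_top)).contDiffOn mapsTo_expNeg_rightHalfPlane

theorem uniqueDiffOn_closedBall : UniqueDiffOn ℝ (Metric.closedBall (0 : ℂ) 1) :=
  uniqueDiffOn_convex (convex_closedBall 0 1) ⟨0, by simp [interior_closedBall]⟩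

instance : IsFiniteMeasure diskMeasure := ⟨by
  simp [diskMeasure, unitDisk]⟩

instance : IsFiniteMeasure circleMeasure := ⟨by
  simpa [circleMeasure] using hausdorffMeasure_sphere_ne_top.lt_top⟩

theorem memLp_gradient_diskMeasure (hf : ContDiffOn ℝ 1 f (Metric.closedBall 0 1)) :
    MemLp (gradient f) 2 diskMeasure := by
  have hc : ContinuousOn (gradientWithin f (Metric.closedBall 0 1)) (Metric.closedBall 0 1) :=
    (InnerProductSpace.toDual ℝ ℂ).symm.continuous.comp_continuousOn
      (hf.continuousOn_fderivWithin uniqueDiffOn_closedBall le_rfl)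
  have h1 := (memLp_restrict_of_isCompact (p := 2) (μ := volume) (isCompact_closedBall (0 : ℂ) 1)
    (isCompact_closedBall _ _).measure_ne_top hc).mono_measure
      (Measure.restrict_mono Metric.ball_subset_closedBall le_rfl)
  refine (memLp_congr_ae ?_).1 h1
  refine (ae_restrict_iff' Metric.isOpen_ball.measurableSet).2 (Eventually.of_forall fun z hz => ?_)
  rw [gradientWithin, gradient, fderivWithin_of_mem_nhds (mem_of_superset
    (Metric.isOpen_ball.mem_nhds hz) Metric.ball_subset_closedBall)]

theorem memLp_diskMeasure (hf : ContinuousOn f (Metric.closedBall 0 1)) : MemLp f 2 diskMeasure :=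
  (memLp_restrict_of_isCompact (p := 2) (μ := volume) (isCompact_closedBall (0 : ℂ) 1)
    (isCompact_closedBall _ _).measure_ne_top hf).mono_measure
      (Measure.restrict_mono Metric.ball_subset_closedBall le_rfl)

theorem memLp_circleMeasure (hf : ContinuousOn f (Metric.closedBall 0 1)) :
    MemLp f 2 circleMeasure :=
  memLp_restrict_of_isCompact (isCompact_sphere (0 : ℂ) 1) hausdorffMeasure_sphere_ne_top
    (hf.mono Metric.sphere_subset_closedBall)

/-- The circles of radius e^(-S) shrink to the origin, where f becomes constant and the deviation
vanishes. -/
theorem tendsto_deviation_expNeg (hf : ContinuousOn f (Metric.closedBall 0 1)) :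
    Tendsto (fun S : ℝ => deviation fun t => f (expNeg (S + t * Complex.I))) atTop (𝓝 0) := by
  -- The radius is clamped to [0, 1] so that the family is jointly continuous on the whole plane,
  -- including r = 0.
  have hF : Continuous (fun r t : ℝ =>
      f ((max 0 (min r 1) : ℝ) * expNeg (t * Complex.I))).uncurry := by
    refine hf.comp_continuous (f := fun p : ℝ × ℝ =>
      ((max 0 (min p.1 1) : ℝ) : ℂ) * expNeg (p.2 * Complex.I)) ?_ ?_
    · have := contDiff_expNeg.continuous
      fun_prop
    · intro p
      rw [mem_closedBall_zero_iff, norm_mul, norm_expNeg, Complex.norm_real, Real.norm_eq_abs,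
        abs_of_nonneg (le_max_left _ _)]
      simp
  have h1 := (continuous_deviation hF).tendsto 0
  simp only [zero_le_one, inf_of_le_left, max_self, Complex.ofReal_zero, zero_mul,
    deviation_const] at h1
  have h2 := h1.comp (Real.tendsto_exp_atBot.comp tendsto_neg_atTop_atBot)
  refine h2.congr' ?_
  filter_upwards [eventually_ge_atTop 0] with S hS
  simp only [Function.comp_apply]
  congr 1
  ext t
  congr 1
  rw [min_eq_left (Real.exp_le_one_iff.2 (by linarith)), max_eq_right (Real.exp_pos _).le, expNeg,
    expNeg, neg_add, Complex.exp_add]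
  simp

/-- The sharp trace inequality on the disk for functions smooth up to the boundary. -/
theorem integral_circle_sq_sub_le (hf : ContDiffOn ℝ 1 f (Metric.closedBall 0 1)) :
    (∫ z, f z ^ 2 ∂circleMeasure) - (∫ z, f z ∂circleMeasure) ^ 2 / (2 * Real.pi)
      ≤ ∫ z, ‖gradient f z‖ ^ 2 ∂diskMeasure := by
  have hFint : Integrable (fun z => ‖gradient f z‖ ^ 2) diskMeasure :=
    (memLp_gradient_diskMeasure hf).integrable_norm_pow (by norm_num)
  have h1 : ∀ S : ℝ, 0 ≤ S → deviation (fun t => f (expNeg (t * Complex.I)))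
      - deviation (fun t => f (expNeg (S + t * Complex.I)))
      ≤ ∫ z, ‖gradient f z‖ ^ 2 ∂diskMeasure := by
    intro S hS
    refine (deviation_sub_le_setIntegral (contDiffOn_comp_expNeg hf)
      (fun w => by simp only [Function.comp_apply, expNeg_add_two_pi_mul_I]) hS).trans ?_
    rw [← setIntegral_image_sq_gradient (measurableSet_cylinderRect S)
      (fun w _ => hasDerivAt_expNeg w) (injOn_expNeg S) (fun w hw =>
        differentiableAt_of_mem_unitDisk hf (image_expNeg_subset S ⟨w, hw, rfl⟩))]
    exact setIntegral_mono_set hFint (Eventually.of_forall fun z => sq_nonneg _)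
      (image_expNeg_subset S).eventuallyLE
  have h2 := le_of_tendsto (tendsto_const_nhds.sub (tendsto_deviation_expNeg hf.continuousOn))
    ((eventually_ge_atTop 0).mono h1)
  rw [sub_zero] at h2
  refine le_trans (le_of_eq ?_) h2
  rw [circleMeasure, ← deviation_exp_mul_I, ← deviation_comp_neg]
  congr 1
  ext t
  simp [expNeg]

end Disk

/-! ### The circle mean as a bounded functional of f and ∇f -/

/-- A closed-open annulus inside the unit disk, as the image of a cylindrical rectangle. -/
def annulus : Set ℂ := expNeg '' cylinderRect 1

theorem measurableSet_annulus : MeasurableSet annulus :=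
  (measurableSet_cylinderRect 1).image_of_continuousOn_injOn
    contDiff_expNeg.continuous.continuousOn (injOn_expNeg 1)

/-- The coefficient of `f` in the representation of `∫_{∂𝔻} f` as an integral over the disk. -/
def meanWeight : ℂ → ℝ := annulus.indicator fun z => (‖z‖ ^ 2)⁻¹

/-- The coefficient of `∇f` in the representation of `∫_{∂𝔻} f` as an integral over the disk. -/
def meanField : ℂ → ℂ := annulus.indicator fun z => ((1 + Real.log ‖z‖) * (‖z‖ ^ 2)⁻¹) • z

theorem memLp_meanWeight : MemLp meanWeight 2 diskMeasure := by
  refine MemLp.of_bound (Measurable.aestronglyMeasurable ?_) (Real.exp 1 ^ 2)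
    (Eventually.of_forall fun z => ?_)
  · exact (by fun_prop : Measurable fun z : ℂ => (‖z‖ ^ 2)⁻¹).indicator measurableSet_annulus
  · by_cases hz : z ∈ annulus
    · rw [meanWeight, Set.indicator_of_mem hz]
      obtain ⟨w, hw, rfl⟩ := hz
      rw [norm_expNeg, Real.exp_neg, inv_pow, inv_inv, Real.norm_eq_abs, abs_of_pos (by positivity)]
      gcongr
      exact hw.1.2
    · rw [meanWeight, Set.indicator_of_notMem hz, norm_zero]; positivity

theorem memLp_meanField : MemLp meanField 2 diskMeasure := by
  refine MemLp.of_bound (Measurable.aestronglyMeasurable ?_) (Real.exp 1 ^ 2)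
    (Eventually.of_forall fun z => ?_)
  · exact (by fun_prop : Measurable fun z : ℂ =>
      ((1 + Real.log ‖z‖) * (‖z‖ ^ 2)⁻¹) • z).indicator measurableSet_annulus
  · by_cases hz : z ∈ annulus
    · rw [meanField, Set.indicator_of_mem hz]
      obtain ⟨w, hw, rfl⟩ := hz
      have h1 := hw.1.1
      have h2 := hw.1.2
      rw [norm_smul, norm_mul, norm_expNeg, Real.log_exp, Real.exp_neg, inv_pow, inv_inv,
        Real.norm_eq_abs, Real.norm_eq_abs, abs_of_nonneg (by linarith : 0 ≤ 1 + -w.re),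
        abs_of_pos (by positivity : 0 < Real.exp w.re ^ 2)]
      calc (1 + -w.re) * Real.exp w.re ^ 2 * (Real.exp w.re)⁻¹
          ≤ 1 * Real.exp 1 ^ 2 * 1 := by
            gcongr
            · linarith
            · exact inv_le_one_of_one_le₀ (Real.one_le_exp h1.le)
        _ = _ := by ring
    · rw [meanField, Set.indicator_of_notMem hz, norm_zero]; positivity

/-- Integrated in t, the integrand is the s-derivative of (s-1)∫v(s,t)dt. The factor s-1 kills the
end s = 1 and leaves the boundary integral at s = 0. -/
theorem intervalIntegral_halfCylinder {v : ℂ → ℝ} (hv : ContDiffOn ℝ 1 v rightHalfPlane) :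
    ∫ w in cylinderRect 1, (v w - (1 - w.re) * fderiv ℝ v w 1)
      = ∫ t in -Real.pi..Real.pi, v (t * Complex.I) := by
  have hpi := Real.pi_pos
  have hV := continuous_clamp hv.continuousOn
  have hVs := continuous_fderivWithin_clamp hv 1
  set V : ℝ → ℝ → ℝ := fun s t => v ((max s 0 : ℝ) + t * Complex.I) with hVdef
  set Vs : ℝ → ℝ → ℝ := fun s t =>
    fderivWithin ℝ v rightHalfPlane ((max s 0 : ℝ) + t * Complex.I) 1 with hVsdef
  have hFint : IntegrableOn (fun w => v w - (1 - w.re) * fderiv ℝ v w 1) (cylinderRect 1) := by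
    refine integrableOn_cylinderRect (F := fun w => v w - (1 - w.re) *
      fderivWithin ℝ v rightHalfPlane w 1) ?_ ?_
    · have h := hv.continuousOn_fderivWithin uniqueDiffOn_rightHalfPlane le_rfl
      exact hv.continuousOn.sub ((by fun_prop : Continuous fun w : ℂ =>
        1 - w.re).continuousOn.mul (h.clm_apply continuousOn_const))
    · intro w hw
      rw [fderivWithin_of_mem_nhds (rightHalfPlane_mem_nhds hw)]
  have hM : ∀ s > 0, HasDerivAt (fun s => ∫ t in -Real.pi..Real.pi, V s t)
      (∫ t in -Real.pi..Real.pi, Vs s t) s := fun s hs =>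
    hasDerivAt_intervalIntegral_of_continuous (Ioi_mem_nhds hs) hV hVs
      fun x hx t => hasDerivAt_clamp_fst hv hx t
  have cM : Continuous fun s => ∫ t in -Real.pi..Real.pi, V s t :=
    intervalIntegral.continuous_parametric_intervalIntegral_of_continuous' hV _ _
  have cMs : Continuous fun s => ∫ t in -Real.pi..Real.pi, Vs s t :=
    intervalIntegral.continuous_parametric_intervalIntegral_of_continuous' hVs _ _
  have hFTC := intervalIntegral.integral_eq_sub_of_hasDerivAt_of_le zero_le_one
    (f := fun s => (s - 1) * ∫ t in -Real.pi..Real.pi, V s t)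
    (f' := fun s => 1 * (∫ t in -Real.pi..Real.pi, V s t)
      + (s - 1) * ∫ t in -Real.pi..Real.pi, Vs s t)
    (by fun_prop) (fun s hs => ((hasDerivAt_id s).sub_const 1).fun_mul (hM s hs.1))
    ((by fun_prop : Continuous _).intervalIntegrable _ _)
  rw [cylinderRect, setIntegral_reProdIm zero_le_one (by linarith) hFint]
  have e : ∫ t in -Real.pi..Real.pi, v (t * Complex.I) = ∫ t in -Real.pi..Real.pi, V 0 t := by
    simp [hVdef]
  rw [e]
  have e2 : (1 - 1) * (∫ t in -Real.pi..Real.pi, V 1 t)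
      - (0 - 1) * (∫ t in -Real.pi..Real.pi, V 0 t) = ∫ t in -Real.pi..Real.pi, V 0 t := by ring
  rw [← e2, ← hFTC]
  refine intervalIntegral.integral_congr_ae (Eventually.of_forall fun s hs => ?_)
  rw [Set.uIoc_of_le zero_le_one] at hs
  have cV : Continuous (V s) := hV.comp (by fun_prop : Continuous fun t : ℝ => (s, t))
  have cVs : Continuous (Vs s) := hVs.comp (by fun_prop : Continuous fun t : ℝ => (s, t))
  rw [one_mul, ← intervalIntegral.integral_const_mul, ← intervalIntegral.integral_add
    (cV.intervalIntegrable _ _) ((by fun_prop : Continuous fun t =>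
      (s - 1) * Vs s t).intervalIntegrable _ _)]
  refine intervalIntegral.integral_congr fun t _ => ?_
  have hre : 0 < ((s : ℂ) + t * Complex.I).re := by simpa using hs.1
  simp only [hVdef, hVsdef, max_eq_left hs.1.le,
    fderivWithin_of_mem_nhds (rightHalfPlane_mem_nhds hre)]
  simp
  ring

/-- This is the half-cylinder identity transported by exp(-w): there s = -log |z|, the Jacobian is
|z|², and ∂_s becomes minus the radial derivative z·∇. The weights are bounded, being cut off near
the origin, so the right-hand side is continuous in L² × L². -/
theorem integral_circle_eq_integral_disk {f : ℂ → ℝ}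
    (hf : ContDiffOn ℝ 1 f (Metric.closedBall 0 1)) :
    ∫ z, f z ∂circleMeasure
      = ∫ z, meanWeight z * f z + inner ℝ (meanField z) (gradient f z) ∂diskMeasure := by
  have e1 : (fun z => meanWeight z * f z + inner ℝ (meanField z) (gradient f z))
      = annulus.indicator fun z => (‖z‖ ^ 2)⁻¹ * f z
        + inner ℝ (((1 + Real.log ‖z‖) * (‖z‖ ^ 2)⁻¹) • z) (gradient f z) := by
    ext z
    by_cases hz : z ∈ annulus <;> simp [meanWeight, meanField, hz]
  have hsub : annulus ⊆ unitDisk := image_expNeg_subset 1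
  rw [e1, diskMeasure, setIntegral_indicator measurableSet_annulus,
    Set.inter_eq_self_of_subset_right hsub, annulus,
    setIntegral_image_sq_norm (measurableSet_cylinderRect 1) (fun w _ => hasDerivAt_expNeg w)
      (injOn_expNeg 1)]
  have e2 : ∀ w ∈ cylinderRect 1, ‖-expNeg w‖ ^ 2 * ((‖expNeg w‖ ^ 2)⁻¹ * f (expNeg w)
      + inner ℝ (((1 + Real.log ‖expNeg w‖) * (‖expNeg w‖ ^ 2)⁻¹) • expNeg w)
        (gradient f (expNeg w)))
      = (f ∘ expNeg) w - (1 - w.re) * fderiv ℝ (f ∘ expNeg) w 1 := by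
    intro w hw
    have hd := (differentiableAt_of_mem_unitDisk hf
      (image_expNeg_subset 1 ⟨w, hw, rfl⟩)).hasFDerivAt.comp w
        (hasDerivAt_expNeg w).complexToReal_fderiv
    have e3 : fderiv ℝ (f ∘ expNeg) w 1 = - fderiv ℝ f (expNeg w) (expNeg w) := by
      rw [hd.fderiv]
      change fderiv ℝ f (expNeg w) (-expNeg w * 1) = _
      rw [mul_one, map_neg]
    have hne : ‖expNeg w‖ ^ 2 ≠ 0 := by rw [norm_expNeg]; positivity
    rw [e3, real_inner_comm, inner_smul_right, inner_gradient_left, norm_neg]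
    have hlog : Real.log ‖expNeg w‖ = -w.re := by rw [norm_expNeg, Real.log_exp]
    have hcancel := mul_inv_cancel₀ hne
    rw [hlog, Function.comp_apply]
    linear_combination (f (expNeg w) + (1 - w.re) * fderiv ℝ f (expNeg w) (expNeg w)) * hcancel
  rw [setIntegral_congr_fun (measurableSet_cylinderRect 1) e2,
    intervalIntegral_halfCylinder (contDiffOn_comp_expNeg hf), circleMeasure, integral_sphere_eq]
  have := intervalIntegral.integral_comp_neg (a := -Real.pi) (b := Real.pi)
    (fun t => f (Complex.exp (t * Complex.I)))
  rw [neg_neg] at this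
  rw [← this]
  simp [expNeg]

/-! ### Traces of H¹ functions and the index of the disk form -/

section Trace

/-- The constant function `1` on the circle. -/
def circleOne : Lp ℝ 2 circleMeasure := (memLp_const (1 : ℝ)).toLp (fun _ => (1 : ℝ))

/-- The integral over the circle of the trace of an `H¹` function, as a functional on `H¹`. -/
def traceMean : H1Disk →ₗ[ℝ] ℝ :=
  (((innerSL ℝ memLp_meanWeight.toLp).toLinearMap.comp (LinearMap.fst ℝ _ _)) +
    ((innerSL ℝ memLp_meanField.toLp).toLinearMap.comp (LinearMap.snd ℝ _ _))).comp H1Disk.subtype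

theorem inner_toLp_toLp {X F : Type*} [MeasurableSpace X] {μ : Measure X} [NormedAddCommGroup F]
    [InnerProductSpace ℝ F] {f g : X → F} (hf : MemLp f 2 μ) (hg : MemLp g 2 μ) :
    inner ℝ (hf.toLp f) (hg.toLp g) = ∫ x, inner ℝ (f x) (g x) ∂μ := by
  rw [L2.inner_def]
  refine integral_congr_ae ?_
  filter_upwards [hf.coeFn_toLp, hg.coeFn_toLp] with x h1 h2
  rw [h1, h2]

theorem integrable_inner_of_memLp {X F : Type*} [MeasurableSpace X] {μ : Measure X}
    [NormedAddCommGroup F] [InnerProductSpace ℝ F] {f g : X → F} (hf : MemLp f 2 μ)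
    (hg : MemLp g 2 μ) : Integrable (fun x => inner ℝ (f x) (g x)) μ := by
  refine (L2.integrable_inner (𝕜 := ℝ) (hf.toLp f) (hg.toLp g)).congr ?_
  filter_upwards [hf.coeFn_toLp, hg.coeFn_toLp] with x h1 h2
  rw [h1, h2]

theorem tendsto_toLp {X F : Type*} [MeasurableSpace X] {μ : Measure X} [NormedAddCommGroup F]
    {f : ℕ → X → F} (hf : ∀ n, MemLp (f n) 2 μ) (g : Lp F 2 μ)
    (h : Tendsto (fun n => eLpNorm (fun x => f n x - g x) 2 μ) atTop (𝓝 0)) :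
    Tendsto (fun n => (hf n).toLp (f n)) atTop (𝓝 g) := by
  rw [Lp.tendsto_Lp_iff_tendsto_eLpNorm']
  refine h.congr fun n => eLpNorm_congr_ae ?_
  filter_upwards [(hf n).coeFn_toLp] with x hx
  simp [hx]

variable {ψ : H1Disk} {τ : Lp ℝ 2 circleMeasure}

/-- Both sides pass to the limit along the smooth approximations, for which they agree. Thus every
trace of ψ has the same mean, and this mean is linear in ψ, whichever trace is chosen. -/
theorem IsTrace.inner_circleOne (h : IsTrace ψ τ) : inner ℝ circleOne τ = traceMean ψ := by
  obtain ⟨f, hf, h1, h2, h3⟩ := h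
  have hf1 : ∀ n, ContDiffOn ℝ 1 (f n) (Metric.closedBall 0 1) := fun n =>
    (hf n).of_le (by exact_mod_cast le_top)
  have m1 := fun n => memLp_diskMeasure (hf n).continuousOn
  have m2 := fun n => memLp_gradient_diskMeasure (hf1 n)
  have m3 := fun n => memLp_circleMeasure (hf n).continuousOn
  have t1 := tendsto_toLp m1 _ h1
  have t2 := tendsto_toLp m2 _ h2
  have t3 := tendsto_toLp m3 _ h3
  have tl := (tendsto_const_nhds (x := circleOne)).inner (𝕜 := ℝ) t3
  have tr := ((tendsto_const_nhds (x := memLp_meanWeight.toLp meanWeight)).inner (𝕜 := ℝ) t1).add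
    ((tendsto_const_nhds (x := memLp_meanField.toLp meanField)).inner (𝕜 := ℝ) t2)
  refine tendsto_nhds_unique tl (tr.congr fun n => ?_)
  rw [inner_toLp_toLp, inner_toLp_toLp, circleOne, inner_toLp_toLp, ← integral_add]
  · simpa [mul_comm] using (integral_circle_eq_integral_disk (hf1 n)).symm
  · exact integrable_inner_of_memLp memLp_meanWeight (m1 n)
  · exact integrable_inner_of_memLp memLp_meanField (m2 n)

/-- The sharp trace inequality for smooth functions survives the limit, both sides being continuous
under the convergences that define a trace. -/
theorem IsTrace.inner_self_sub_le (h : IsTrace ψ τ) :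
    inner ℝ τ τ - (inner ℝ circleOne τ) ^ 2 / (2 * Real.pi) ≤ inner ℝ ψ.1.2 ψ.1.2 := by
  obtain ⟨f, hf, h1, h2, h3⟩ := h
  have hf1 : ∀ n, ContDiffOn ℝ 1 (f n) (Metric.closedBall 0 1) := fun n =>
    (hf n).of_le (by exact_mod_cast le_top)
  have m2 := fun n => memLp_gradient_diskMeasure (hf1 n)
  have m3 := fun n => memLp_circleMeasure (hf n).continuousOn
  have t2 := tendsto_toLp m2 _ h2
  have t3 := tendsto_toLp m3 _ h3
  have tl := (t3.inner (𝕜 := ℝ) t3).sub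
    ((((tendsto_const_nhds (x := circleOne)).inner (𝕜 := ℝ) t3).pow 2).div_const (2 * Real.pi))
  refine le_of_tendsto_of_tendsto' tl (t2.inner (𝕜 := ℝ) t2) fun n => ?_
  rw [inner_toLp_toLp, inner_toLp_toLp, circleOne, inner_toLp_toLp]
  have := integral_circle_sq_sub_le (hf1 n)
  simpa [← sq] using this

theorem Q0_self (ψ : H1Disk) :
    Q0 ψ ψ = inner ℝ ψ.1.2 ψ.1.2 - inner ℝ (traceOp ψ) (traceOp ψ) := by
  rw [Q0, L2.inner_def, L2.inner_def]
  rfl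

/-- If ψ had no trace, `traceOp` would return 0 and the form would be the Dirichlet energy, so the
trace theorem is not needed here. -/
theorem Q0_nonneg_of_traceMean_eq_zero (h : traceMean ψ = 0) : 0 ≤ Q0 ψ ψ := by
  rw [Q0_self]
  by_cases hτ : ∃ τ, IsTrace ψ τ
  · have ht : IsTrace ψ (traceOp ψ) := by rw [traceOp, dif_pos hτ]; exact hτ.choose_spec
    have h1 := ht.inner_self_sub_le
    rw [ht.inner_circleOne, h] at h1
    simp at h1 ⊢
    linarith
  · rw [traceOp, dif_neg hτ, inner_zero_left, sub_zero]
    exact real_inner_self_nonneg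

/-- The constant function `1` on the disk. -/
def diskOne : Lp ℝ 2 diskMeasure := (memLp_const (1 : ℝ)).toLp (fun _ => (1 : ℝ))

/-- The constant function `1` as an element of `H¹`. -/
def H1One : H1Disk := ⟨(diskOne, 0), by
  intro η h hc hs e
  have hη : ∫ z, fderiv ℝ η z e = 0 := by
    have hi : Integrable (fun z => fderiv ℝ η z e) :=
      ((h.continuous_fderiv (by simp)).clm_apply continuous_const).integrable_of_hasCompactSupport
        (hc.fderiv_apply (𝕜 := ℝ) e)
    have := integral_smul_fderiv_eq_neg_fderiv_smul_of_integrable (μ := (volume : Measure ℂ))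
      (f := fun _ => (1 : ℝ)) (g := η) (v := e) (by simp) (by simpa using hi)
      (by simpa using h.continuous.integrable_of_hasCompactSupport hc)
      (fun _ _ => differentiableAt_const _) (fun z _ => h.differentiable (by simp) z)
    simpa using this
  have hsupp : ∫ z, fderiv ℝ η z e ∂diskMeasure = ∫ z, fderiv ℝ η z e := by
    refine setIntegral_eq_integral_of_forall_compl_eq_zero fun z hz => ?_
    have : z ∉ tsupport (fderiv ℝ η) := fun h => hz (hs (tsupport_fderiv_subset ℝ h))
    rw [image_eq_zero_of_notMem_tsupport this, zero_apply]
  have e1 : ∫ z, diskOne z * fderiv ℝ η z e ∂diskMeasure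
      = ∫ z, fderiv ℝ η z e ∂diskMeasure := by
    refine integral_congr_ae ?_
    filter_upwards [(memLp_const (1 : ℝ) (μ := diskMeasure) (p := 2)).coeFn_toLp] with z hz
    rw [show diskOne z = 1 from hz, one_mul]
  have e2 : ∫ z, inner ℝ ((0 : Lp ℂ 2 diskMeasure) z) e * η z ∂diskMeasure = 0 := by
    refine integral_eq_zero_of_ae ?_
    filter_upwards [Lp.coeFn_zero ℂ 2 diskMeasure] with z hz
    rw [hz]; simp
  change ∫ z, diskOne z * fderiv ℝ η z e ∂diskMeasure
      = -∫ z, inner ℝ ((0 : Lp ℂ 2 diskMeasure) z) e * η z ∂diskMeasure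
  rw [e1, e2, hsupp, hη, neg_zero]⟩

theorem isTrace_smul_H1One (c : ℝ) : IsTrace (c • H1One) (c • circleOne) := by
  refine ⟨fun _ _ => c, fun _ => contDiffOn_const, ?_, ?_, ?_⟩
  · refine tendsto_const_nhds.congr fun n => Eq.symm ?_
    rw [eLpNorm_congr_ae (g := 0), eLpNorm_zero]
    filter_upwards [Lp.coeFn_smul c H1One.1.1,
      (memLp_const (1 : ℝ) (μ := diskMeasure) (p := 2)).coeFn_toLp] with z h1 h2
    change c - (c • H1One.1.1) z = 0
    rw [h1, Pi.smul_apply, show H1One.1.1 z = 1 from h2, smul_eq_mul, mul_one, sub_self]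
  · refine tendsto_const_nhds.congr fun n => Eq.symm ?_
    rw [eLpNorm_congr_ae (g := 0), eLpNorm_zero]
    filter_upwards [Lp.coeFn_smul c H1One.1.2, Lp.coeFn_zero ℂ 2 diskMeasure] with z h1 h2
    change gradient (fun _ => c) z - (c • H1One.1.2) z = 0
    rw [h1, Pi.smul_apply, gradient_fun_const, show H1One.1.2 z = 0 from h2, smul_zero, sub_zero]
  · refine tendsto_const_nhds.congr fun n => Eq.symm ?_
    rw [eLpNorm_congr_ae (g := 0), eLpNorm_zero]
    filter_upwards [Lp.coeFn_smul c circleOne,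
      (memLp_const (1 : ℝ) (μ := circleMeasure) (p := 2)).coeFn_toLp] with z h1 h2
    change c - (c • circleOne) z = 0
    rw [h1, Pi.smul_apply, show circleOne z = 1 from h2, smul_eq_mul, mul_one, sub_self]

theorem inner_circleOne_self : inner ℝ circleOne circleOne = 2 * Real.pi := by
  rw [circleOne, inner_toLp_toLp, circleMeasure, integral_sphere_eq]
  simp
  ring

/-- The gradient vanishes, and whichever trace is chosen has integral 2πc ≠ 0, hence is not zero. -/
theorem Q0_smul_H1One_neg {c : ℝ} (hc : c ≠ 0) : Q0 (c • H1One) (c • H1One) < 0 := by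
  have hτ : ∃ τ, IsTrace (c • H1One) τ := ⟨_, isTrace_smul_H1One c⟩
  have ht : IsTrace (c • H1One) (traceOp (c • H1One)) := by
    rw [traceOp, dif_pos hτ]; exact hτ.choose_spec
  have h1 := ht.inner_circleOne
  rw [← (isTrace_smul_H1One c).inner_circleOne, inner_smul_right, inner_circleOne_self] at h1
  have hne : traceOp (c • H1One) ≠ 0 := by
    intro h0
    rw [h0, inner_zero_right] at h1
    have := Real.pi_pos
    have : c * (2 * Real.pi) ≠ 0 := by positivity
    exact this h1.symm
  have hg : (c • H1One).1.2 = 0 := smul_zero c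
  rw [Q0_self, hg, inner_zero_left, zero_sub, neg_lt_zero]
  exact real_inner_self_pos.2 hne

theorem formIndex_Q0 : formIndex Q0 = 1 :=
  formIndex_eq_one traceMean (fun _ h => Q0_nonneg_of_traceMean_eq_zero h)
    (fun _ hc => Q0_smul_H1One_neg hc)

end Trace

/-! ### Gradient and curvature in complex notation; cut-offs -/

/-- Multiplication by g' ≠ 0 is onto, so tangent directions still span. This makes one-sided
derivatives at the free boundary well defined on a conformal image of a half-plane or strip. -/
theorem uniqueDiffOn_image_of_deriv_ne_zero {g g' : ℂ → ℂ} {s : Set ℂ} (hs : UniqueDiffOn ℝ s)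
    (hg : ∀ w ∈ s, HasDerivAt g (g' w) w) (h0 : ∀ w ∈ s, g' w ≠ 0) :
    UniqueDiffOn ℝ (g '' s) := by
  refine hs.image (fun w hw => ((hg w hw).complexToReal_fderiv).hasFDerivWithinAt)
    fun w hw => Function.Surjective.denseRange fun z => ⟨(g' w)⁻¹ * z, ?_⟩
  change g' w * ((g' w)⁻¹ * z) = z
  rw [mul_inv_cancel_left₀ (h0 w hw)]

/-- By the Cauchy-Riemann equations ∇ Re F = conj(F'). Only a local F is required, since the
harmonic conjugate may be multivalued. -/
theorem gradientWithin_re {u : ℂ → ℝ} {F : ℂ → ℂ} {F' z : ℂ} {C : Set ℂ}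
    (hC : UniqueDiffWithinAt ℝ C z) (hz : z ∈ C) (hF : HasDerivAt F F' z)
    (hu : u =ᶠ[𝓝[C] z] fun y => (F y).re) : gradientWithin u C z = (starRingEnd ℂ) F' := by
  have h1 : HasFDerivAt (fun y => (F y).re) (Complex.reCLM.comp (F' • (1 : ℂ →L[ℝ] ℂ))) z :=
    Complex.reCLM.hasFDerivAt.comp z hF.complexToReal_fderiv
  have h2 := (h1.hasFDerivWithinAt (s := C)).congr_of_eventuallyEq hu (hu.eq_of_nhdsWithin hz)
  rw [gradientWithin, h2.fderivWithin hC, LinearIsometryEquiv.symm_apply_eq]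
  ext v
  rw [InnerProductSpace.toDual_apply_apply, Complex.inner]
  change (F' * v).re = _
  simp
  ring

theorem trace_complex (A : ℂ →ₗ[ℝ] ℂ) :
    LinearMap.trace ℝ ℂ A = (A 1).re + (A Complex.I).im := by
  rw [LinearMap.trace_eq_matrix_trace ℝ Complex.basisOneI, Matrix.trace_fin_two,
    LinearMap.toMatrix_apply, LinearMap.toMatrix_apply]
  simp

/-- The mean curvature when the gradient is the conjugate of a holomorphic function `τ`. -/
theorem meanCurvature_eq {u : ℂ → ℝ} {τ : ℂ → ℂ} {τ' z : ℂ}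
    (hC : UniqueDiffWithinAt ℝ (closure (posPhase u)) z) (hz : z ∈ closure (posPhase u))
    (hu : ∀ᶠ y in 𝓝[closure (posPhase u)] z,
      gradientWithin u (closure (posPhase u)) y = (starRingEnd ℂ) (τ y))
    (hτ : HasDerivAt τ τ' z) (h1 : ‖τ z‖ = 1) :
    meanCurvature u z = -((starRingEnd ℂ) (τ z) ^ 2 * τ').re := by
  have hconj : HasFDerivAt (fun y => (starRingEnd ℂ) (τ y))
      ((Complex.conjCLE : ℂ →L[ℝ] ℂ).comp (τ' • (1 : ℂ →L[ℝ] ℂ))) z :=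
    (Complex.conjCLE : ℂ →L[ℝ] ℂ).hasFDerivAt.comp z hτ.complexToReal_fderiv
  -- The normalising factor 1/|τ| is written through |τ|², which is differentiable. The field
  -- conj(τ) is divergence free, so only the derivative of this factor contributes to the trace.
  have hr : HasDerivAt (fun x : ℝ => (√x)⁻¹) (-(1 / (2 * √(‖τ z‖ ^ 2))) / √(‖τ z‖ ^ 2) ^ 2)
      (‖τ z‖ ^ 2) :=
    (Real.hasDerivAt_sqrt (by rw [h1]; norm_num)).inv (by rw [h1]; norm_num)
  have hn := hr.comp_hasFDerivAt z (hτ.complexToReal_fderiv.norm_sq)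
  have hU := hn.smul hconj
  have he : unitGrad u =ᶠ[𝓝[closure (posPhase u)] z]
      ((fun x : ℝ => (√x)⁻¹) ∘ fun y => ‖τ y‖ ^ 2) • (fun y => (starRingEnd ℂ) (τ y)) := by
    filter_upwards [hu] with y hy
    rw [unitGrad, hy]
    simp [Real.sqrt_sq (norm_nonneg _)]
  have hW := (hU.hasFDerivWithinAt (s := closure (posPhase u))).congr_of_eventuallyEq he
    (he.eq_of_nhdsWithin hz)
  rw [meanCurvature, hW.fderivWithin hC, trace_complex]
  simp [h1, Complex.inner, sq]
  ring

theorem secondVariation_smul {u : ℂ → ℝ} (c : ℝ) (φ : testSpace u) :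
    secondVariation u (c • φ) (c • φ) = c ^ 2 * secondVariation u φ φ := by
  have hg : ∀ z, gradient ((c • φ : testSpace u) : ℂ → ℝ) z = c • gradient (φ : ℂ → ℝ) z := by
    intro z
    rw [gradient, gradient, Submodule.coe_smul, fderiv_const_smul_field]
    simp
  rw [secondVariation, secondVariation, mul_sub, ← integral_const_mul, ← integral_const_mul]
  congr 1
  · congr 1
    ext z
    rw [hg, real_inner_smul_left, real_inner_smul_right]
    ring
  · congr 1
    ext z
    simp only [Submodule.coe_smul, Pi.smul_apply, smul_eq_mul]
    ring

theorem morseIndex_eq_one {u : ℂ → ℝ} (l : testSpace u →ₗ[ℝ] ℝ)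
    (hl : ∀ φ, l φ = 0 → 0 ≤ secondVariation u φ φ) {φ : testSpace u}
    (hφ : secondVariation u φ φ < 0) : morseIndex u = 1 :=
  formIndex_eq_one l hl (v := φ) fun c hc => by
    rw [secondVariation_smul]
    exact mul_neg_of_pos_of_neg (by positivity) hφ

/-- A smooth even cut-off function on the line, equal to `1` on `[-1, 1]` and to `0` off
`[-2, 2]`. -/
def cutoff (x : ℝ) : ℝ := Real.smoothTransition (2 - x ^ 2)

theorem contDiff_cutoff : ContDiff ℝ ∞ cutoff :=
  Real.smoothTransition.contDiff.comp (contDiff_const.sub (contDiff_id.pow 2))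

theorem cutoff_eq_one {x : ℝ} (hx : |x| ≤ 1) : cutoff x = 1 :=
  Real.smoothTransition.one_of_one_le (by nlinarith [sq_abs x, abs_nonneg x])

theorem cutoff_eq_zero {x : ℝ} (hx : 2 ≤ |x|) : cutoff x = 0 :=
  Real.smoothTransition.zero_of_nonpos (by nlinarith [sq_abs x, abs_nonneg x])

theorem hasCompactSupport_cutoff : HasCompactSupport cutoff :=
  HasCompactSupport.intro (isCompact_Icc (a := -2) (b := 2)) fun x hx => cutoff_eq_zero (by
    by_contra! h
    exact hx (abs_le.1 h.le))

theorem exists_deriv_cutoff_le : ∃ C : ℝ, ∀ x, ‖deriv cutoff x‖ ≤ C :=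
  hasCompactSupport_cutoff.deriv.exists_bound_of_continuous
    (contDiff_cutoff.continuous_deriv (by simp))

/-- The cut-off in the real direction at scale `ε⁻¹`. -/
def reCutoff (ε : ℝ) (w : ℂ) : ℝ := cutoff (ε * w.re)

theorem contDiff_reCutoff (ε : ℝ) : ContDiff ℝ ∞ (reCutoff ε) :=
  contDiff_cutoff.comp (contDiff_const.mul Complex.reCLM.contDiff)

theorem norm_gradient_reCutoff_le {C : ℝ} (hC : ∀ x, ‖deriv cutoff x‖ ≤ C) {ε : ℝ} (hε : 0 ≤ ε)
    (w : ℂ) : ‖gradient (reCutoff ε) w‖ ≤ ε * C := by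
  have h1 : HasDerivAt cutoff (deriv cutoff (ε * w.re)) (ε * w.re) :=
    (contDiff_cutoff.differentiable (by simp) _).hasDerivAt
  have h2 : HasFDerivAt (fun w : ℂ => ε * w.re) (ε • Complex.reCLM) w :=
    Complex.reCLM.hasFDerivAt.const_mul ε
  have h3 : HasFDerivAt (reCutoff ε) (deriv cutoff (ε * w.re) • ε • Complex.reCLM) w :=
    h1.comp_hasFDerivAt w h2
  rw [gradient, LinearIsometryEquiv.norm_map, h3.fderiv, norm_smul, norm_smul, Complex.reCLM_norm,
    mul_one, Real.norm_of_nonneg hε, mul_comm]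
  exact mul_le_mul_of_nonneg_left (hC _) hε

theorem measureReal_reProdIm {a b c d : ℝ} (hab : a ≤ b) (hcd : c ≤ d) :
    volume (Set.Ioc a b ×ℂ Set.Ioc c d) < ⊤ ∧
      (volume : Measure ℂ).real (Set.Ioc a b ×ℂ Set.Ioc c d) = (b - a) * (d - c) := by
  have hlt : volume (Set.Ioc a b ×ℂ Set.Ioc c d) < ⊤ :=
    (measure_mono (t := Set.Icc a b ×ℂ Set.Icc c d) fun w hw => ⟨Set.Ioc_subset_Icc_self hw.1, Set.Ioc_subset_Icc_self hw.2⟩).trans_lt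
      (IsCompact.reProdIm (isCompact_Icc (a := a) (b := b))
        (isCompact_Icc (a := c) (b := d))).measure_lt_top
  refine ⟨hlt, ?_⟩
  have := setIntegral_reProdIm hab hcd (F := fun _ => 1) (integrableOn_const hlt.ne)
  simp only [integral_const, measureReal_restrict_apply_univ, smul_eq_mul, mul_one,
    intervalIntegral.integral_const] at this
  exact this

/-- The energy of a cut-off in a horizontal rectangle. -/
theorem setIntegral_sq_gradient_le {a b c d M : ℝ} (hab : a ≤ b) (hcd : c ≤ d) {s : Set ℂ}
    (hs : s ⊆ Set.Ioc a b ×ℂ Set.Ioc c d) {f : ℂ → ℝ}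
    (hM : ∀ w ∈ s, ‖gradient f w‖ ≤ M) :
    ∫ w in s, ‖gradient f w‖ ^ 2 ≤ M ^ 2 * ((b - a) * (d - c)) := by
  obtain ⟨h1, h2⟩ := measureReal_reProdIm hab hcd
  have hlt : volume s < ⊤ := (measure_mono hs).trans_lt h1
  have h3 := norm_setIntegral_le_of_norm_le_const (C := M ^ 2) (f := fun w => ‖gradient f w‖ ^ 2)
    hlt fun w hw => by
      rw [norm_pow, norm_norm]
      exact pow_le_pow_left₀ (norm_nonneg _) (hM w hw) 2
  refine (le_abs_self _).trans (h3.trans ?_)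
  rw [← h2]
  exact mul_le_mul_of_nonneg_left (measureReal_mono hs h1.ne) (sq_nonneg M)

/-! ### The disk-complement solution -/

section DiskComplement

theorem posPhase_diskComplement : posPhase diskComplement = (Metric.closedBall 0 1)ᶜ := by
  ext z
  simp only [posPhase, diskComplement, Set.mem_ofPred_eq, lt_max_iff, lt_irrefl, or_false,
    Set.mem_compl_iff, mem_closedBall_zero_iff, not_le]
  exact Real.log_pos_iff (norm_nonneg z)

theorem closure_posPhase_diskComplement :
    closure (posPhase diskComplement) = (Metric.ball 0 1)ᶜ := by
  rw [posPhase_diskComplement, closure_compl, interior_closedBall _ one_ne_zero]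

theorem freeBoundary_diskComplement : freeBoundary diskComplement = Metric.sphere 0 1 := by
  rw [freeBoundary, posPhase_diskComplement, frontier_compl, frontier_closedBall _ one_ne_zero]

theorem image_exp_rightHalfPlane : Complex.exp '' rightHalfPlane = (Metric.ball 0 1)ᶜ := by
  ext z
  simp only [Set.mem_image, Set.mem_compl_iff, mem_ball_zero_iff, not_lt]
  constructor
  · rintro ⟨w, hw, rfl⟩
    rw [Complex.norm_exp]
    exact Real.one_le_exp hw
  · intro hz
    have hz0 : z ≠ 0 := norm_pos_iff.1 (by linarith)
    refine ⟨Complex.log z, ?_, Complex.exp_log hz0⟩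
    change 0 ≤ (Complex.log z).re
    rw [Complex.log_re]
    exact Real.log_nonneg hz

theorem uniqueDiffOn_compl_ball : UniqueDiffOn ℝ (Metric.ball (0 : ℂ) 1)ᶜ := by
  rw [← image_exp_rightHalfPlane]
  exact uniqueDiffOn_image_of_deriv_ne_zero uniqueDiffOn_rightHalfPlane
    (fun w _ => Complex.hasDerivAt_exp w) fun w _ => Complex.exp_ne_zero w

theorem gradientWithin_diskComplement {z : ℂ} (hz : z ∈ (Metric.ball (0 : ℂ) 1)ᶜ) :
    gradientWithin diskComplement (Metric.ball 0 1)ᶜ z = (starRingEnd ℂ) z⁻¹ := by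
  have hz1 : 1 ≤ ‖z‖ := by simpa using hz
  have hz0 : z ≠ 0 := norm_pos_iff.1 (by linarith)
  -- Dividing by z moves the base point of the logarithm to 1, away from the branch cut, for every
  -- z.
  have hF : HasDerivAt (fun y => Complex.log (y / z) + (Real.log ‖z‖ : ℂ)) z⁻¹ z := by
    have h := ((hasDerivAt_id z).div_const z).clog (x := z) (by simp [div_self hz0])
    simpa [div_self hz0] using h.add_const (Real.log ‖z‖ : ℂ)
  refine gradientWithin_re (uniqueDiffOn_compl_ball z hz) hz hF ?_
  filter_upwards [self_mem_nhdsWithin] with y hy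
  have hy1 : 1 ≤ ‖y‖ := by simpa using hy
  rw [diskComplement, max_eq_left (Real.log_nonneg hy1), Complex.add_re, Complex.log_re, norm_div,
    Complex.ofReal_re, Real.log_div (by positivity) (by positivity), sub_add_cancel]

theorem meanCurvature_diskComplement {z : ℂ} (hz : z ∈ Metric.sphere (0 : ℂ) 1) :
    meanCurvature diskComplement z = 1 := by
  have hz1 : ‖z‖ = 1 := by simpa using hz
  have hz0 : z ≠ 0 := norm_pos_iff.1 (by linarith)
  have hmem : z ∈ (Metric.ball (0 : ℂ) 1)ᶜ := by simp [hz1]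
  have h := meanCurvature_eq (u := diskComplement) (τ := fun y => y⁻¹) (z := z)
    (by rw [closure_posPhase_diskComplement]; exact uniqueDiffOn_compl_ball z hmem)
    (by rwa [closure_posPhase_diskComplement])
    (by
      rw [closure_posPhase_diskComplement]
      filter_upwards [self_mem_nhdsWithin] with y hy using gradientWithin_diskComplement hy)
    (hasDerivAt_inv hz0) (by simp [hz1])
  rw [h]
  have hc : (starRingEnd ℂ) z⁻¹ = z := by
    rw [map_inv₀, ← Complex.inv_eq_conj hz1, inv_inv]
  rw [hc, mul_neg, mul_inv_cancel₀ (pow_ne_zero 2 hz0)]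
  simp

theorem secondVariation_diskComplement (φ : testSpace diskComplement) :
    secondVariation diskComplement φ φ
      = (∫ z in (Metric.closedBall (0 : ℂ) 1)ᶜ, ‖gradient (φ : ℂ → ℝ) z‖ ^ 2)
        - ∫ z in Metric.sphere (0 : ℂ) 1, (φ : ℂ → ℝ) z ^ 2 ∂μH[1] := by
  rw [secondVariation, posPhase_diskComplement, freeBoundary_diskComplement]
  congr 1
  · simp only [real_inner_self_eq_norm_sq]
  · refine setIntegral_congr_fun Metric.isClosed_sphere.measurableSet fun z hz => ?_
    simp only [meanCurvature_diskComplement hz, one_mul, sq]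

theorem image_exp_cylinderRect (S : ℝ) : Complex.exp '' cylinderRect S
    = (Metric.closedBall 0 1)ᶜ ∩ Metric.closedBall 0 (Real.exp S) := by
  ext z
  simp only [Set.mem_image, Set.mem_inter_iff, Set.mem_compl_iff, mem_closedBall_zero_iff, not_le]
  constructor
  · rintro ⟨w, hw, rfl⟩
    rw [Complex.norm_exp]
    exact ⟨Real.one_lt_exp_iff.2 hw.1.1, Real.exp_le_exp.2 hw.1.2⟩
  · rintro ⟨h1, h2⟩
    have hz0 : z ≠ 0 := norm_pos_iff.1 (by linarith)
    refine ⟨Complex.log z, ⟨?_, ?_⟩, Complex.exp_log hz0⟩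
    · change (Complex.log z).re ∈ Set.Ioc 0 S
      rw [Complex.log_re]
      exact ⟨Real.log_pos h1, (Real.log_le_iff_le_exp (by linarith)).2 h2⟩
    · exact ⟨Complex.neg_pi_lt_log_im z, Complex.log_im_le_pi z⟩

theorem gradient_eq_zero_of_notMem_tsupport {f : ℂ → ℝ} {z : ℂ} (hz : z ∉ tsupport f) :
    gradient f z = 0 := by
  have : z ∉ tsupport (fderiv ℝ f) := fun h => hz (tsupport_fderiv_subset ℝ h)
  rw [gradient, image_eq_zero_of_notMem_tsupport this, map_zero]

theorem setIntegral_sq_gradient_diskComplement {φ : ℂ → ℝ} {S : ℝ}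
    (hφ : ContDiffOn ℝ 1 φ (Metric.ball 0 1)ᶜ)
    (hS : tsupport φ ⊆ Metric.closedBall 0 (Real.exp S)) :
    ∫ z in (Metric.closedBall (0 : ℂ) 1)ᶜ, ‖gradient φ z‖ ^ 2
      = ∫ w in cylinderRect S, ‖gradient (φ ∘ Complex.exp) w‖ ^ 2 := by
  rw [← setIntegral_image_sq_gradient (measurableSet_cylinderRect S)
    (fun w _ => Complex.hasDerivAt_exp w) (injOn_exp_im_Ioc fun w hw => hw.2),
    image_exp_cylinderRect]
  · refine (setIntegral_eq_of_subset_of_forall_sdiff_eq_zero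
      Metric.isClosed_closedBall.isOpen_compl.measurableSet Set.inter_subset_left ?_)
    intro z hz
    rw [gradient_eq_zero_of_notMem_tsupport fun h => hz.2 ⟨hz.1, hS h⟩]
    simp
  · intro w hw
    have h0 := Set.mem_image_of_mem Complex.exp hw
    rw [image_exp_cylinderRect] at h0
    have h1 := h0.1
    exact (hφ.contDiffAt (mem_of_superset (Metric.isClosed_closedBall.isOpen_compl.mem_nhds h1)
      (Set.compl_subset_compl.2 Metric.ball_subset_closedBall))).differentiableAt one_ne_zero

theorem testSpace_diskComplement_contDiffOn (φ : testSpace diskComplement) :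
    ContDiffOn ℝ 1 (φ : ℂ → ℝ) (Metric.ball 0 1)ᶜ := by
  have := φ.2.1
  rw [closure_posPhase_diskComplement] at this
  exact this.of_le (by exact_mod_cast le_top)

/-- The exterior of the disk is the half-cylinder under exp. The support of φ is compact, so for S
large φ vanishes on |z| = e^S and the far deviation is zero. -/
theorem integral_sphere_sq_sub_le (φ : testSpace diskComplement) :
    (∫ z in Metric.sphere (0 : ℂ) 1, (φ : ℂ → ℝ) z ^ 2 ∂μH[1])
      - (∫ z in Metric.sphere (0 : ℂ) 1, (φ : ℂ → ℝ) z ∂μH[1]) ^ 2 / (2 * Real.pi)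
      ≤ ∫ z in (Metric.closedBall (0 : ℂ) 1)ᶜ, ‖gradient (φ : ℂ → ℝ) z‖ ^ 2 := by
  have hφ := testSpace_diskComplement_contDiffOn φ
  obtain ⟨R, hR⟩ := φ.2.2.1.isCompact.isBounded.subset_closedBall (0 : ℂ)
  set S := max R 1 with hSdef
  have hS0 : 0 ≤ S := by positivity
  have hS : tsupport (φ : ℂ → ℝ) ⊆ Metric.ball 0 (Real.exp S) := hR.trans
    (Metric.closedBall_subset_ball ((le_max_left R 1).trans_lt (by
      linarith [Real.add_one_le_exp S])))
  have hv : ContDiffOn ℝ 1 ((φ : ℂ → ℝ) ∘ Complex.exp) rightHalfPlane :=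
    hφ.comp ((Complex.contDiff_exp (𝕜 := ℂ)).restrict_scalars ℝ).contDiffOn
      fun w hw => image_exp_rightHalfPlane ▸ Set.mem_image_of_mem _ hw
  have h := deviation_sub_le_setIntegral hv (fun w => by
    simp only [Function.comp_apply, Complex.exp_add, Complex.exp_two_pi_mul_I, mul_one]) hS0
  rw [← setIntegral_sq_gradient_diskComplement hφ
    (hS.trans Metric.ball_subset_closedBall)] at h
  have h0 : (fun t : ℝ => ((φ : ℂ → ℝ) ∘ Complex.exp) (S + t * Complex.I)) = fun _ => 0 := by
    ext t
    refine image_eq_zero_of_notMem_tsupport (f := (φ : ℂ → ℝ)) fun hmem => ?_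
    have := hS hmem
    rw [mem_ball_zero_iff, Complex.norm_exp] at this
    simp at this
  rw [h0, deviation_const, sub_zero] at h
  rw [← deviation_exp_mul_I]
  exact h

/-- The boundary mean of a test function. -/
def sphereMean : testSpace diskComplement →ₗ[ℝ] ℝ where
  toFun φ := ∫ z in Metric.sphere (0 : ℂ) 1, (φ : ℂ → ℝ) z ∂μH[1]
  map_add' φ ψ := by
    have hi : ∀ φ : testSpace diskComplement,
        IntegrableOn (φ : ℂ → ℝ) (Metric.sphere (0 : ℂ) 1) μH[1] := fun φ =>
      memLp_one_iff_integrable.1 (memLp_restrict_of_isCompact (isCompact_sphere 0 1)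
        hausdorffMeasure_sphere_ne_top
        ((testSpace_diskComplement_contDiffOn φ).continuousOn.mono fun z hz => by
          simp [mem_sphere_zero_iff_norm.1 hz]))
    exact integral_add (hi φ) (hi ψ)
  map_smul' c φ := integral_const_mul c _

/-- The radial logarithmic cut-off. -/
def logCutoff (ε : ℝ) : ℂ → ℝ := (Metric.ball 0 1)ᶜ.indicator fun z => cutoff (ε * Real.log ‖z‖)

theorem tsupport_logCutoff_subset {ε : ℝ} (hε : 0 < ε) :
    tsupport (logCutoff ε) ⊆ Metric.closedBall 0 (Real.exp (2 / ε)) := by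
  refine closure_minimal (fun z hz => ?_) Metric.isClosed_closedBall
  by_contra hmem
  rw [mem_closedBall_zero_iff, not_le] at hmem
  refine hz ?_
  rw [logCutoff, Set.indicator_apply_eq_zero]
  intro _
  have h1 : 2 / ε < Real.log ‖z‖ := by
    rw [Real.lt_log_iff_exp_lt ((Real.exp_pos _).trans hmem)]; exact hmem
  rw [div_lt_iff₀ hε, mul_comm] at h1
  exact cutoff_eq_zero (h1.le.trans (le_abs_self _))

theorem contDiffOn_logCutoff (ε : ℝ) : ContDiffOn ℝ ∞ (logCutoff ε) (Metric.ball 0 1)ᶜ := by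
  refine ContDiffOn.congr (f := fun z => cutoff (ε * Real.log ‖z‖)) ?_
    fun z hz => Set.indicator_of_mem hz _
  intro z hz
  have hz1 : 1 ≤ ‖z‖ := by simpa using hz
  have hz0 : z ≠ 0 := norm_pos_iff.1 (by linarith)
  exact (contDiff_cutoff.contDiffAt.comp z (contDiffAt_const.mul
    ((contDiffAt_norm ℝ hz0).log (norm_ne_zero_iff.2 hz0)))).contDiffWithinAt

/-- The logarithmic cut-off as a test function. -/
def logCutoffTest {ε : ℝ} (hε : 0 < ε) : testSpace diskComplement :=
  ⟨logCutoff ε, by rw [closure_posPhase_diskComplement]; exact contDiffOn_logCutoff ε,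
    (isCompact_closedBall (0 : ℂ) (Real.exp (2 / ε))).of_isClosed_subset (isClosed_tsupport _)
      (tsupport_logCutoff_subset hε),
    fun z hz => Set.indicator_of_notMem (by rwa [closure_posPhase_diskComplement] at hz) _⟩

/-- In the coordinate log z the cut-off has slope at most εC on a cylinder of length 2/ε, so its
energy is O(ε): infinity has zero capacity in the plane. The boundary term is 2π for every ε. -/
theorem secondVariation_logCutoff_le {C : ℝ} (hC : ∀ x, ‖deriv cutoff x‖ ≤ C) {ε : ℝ} (hε : 0 < ε) :
    secondVariation diskComplement (logCutoffTest hε) (logCutoffTest hε)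
      ≤ 4 * Real.pi * C ^ 2 * ε - 2 * Real.pi := by
  have hpi := Real.pi_pos
  rw [secondVariation_diskComplement]
  change (∫ z in _, ‖gradient (logCutoff ε) z‖ ^ 2) - ∫ z in _, logCutoff ε z ^ 2 ∂_ ≤ _
  rw [setIntegral_sq_gradient_diskComplement ((contDiffOn_logCutoff ε).of_le
    (by exact_mod_cast le_top)) (tsupport_logCutoff_subset hε)]
  have h1 : ∫ w in cylinderRect (2 / ε), ‖gradient (logCutoff ε ∘ Complex.exp) w‖ ^ 2
      ≤ (ε * C) ^ 2 * ((2 / ε - 0) * (Real.pi - -Real.pi)) := by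
    refine setIntegral_sq_gradient_le (by positivity) (by linarith) subset_rfl fun w hw => ?_
    have he : logCutoff ε ∘ Complex.exp =ᶠ[𝓝 w] reCutoff ε := by
      filter_upwards [rightHalfPlane_mem_nhds hw.1.1] with y hy
      rw [Function.comp_apply, logCutoff, Set.indicator_of_mem
        (image_exp_rightHalfPlane ▸ Set.mem_image_of_mem _ hy), Complex.norm_exp, Real.log_exp,
        reCutoff]
    rw [he.gradient_eq]
    exact norm_gradient_reCutoff_le hC hε.le w
  have h2 : ∫ z in Metric.sphere (0 : ℂ) 1, logCutoff ε z ^ 2 ∂μH[1] = 2 * Real.pi := by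
    rw [integral_sphere_eq]
    have : ∀ t : ℝ, logCutoff ε (Complex.exp (t * Complex.I)) ^ 2 = 1 := by
      intro t
      rw [logCutoff, Set.indicator_of_mem (by simp [Complex.norm_exp_ofReal_mul_I]),
        Complex.norm_exp_ofReal_mul_I, Real.log_one, mul_zero, cutoff_eq_one (by simp), one_pow]
    simp only [this, intervalIntegral.integral_const, smul_eq_mul]
    ring
  rw [h2]
  have h3 : (ε * C) ^ 2 * ((2 / ε - 0) * (Real.pi - -Real.pi)) = 4 * Real.pi * C ^ 2 * ε := by
    field_simp
    ring
  linarith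

theorem morseIndex_diskComplement : morseIndex diskComplement = 1 := by
  obtain ⟨C, hC⟩ := exists_deriv_cutoff_le
  have hpi := Real.pi_pos
  -- This makes 4πC²ε less than π; adding 4 keeps the inverse positive even if C = 0.
  have hε : 0 < (4 * C ^ 2 + 4)⁻¹ := by positivity
  refine morseIndex_eq_one sphereMean (fun φ hφ => ?_) (φ := logCutoffTest hε) ?_
  · have h := integral_sphere_sq_sub_le φ
    rw [show (∫ z in Metric.sphere (0 : ℂ) 1, (φ : ℂ → ℝ) z ∂μH[1]) = 0 from hφ] at h
    rw [secondVariation_diskComplement]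
    simp only [ne_eq, OfNat.ofNat_ne_zero, not_false_eq_true, zero_pow, zero_div, sub_zero] at h
    linarith
  · refine (secondVariation_logCutoff_le hC hε).trans_lt ?_
    have : 4 * C ^ 2 * (4 * C ^ 2 + 4)⁻¹ < 1 := by
      rw [← div_eq_mul_inv, div_lt_one (by positivity)]
      linarith
    nlinarith

end DiskComplement

/-! ### Geometry of the double hairpin up to its free boundary -/

section HairpinGeometry

theorem cosh_re (w : ℂ) : (Complex.cosh w).re = Real.cosh w.re * Real.cos w.im := by
  obtain ⟨x, y⟩ := w
  rw [Complex.mk_eq_add_mul_I, Complex.cosh_add, Complex.cosh_mul_I, Complex.sinh_mul_I]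
  simp
  exact Or.inl (Complex.cos_ofReal_re y)

/-- The closed strip `|Im w| ≤ π/2`. -/
def closedStrip : Set ℂ := {w | |w.im| ≤ Real.pi / 2}

theorem closedStrip_eq_reProdIm :
    closedStrip = Set.univ ×ℂ Set.Icc (-(Real.pi / 2)) (Real.pi / 2) := by
  ext w; simp [closedStrip, Complex.mem_reProdIm, abs_le]

theorem strip_eq_reProdIm : strip = Set.univ ×ℂ Set.Ioo (-(Real.pi / 2)) (Real.pi / 2) := by
  ext w; simp [strip, Complex.mem_reProdIm, abs_lt]

theorem strip_subset_closedStrip : strip ⊆ closedStrip := fun _ hw => le_of_lt (Set.mem_ofPred.1 hw)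

theorem isClosed_closedStrip : IsClosed closedStrip :=
  isClosed_le (by fun_prop) continuous_const

theorem isOpen_strip : IsOpen strip :=
  isOpen_lt (by fun_prop) continuous_const

theorem closure_strip : closure strip = closedStrip := by
  rw [strip_eq_reProdIm, closedStrip_eq_reProdIm, Complex.closure_reProdIm, closure_univ,
    closure_Ioo (by linarith [Real.pi_pos])]

theorem convex_closedStrip : Convex ℝ closedStrip := by
  have : closedStrip = Complex.imLm ⁻¹' Set.Icc (-(Real.pi / 2)) (Real.pi / 2) := by
    ext w; simp [closedStrip, abs_le]
  rw [this]
  exact (convex_Icc _ _).linear_preimage _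

theorem cosh_re_nonneg {w : ℂ} (hw : w ∈ closedStrip) : 0 ≤ (Complex.cosh w).re := by
  rw [cosh_re]
  exact mul_nonneg (Real.cosh_pos _).le (Real.cos_nonneg_of_mem_Icc (abs_le.1 hw))

theorem cosh_re_pos {w : ℂ} (hw : w ∈ strip) : 0 < (Complex.cosh w).re := by
  rw [cosh_re]
  exact mul_pos (Real.cosh_pos _) (Real.cos_pos_of_mem_Ioo (abs_lt.1 hw))

theorem one_add_cosh_ne_zero {w : ℂ} (hw : w ∈ closedStrip) : 1 + Complex.cosh w ≠ 0 := by
  intro h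
  have h1 := congrArg Complex.re h
  have h2 := cosh_re_nonneg hw
  simp only [Complex.add_re, Complex.one_re, Complex.zero_re] at h1
  linarith

theorem hasDerivAt_hairpinMap (w : ℂ) : HasDerivAt hairpinMap (1 + Complex.cosh w) w :=
  (hasDerivAt_id _).add (Complex.hasDerivAt_sinh _)

theorem contDiff_hairpinMap : ContDiff ℂ ∞ hairpinMap :=
  contDiff_id.add Complex.contDiff_sinh

theorem continuous_hairpinMap : Continuous hairpinMap := contDiff_hairpinMap.continuous

/-- `w ↦ w + sinh w` does not decrease distances in the closed strip. -/
theorem norm_sub_le_norm_hairpinMap_sub {a b : ℂ} (ha : a ∈ closedStrip) (hb : b ∈ closedStrip) :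
    ‖b - a‖ ≤ ‖hairpinMap b - hairpinMap a‖ := by
  set d := b - a with hd
  -- The component of sinh along d on the segment from a to b. Its derivative is |d|² Re cosh, which
  -- is nonnegative on the convex closed strip.
  let p : ℝ → ℝ := fun t => ((starRingEnd ℂ) d * Complex.sinh (a + t * d)).re
  have hp : ∀ t : ℝ, HasDerivAt p
      (((starRingEnd ℂ) d * (Complex.cosh (a + t * d) * d)).re) t := by
    intro t
    have h1 : HasDerivAt (fun s : ℂ => a + s * d) d (t : ℂ) := by
      simpa using ((hasDerivAt_id (t : ℂ)).mul_const d).const_add a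
    exact ((h1.csinh).const_mul ((starRingEnd ℂ) d)).real_of_complex
  have hmono : MonotoneOn p (Set.Icc 0 1) := by
    refine monotoneOn_of_deriv_nonneg (convex_Icc 0 1)
      (fun t _ => (hp t).continuousAt.continuousWithinAt)
      (fun t _ => (hp t).differentiableAt.differentiableWithinAt) fun t ht => ?_
    rw [(hp t).deriv]
    have ht' := interior_subset ht
    have hmem : a + t * d ∈ closedStrip := by
      have := convex_closedStrip ha hb (sub_nonneg.2 ht'.2) ht'.1 (by ring)
      convert this using 1
      simp [hd]
      ring
    have e : (starRingEnd ℂ) d * (Complex.cosh (a + t * d) * d)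
        = (Complex.normSq d : ℂ) * Complex.cosh (a + t * d) := by
      rw [← Complex.mul_conj]; ring
    rw [e, Complex.re_ofReal_mul]
    exact mul_nonneg (Complex.normSq_nonneg d) (cosh_re_nonneg hmem)
  have h01 : p 0 ≤ p 1 := hmono (by simp) (by simp) zero_le_one
  -- The identity part of the map contributes |d|² and the sinh part a nonnegative amount;
  -- Cauchy-Schwarz then finishes.
  have h2 : ‖d‖ ^ 2 ≤ ((starRingEnd ℂ) d * (hairpinMap b - hairpinMap a)).re := by
    have e : (starRingEnd ℂ) d * (hairpinMap b - hairpinMap a)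
        = (Complex.normSq d : ℂ) + ((starRingEnd ℂ) d * Complex.sinh b
          - (starRingEnd ℂ) d * Complex.sinh a) := by
      rw [← Complex.mul_conj, hairpinMap, hairpinMap, hd]; ring
    rw [e, Complex.add_re, Complex.ofReal_re, Complex.normSq_eq_norm_sq, Complex.sub_re]
    simp only [p, Complex.ofReal_zero, zero_mul, add_zero, Complex.ofReal_one, one_mul, hd,
      add_sub_cancel] at h01
    linarith
  have h3 : ‖d‖ ^ 2 ≤ ‖d‖ * ‖hairpinMap b - hairpinMap a‖ := by
    refine h2.trans ((Complex.re_le_norm _).trans ?_)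
    rw [norm_mul, RCLike.norm_conj]
  rcases (norm_nonneg d).eq_or_lt with h | h
  · rw [← h]; exact norm_nonneg _
  · rw [sq] at h3
    exact le_of_mul_le_mul_left h3 h

theorem injOn_hairpinMap_closedStrip : Set.InjOn hairpinMap closedStrip := by
  intro a ha b hb h
  have := norm_sub_le_norm_hairpinMap_sub ha hb
  rw [h, sub_self, norm_zero] at this
  exact (sub_eq_zero.1 (norm_le_zero_iff.1 this)).symm

theorem norm_le_norm_hairpinMap {w : ℂ} (hw : w ∈ closedStrip) : ‖w‖ ≤ ‖hairpinMap w‖ := by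
  have := norm_sub_le_norm_hairpinMap_sub (a := 0) (b := w)
    (by simp [closedStrip]; positivity) hw
  simpa [hairpinMap] using this

theorem posPhase_doubleHairpin : posPhase doubleHairpin = hairpinMap '' strip := by
  ext z
  constructor
  · intro hz
    by_contra h
    rw [posPhase, Set.mem_ofPred, doubleHairpin, if_neg h] at hz
    exact lt_irrefl _ hz
  · rintro ⟨w, hw, rfl⟩
    rw [posPhase, Set.mem_ofPred, doubleHairpin_hairpinMap hw]
    exact cosh_re_pos hw

theorem isOpen_image_hairpinMap_strip : IsOpen (hairpinMap '' strip) := by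
  rw [isOpen_iff_mem_nhds]
  rintro _ ⟨w, hw, rfl⟩
  have h := (contDiff_hairpinMap.contDiffAt.hasStrictDerivAt' (hasDerivAt_hairpinMap w)
    (by simp)).map_nhds_eq (one_add_cosh_ne_zero (strip_subset_closedStrip hw))
  rw [← h]
  exact image_mem_map (isOpen_strip.mem_nhds hw)

/-- Since distances do not decrease, the preimages of a convergent sequence are Cauchy. -/
theorem isClosed_image_hairpinMap_closedStrip : IsClosed (hairpinMap '' closedStrip) := by
  refine IsSeqClosed.isClosed fun z y hz hy => ?_
  choose w hw hwz using hz
  have hc : CauchySeq w := by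
    refine Metric.cauchySeq_iff'.2 fun ε hε => ?_
    obtain ⟨N, hN⟩ := Metric.cauchySeq_iff'.1 hy.cauchySeq ε hε
    refine ⟨N, fun n hn => lt_of_le_of_lt ?_ (hN n hn)⟩
    rw [dist_eq_norm, dist_eq_norm, ← hwz, ← hwz]
    exact norm_sub_le_norm_hairpinMap_sub (hw N) (hw n)
  obtain ⟨w₀, hw₀⟩ := cauchySeq_tendsto_of_complete hc
  refine ⟨w₀, isClosed_closedStrip.mem_of_tendsto hw₀ (Eventually.of_forall hw), ?_⟩
  refine tendsto_nhds_unique ((continuous_hairpinMap.tendsto w₀).comp hw₀) (hy.congr fun n => ?_)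
  exact (hwz n).symm

theorem closure_posPhase_doubleHairpin :
    closure (posPhase doubleHairpin) = hairpinMap '' closedStrip := by
  rw [posPhase_doubleHairpin]
  refine (closure_minimal (Set.image_mono strip_subset_closedStrip)
    isClosed_image_hairpinMap_closedStrip).antisymm ?_
  rw [← closure_strip]
  exact image_closure_subset_closure_image continuous_hairpinMap

theorem uniqueDiffOn_image_hairpinMap : UniqueDiffOn ℝ (hairpinMap '' closedStrip) := by
  refine uniqueDiffOn_image_of_deriv_ne_zero (uniqueDiffOn_convex convex_closedStrip ⟨0, ?_⟩)
    (fun w _ => hasDerivAt_hairpinMap w) fun w hw => one_add_cosh_ne_zero hw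
  exact mem_interior.2 ⟨strip, strip_subset_closedStrip, isOpen_strip, by
    simp [strip]; positivity⟩

/-- The boundary point `t + iσπ/2` of the strip. -/
def stripEdge (σ t : ℝ) : ℂ := t + (σ * (Real.pi / 2) : ℝ) * Complex.I

theorem freeBoundary_doubleHairpin : freeBoundary doubleHairpin
    = (fun t => hairpinMap (stripEdge 1 t)) '' Set.univ
      ∪ (fun t => hairpinMap (stripEdge (-1) t)) '' Set.univ := by
  have hpi := Real.pi_pos
  rw [freeBoundary, frontier, closure_posPhase_doubleHairpin, posPhase_doubleHairpin,
    isOpen_image_hairpinMap_strip.interior_eq]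
  ext z
  constructor
  · rintro ⟨⟨w, hw, rfl⟩, h2⟩
    have h3 : w ∉ strip := fun h => h2 ⟨w, h, rfl⟩
    have h4 : |w.im| = Real.pi / 2 := le_antisymm hw (not_lt.1 h3)
    rcases (abs_eq (by positivity)).1 h4 with h | h
    · exact Or.inl ⟨w.re, trivial, congrArg hairpinMap (Complex.ext (by simp [stripEdge])
        (by simp [stripEdge, h]))⟩
    · exact Or.inr ⟨w.re, trivial, congrArg hairpinMap (Complex.ext (by simp [stripEdge])
        (by simp [stripEdge, h]))⟩
  · have key : ∀ σ t : ℝ, |σ| = 1 → hairpinMap (stripEdge σ t) ∈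
        hairpinMap '' closedStrip \ hairpinMap '' strip := by
      intro σ t hσ
      have him : |(stripEdge σ t).im| = Real.pi / 2 := by
        simp [stripEdge, abs_mul, hσ, abs_of_pos (half_pos hpi)]
      have hmem : stripEdge σ t ∈ closedStrip := him.le
      refine ⟨⟨_, hmem, rfl⟩, ?_⟩
      rintro ⟨w, hw, hwe⟩
      rw [injOn_hairpinMap_closedStrip (strip_subset_closedStrip hw) hmem hwe] at hw
      exact absurd (Set.mem_ofPred.1 hw) (by rw [him]; exact lt_irrefl _)
    rintro (⟨t, -, rfl⟩ | ⟨t, -, rfl⟩)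
    · exact key 1 t (by simp)
    · exact key (-1) t (by simp)

theorem doubleHairpin_hairpinMap_closedStrip {w : ℂ} (hw : w ∈ closedStrip) :
    doubleHairpin (hairpinMap w) = (Complex.cosh w).re := by
  by_cases h : w ∈ strip
  · exact doubleHairpin_hairpinMap h
  · have h1 : hairpinMap w ∉ hairpinMap '' strip := by
      rintro ⟨w', hw', he⟩
      exact h (injOn_hairpinMap_closedStrip (strip_subset_closedStrip hw') hw he ▸ hw')
    have h4 : |w.im| = Real.pi / 2 := le_antisymm hw (not_lt.1 h)
    rw [doubleHairpin, if_neg h1, cosh_re, ← Real.cos_abs, h4, Real.cos_pi_div_two, mul_zero]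

/-- The holomorphic inverse exists on a full neighbourhood, even at boundary points, because 1 +
cosh w ≠ 0 on the closed strip. -/
theorem exists_local_inverse {w : ℂ} (hw : w ∈ closedStrip) :
    ∃ e : ℂ → ℂ, ContDiffAt ℝ ∞ e (hairpinMap w) ∧
      HasDerivAt e (1 + Complex.cosh w)⁻¹ (hairpinMap w) ∧ e (hairpinMap w) = w ∧
      ∀ᶠ y in 𝓝[hairpinMap '' closedStrip] (hairpinMap w),
        e y ∈ closedStrip ∧ hairpinMap (e y) = y := by
  have h0 := one_add_cosh_ne_zero hw
  have hf : ContDiffAt ℂ ∞ hairpinMap w := contDiff_hairpinMap.contDiffAt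
  have hs : HasStrictDerivAt hairpinMap (1 + Complex.cosh w) w :=
    hf.hasStrictDerivAt' (hasDerivAt_hairpinMap w) (by simp)
  have hf' : HasFDerivAt hairpinMap
      (ContinuousLinearEquiv.unitsEquivAut ℂ (Units.mk0 _ h0) : ℂ →L[ℂ] ℂ) w :=
    (hs.hasStrictFDerivAt_equiv h0).hasFDerivAt
  have hleft : ∀ᶠ x in 𝓝 w, hf.localInverse hf' (by simp) (hairpinMap x) = x :=
    (hf.hasStrictFDerivAt' hf' (by simp)).eventually_left_inverse
  have hcd := hf.to_localInverse hf' (by simp)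
  refine ⟨hf.localInverse hf' (by simp), hcd.restrict_scalars ℝ, ?_, hleft.self_of_nhds, ?_⟩
  · exact (hs.to_localInverse h0).hasDerivAt
  -- A nearby image point could a priori come from a distant part of the strip; the expansion
  -- estimate forces its preimage to be close to w, where e inverts the map.
  · obtain ⟨ε, hε, hball⟩ := Metric.eventually_nhds_iff.1 hleft
    filter_upwards [self_mem_nhdsWithin, nhdsWithin_le_nhds (Metric.ball_mem_nhds _ hε)]
    rintro _ ⟨x, hx, rfl⟩ hd
    have hx' : dist x w < ε := by
      refine lt_of_le_of_lt ?_ hd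
      rw [dist_eq_norm, dist_eq_norm]
      exact norm_sub_le_norm_hairpinMap_sub hw hx
    rw [hball hx']
    exact ⟨hx, rfl⟩

theorem gradientWithin_doubleHairpin {w : ℂ} (hw : w ∈ closedStrip) :
    gradientWithin doubleHairpin (hairpinMap '' closedStrip) (hairpinMap w)
      = (starRingEnd ℂ) (Complex.sinh w / (1 + Complex.cosh w)) := by
  obtain ⟨e, -, he, hew, hev⟩ := exists_local_inverse hw
  have hF : HasDerivAt (fun y => Complex.cosh (e y))
      (Complex.sinh w / (1 + Complex.cosh w)) (hairpinMap w) := by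
    have := he.ccosh
    rwa [hew, ← div_eq_mul_inv] at this
  refine gradientWithin_re (uniqueDiffOn_image_hairpinMap _ ⟨w, hw, rfl⟩) ⟨w, hw, rfl⟩ hF ?_
  filter_upwards [hev] with y hy
  rw [← hy.2, doubleHairpin_hairpinMap_closedStrip hy.1, hy.2]

theorem cosh_stripEdge {σ : ℝ} (hσ : σ = 1 ∨ σ = -1) (t : ℝ) :
    Complex.cosh (stripEdge σ t) = (σ * Real.sinh t : ℝ) * Complex.I := by
  have h : Real.cos (σ * (Real.pi / 2)) = 0 ∧ Real.sin (σ * (Real.pi / 2)) = σ := by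
    rcases hσ with rfl | rfl <;> simp
  rw [stripEdge, Complex.cosh_add, Complex.cosh_mul_I, Complex.sinh_mul_I, ← Complex.ofReal_cos,
    ← Complex.ofReal_sin, h.1, h.2]
  push_cast
  ring

theorem sinh_stripEdge {σ : ℝ} (hσ : σ = 1 ∨ σ = -1) (t : ℝ) :
    Complex.sinh (stripEdge σ t) = (σ * Real.cosh t : ℝ) * Complex.I := by
  have h : Real.cos (σ * (Real.pi / 2)) = 0 ∧ Real.sin (σ * (Real.pi / 2)) = σ := by
    rcases hσ with rfl | rfl <;> simp
  rw [stripEdge, Complex.sinh_add, Complex.cosh_mul_I, Complex.sinh_mul_I, ← Complex.ofReal_cos,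
    ← Complex.ofReal_sin, h.1, h.2]
  push_cast
  ring

theorem stripEdge_mem {σ : ℝ} (hσ : σ = 1 ∨ σ = -1) (t : ℝ) : stripEdge σ t ∈ closedStrip := by
  have hpi := Real.pi_pos
  rcases hσ with rfl | rfl <;> simp [stripEdge, closedStrip, abs_of_pos (half_pos hpi)]

theorem norm_one_add_cosh_stripEdge {σ : ℝ} (hσ : σ = 1 ∨ σ = -1) (t : ℝ) :
    ‖1 + Complex.cosh (stripEdge σ t)‖ = Real.cosh t := by
  have h2 : σ ^ 2 = 1 := by rcases hσ with rfl | rfl <;> simp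
  rw [cosh_stripEdge hσ, ← sq_eq_sq₀ (norm_nonneg _) (Real.cosh_pos t).le,
    ← Complex.normSq_eq_norm_sq, ← Complex.ofReal_one, Complex.normSq_add_mul_I, Real.cosh_sq]
  linear_combination Real.sinh t ^ 2 * h2

/-- Here τ = sinh w/(1 + cosh w) and dτ/dz = 1/(1 + cosh w)². On the edges sinh w = iσ cosh t and |1
+ cosh w| = cosh t, so |τ| = 1 and conj(τ)² dτ/dz = -cosh² t/cosh⁴ t. -/
theorem meanCurvature_doubleHairpin {σ : ℝ} (hσ : σ = 1 ∨ σ = -1) (t : ℝ) :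
    meanCurvature doubleHairpin (hairpinMap (stripEdge σ t)) = (Real.cosh t ^ 2)⁻¹ := by
  have hw := stripEdge_mem hσ t
  set w := stripEdge σ t with hwdef
  obtain ⟨e, -, he, hew, hev⟩ := exists_local_inverse hw
  have h0 := one_add_cosh_ne_zero hw
  have hn := norm_one_add_cosh_stripEdge hσ t
  have hτ : HasDerivAt (fun y => Complex.sinh (e y) / (1 + Complex.cosh (e y)))
      ((1 + Complex.cosh w) ^ 2)⁻¹ (hairpinMap w) := by
    have h := he.csinh.fun_div (he.ccosh.const_add 1) (by rwa [hew])
    rw [hew] at h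
    have e : ((1 + Complex.cosh w) ^ 2)⁻¹
        = (Complex.cosh w * (1 + Complex.cosh w)⁻¹ * (1 + Complex.cosh w)
          - Complex.sinh w * (Complex.sinh w * (1 + Complex.cosh w)⁻¹)) / (1 + Complex.cosh w) ^ 2 := by
      have := Complex.cosh_sq w
      field_simp
      linear_combination -this
    rw [e]
    exact h
  have hmem : hairpinMap w ∈ hairpinMap '' closedStrip := ⟨w, hw, rfl⟩
  have h := meanCurvature_eq (u := doubleHairpin)
    (by rw [closure_posPhase_doubleHairpin]; exact uniqueDiffOn_image_hairpinMap _ hmem)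
    (by rwa [closure_posPhase_doubleHairpin])
    (by
      rw [closure_posPhase_doubleHairpin]
      filter_upwards [hev] with y hy
      rw [← gradientWithin_doubleHairpin hy.1, hy.2])
    hτ (by
      rw [hew, norm_div, hn, sinh_stripEdge hσ]
      have hσ1 : |σ| = 1 := by rcases hσ with rfl | rfl <;> simp
      have := Real.cosh_pos t
      rw [norm_mul, Complex.norm_I, Complex.norm_real, Real.norm_eq_abs, abs_mul, hσ1,
        abs_of_pos this, one_mul, mul_one, div_self this.ne'])
  rw [h, hew, sinh_stripEdge hσ, map_div₀, div_pow, div_mul_eq_mul_div, ← div_eq_mul_inv]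
  have h1 : (1 + Complex.cosh w) ^ 2 * (starRingEnd ℂ) (1 + Complex.cosh w) ^ 2
      = ((Real.cosh t ^ 4 : ℝ) : ℂ) := by
    rw [← mul_pow, Complex.mul_conj, Complex.normSq_eq_norm_sq, hn]
    push_cast
    ring
  have h2 : (starRingEnd ℂ) ((σ * Real.cosh t : ℝ) * Complex.I) ^ 2
      = ((-Real.cosh t ^ 2 : ℝ) : ℂ) := by
    have h3 : (σ : ℂ) ^ 2 = 1 := by rcases hσ with rfl | rfl <;> simp
    rw [map_mul, Complex.conj_I, Complex.conj_ofReal, mul_pow, neg_sq, Complex.I_sq]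
    push_cast
    linear_combination -(Complex.cosh t ^ 2) * h3
  rw [div_div, h1, h2, ← Complex.ofReal_div, Complex.ofReal_re]
  have := Real.cosh_pos t
  field_simp

end HairpinGeometry

/-! ### Boundary measures: catenaries and circle -/

section HairpinBoundary

theorem hasDerivAt_hairpinMap_stripEdge (σ t : ℝ) :
    HasDerivAt (fun t : ℝ => hairpinMap (stripEdge σ t)) (1 + Complex.cosh (stripEdge σ t)) t := by
  have h : HasDerivAt (stripEdge σ) 1 t := (Complex.ofRealCLM.hasDerivAt (x := t)).add_const _
  have := (hasDerivAt_hairpinMap (stripEdge σ t)).comp t h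
  rwa [mul_one] at this

theorem continuous_stripEdge (σ : ℝ) : Continuous (stripEdge σ) := by
  unfold stripEdge; fun_prop

theorem continuous_one_add_cosh_stripEdge (σ : ℝ) :
    Continuous fun t => 1 + Complex.cosh (stripEdge σ t) := by
  have := continuous_stripEdge σ
  fun_prop

theorem stripEdge_re (σ t : ℝ) : (stripEdge σ t).re = t := by simp [stripEdge]

theorem stripEdge_im (σ t : ℝ) : (stripEdge σ t).im = σ * (Real.pi / 2) := by simp [stripEdge]

theorem injOn_hairpinMap_stripEdge {σ : ℝ} (hσ : σ = 1 ∨ σ = -1) :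
    Set.InjOn (fun t : ℝ => hairpinMap (stripEdge σ t)) Set.univ := by
  intro s _ t _ h
  have := injOn_hairpinMap_closedStrip (stripEdge_mem hσ s) (stripEdge_mem hσ t) h
  simpa [stripEdge_re] using congrArg Complex.re this

theorem disjoint_edges : Disjoint ((fun t => hairpinMap (stripEdge 1 t)) '' Set.univ)
    ((fun t => hairpinMap (stripEdge (-1) t)) '' Set.univ) := by
  rw [Set.disjoint_left]
  rintro _ ⟨s, -, rfl⟩ ⟨t, -, h⟩
  have := congrArg Complex.im (injOn_hairpinMap_closedStrip (stripEdge_mem (Or.inr rfl) t)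
    (stripEdge_mem (Or.inl rfl) s) h)
  rw [stripEdge_im, stripEdge_im] at this
  linarith [Real.pi_pos]

/-- Integration over the free boundary against the curvature, in the parameters of the strip. -/
theorem integral_freeBoundary_doubleHairpin {f : ℂ → ℝ}
    (h1 : Integrable fun t => f (hairpinMap (stripEdge 1 t)) / Real.cosh t)
    (h2 : Integrable fun t => f (hairpinMap (stripEdge (-1) t)) / Real.cosh t) :
    ∫ z in freeBoundary doubleHairpin, meanCurvature doubleHairpin z * f z ∂μH[1]
      = ∫ t, (f (hairpinMap (stripEdge 1 t)) + f (hairpinMap (stripEdge (-1) t))) / Real.cosh t := by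
  -- Speed cosh t times curvature 1/cosh² t leaves the weight 1/cosh t.
  have key : ∀ {σ : ℝ}, σ = 1 ∨ σ = -1 → ∀ t,
      ‖1 + Complex.cosh (stripEdge σ t)‖ * (meanCurvature doubleHairpin (hairpinMap (stripEdge σ t))
        * f (hairpinMap (stripEdge σ t))) = f (hairpinMap (stripEdge σ t)) / Real.cosh t := by
    intro σ hσ t
    rw [norm_one_add_cosh_stripEdge hσ, meanCurvature_doubleHairpin hσ]
    have := Real.cosh_pos t
    field_simp
  have h0 : ∀ {σ : ℝ}, σ = 1 ∨ σ = -1 → ∀ t, 1 + Complex.cosh (stripEdge σ t) ≠ 0 :=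
    fun hσ t => one_add_cosh_ne_zero (stripEdge_mem hσ t)
  have hi : ∀ {σ : ℝ}, σ = 1 ∨ σ = -1 →
      (Integrable fun t => f (hairpinMap (stripEdge σ t)) / Real.cosh t) →
      IntegrableOn (fun z => meanCurvature doubleHairpin z * f z)
        ((fun t => hairpinMap (stripEdge σ t)) '' Set.univ) μH[1] := by
    intro σ hσ h
    rw [integrableOn_image_curve (hasDerivAt_hairpinMap_stripEdge σ)
      (continuous_one_add_cosh_stripEdge σ) (h0 hσ) MeasurableSet.univ
      (injOn_hairpinMap_stripEdge hσ)]
    simpa only [key hσ, integrableOn_univ] using h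
  have he : ∀ {σ : ℝ}, σ = 1 ∨ σ = -1 →
      ∫ z in (fun t => hairpinMap (stripEdge σ t)) '' Set.univ,
        meanCurvature doubleHairpin z * f z ∂μH[1]
        = ∫ t, f (hairpinMap (stripEdge σ t)) / Real.cosh t := by
    intro σ hσ
    rw [setIntegral_image_curve (hasDerivAt_hairpinMap_stripEdge σ)
      (continuous_one_add_cosh_stripEdge σ) (h0 hσ) MeasurableSet.univ
      (injOn_hairpinMap_stripEdge hσ), setIntegral_univ]
    simp only [key hσ]
  have hm : MeasurableSet ((fun t => hairpinMap (stripEdge (-1) t)) '' Set.univ) :=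
    MeasurableSet.univ.image_of_continuousOn_injOn
      (continuous_hairpinMap.comp (continuous_stripEdge _)).continuousOn
      (injOn_hairpinMap_stripEdge (Or.inr rfl))
  rw [freeBoundary_doubleHairpin, setIntegral_union disjoint_edges hm (hi (Or.inl rfl) h1)
    (hi (Or.inr rfl) h2), he (Or.inl rfl), he (Or.inr rfl), ← integral_add h1 h2]
  simp only [add_div]

/-- The boundary of the disk without `±1`, parametrized by the boundary of the strip. -/
def circleEdge (σ t : ℝ) : ℂ :=
  ((Real.sinh t / Real.cosh t : ℝ) : ℂ) + ((σ / Real.cosh t : ℝ) : ℂ) * Complex.I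

theorem circleEdge_re (σ t : ℝ) : (circleEdge σ t).re = Real.sinh t / Real.cosh t := by
  simp [circleEdge, -Complex.ofReal_div]

theorem circleEdge_im (σ t : ℝ) : (circleEdge σ t).im = σ / Real.cosh t := by
  simp [circleEdge, -Complex.ofReal_div]

/-- The velocity of `circleEdge`. -/
def circleEdgeDeriv (σ t : ℝ) : ℂ :=
  (((Real.cosh t ^ 2)⁻¹ : ℝ) : ℂ) + ((-σ * Real.sinh t / Real.cosh t ^ 2 : ℝ) : ℂ) * Complex.I

theorem hasDerivAt_circleEdge (σ t : ℝ) : HasDerivAt (circleEdge σ) (circleEdgeDeriv σ t) t := by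
  have hc := (Real.cosh_pos t).ne'
  have h1 : HasDerivAt (fun t => Real.sinh t / Real.cosh t) (Real.cosh t ^ 2)⁻¹ t := by
    have := (Real.hasDerivAt_sinh t).fun_div (Real.hasDerivAt_cosh t) hc
    have e : (Real.cosh t * Real.cosh t - Real.sinh t * Real.sinh t) / Real.cosh t ^ 2
        = (Real.cosh t ^ 2)⁻¹ := by
      rw [inv_eq_one_div]; congr 1
      linarith [Real.cosh_sq t, sq (Real.cosh t), sq (Real.sinh t)]
    rwa [e] at this
  have h2 : HasDerivAt (fun t => σ / Real.cosh t) (-σ * Real.sinh t / Real.cosh t ^ 2) t := by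
    simpa using (hasDerivAt_const t σ).fun_div (Real.hasDerivAt_cosh t) hc
  exact h1.ofReal_comp.add (h2.ofReal_comp.mul_const Complex.I)

theorem continuous_circleEdgeDeriv (σ : ℝ) : Continuous (circleEdgeDeriv σ) := by
  have : ∀ t, Real.cosh t ^ 2 ≠ 0 := fun t => (pow_pos (Real.cosh_pos t) 2).ne'
  have h1 : Continuous fun t => (Real.cosh t ^ 2)⁻¹ :=
    (Real.continuous_cosh.pow 2).inv₀ this
  have h2 : Continuous fun t => -σ * Real.sinh t / Real.cosh t ^ 2 :=
    (continuous_const.mul Real.continuous_sinh).div (Real.continuous_cosh.pow 2) this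
  unfold circleEdgeDeriv
  fun_prop

/-- Arclength on the circle is dt/cosh t, the same weight as curvature times arclength on the
catenaries. This coincidence identifies the boundary terms of the two forms. -/
theorem norm_circleEdgeDeriv {σ : ℝ} (hσ : σ = 1 ∨ σ = -1) (t : ℝ) :
    ‖circleEdgeDeriv σ t‖ = (Real.cosh t)⁻¹ := by
  have h2 : σ ^ 2 = 1 := by rcases hσ with rfl | rfl <;> simp
  have hc := Real.cosh_pos t
  rw [← sq_eq_sq₀ (norm_nonneg _) (by positivity), ← Complex.normSq_eq_norm_sq, circleEdgeDeriv,
    Complex.normSq_add_mul_I]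
  field_simp
  rw [Real.cosh_sq]
  linear_combination Real.sinh t ^ 2 * h2

theorem circleEdge_mem_sphere {σ : ℝ} (hσ : σ = 1 ∨ σ = -1) (t : ℝ) :
    circleEdge σ t ∈ Metric.sphere (0 : ℂ) 1 := by
  have h2 : σ ^ 2 = 1 := by rcases hσ with rfl | rfl <;> simp
  have hc := Real.cosh_pos t
  rw [mem_sphere_zero_iff_norm, ← sq_eq_sq₀ (norm_nonneg _) zero_le_one,
    ← Complex.normSq_eq_norm_sq, circleEdge, Complex.normSq_add_mul_I]
  field_simp
  rw [Real.cosh_sq]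
  linear_combination h2

theorem injOn_circleEdge (σ : ℝ) : Set.InjOn (circleEdge σ) Set.univ := by
  have hmono : StrictMono fun t => Real.sinh t / Real.cosh t := by
    refine strictMono_of_deriv_pos fun t => ?_
    have hc := (Real.cosh_pos t).ne'
    have := (Real.hasDerivAt_sinh t).fun_div (Real.hasDerivAt_cosh t) hc
    rw [this.deriv]
    have := Real.cosh_sq t
    have : Real.cosh t * Real.cosh t - Real.sinh t * Real.sinh t = 1 := by
      linarith [sq (Real.cosh t), sq (Real.sinh t)]
    rw [this]
    positivity
  intro s _ t _ h
  have := congrArg Complex.re h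
  rw [circleEdge_re, circleEdge_re] at this
  exact hmono.injective this

theorem disjoint_circleEdges : Disjoint (circleEdge 1 '' Set.univ)
    (circleEdge (-1) '' Set.univ) := by
  rw [Set.disjoint_left]
  rintro _ ⟨s, -, rfl⟩ ⟨t, -, h⟩
  have h := congrArg Complex.im h
  rw [circleEdge_im, circleEdge_im] at h
  have h1 : 0 < 1 / Real.cosh s := by have := Real.cosh_pos s; positivity
  have h2 : 0 < 1 / Real.cosh t := by have := Real.cosh_pos t; positivity
  rw [neg_div] at h
  linarith

/-- The two open arcs miss only ±1, a set of zero length. -/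
theorem sphere_ae_eq_circleEdges : Metric.sphere (0 : ℂ) 1 =ᵐ[μH[1]]
    (circleEdge 1 '' Set.univ ∪ circleEdge (-1) '' Set.univ : Set ℂ) := by
  have hsub : (circleEdge 1 '' Set.univ ∪ circleEdge (-1) '' Set.univ : Set ℂ)
      ⊆ Metric.sphere (0 : ℂ) 1 := by
    rintro _ (⟨t, -, rfl⟩ | ⟨t, -, rfl⟩)
    · exact circleEdge_mem_sphere (Or.inl rfl) t
    · exact circleEdge_mem_sphere (Or.inr rfl) t
  have hdiff : Metric.sphere (0 : ℂ) 1 \ (circleEdge 1 '' Set.univ ∪ circleEdge (-1) '' Set.univ)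
      ⊆ {1, -1} := by
    rintro z ⟨hz, hz'⟩
    have hn : z.re ^ 2 + z.im ^ 2 = 1 := by
      have := Complex.normSq_eq_norm_sq z
      rw [mem_sphere_zero_iff_norm.1 hz, Complex.normSq_apply] at this
      nlinarith
    by_cases him : z.im = 0
    · rw [him] at hn
      have h : (z.re - 1) * (z.re + 1) = 0 := by linarith
      rcases mul_eq_zero.1 h with h | h
      · exact Or.inl (Complex.ext (by simpa using sub_eq_zero.1 h) (by simp [him]))
      · exact Or.inr (Complex.ext (by simpa using eq_neg_of_add_eq_zero_left h) (by simp [him]))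
    · exfalso
      have hpos : 0 < |z.im| := abs_pos.2 him
      -- The parameter must satisfy tanh t = Re z and 1/cosh t = |Im z|, hence sinh t = Re z/|Im z|.
      have hs : Real.sinh (Real.arsinh (z.re / |z.im|)) = z.re / |z.im| := Real.sinh_arsinh _
      have hc : Real.cosh (Real.arsinh (z.re / |z.im|)) = |z.im|⁻¹ := by
        rw [← sq_eq_sq₀ (Real.cosh_pos _).le (by positivity), Real.cosh_sq, hs, div_pow, inv_pow,
          sq_abs]
        field_simp
        linarith
      refine hz' ?_
      rcases lt_or_gt_of_ne him with h | h
      · refine Or.inr ⟨Real.arsinh (z.re / |z.im|), trivial, Complex.ext ?_ ?_⟩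
        · rw [circleEdge_re, hs, hc]; field_simp
        · rw [circleEdge_im, hc, abs_of_neg h]; field_simp
      · refine Or.inl ⟨Real.arsinh (z.re / |z.im|), trivial, Complex.ext ?_ ?_⟩
        · rw [circleEdge_re, hs, hc]; field_simp
        · rw [circleEdge_im, hc, abs_of_pos h]; field_simp
  have hnull : μH[1] (Metric.sphere (0 : ℂ) 1 \
      (circleEdge 1 '' Set.univ ∪ circleEdge (-1) '' Set.univ)) = 0 := by
    have := Measure.nullSingletonClass_hausdorff ℂ one_pos
    exact measure_mono_null hdiff ((Set.toFinite _).measure_zero _)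
  exact ae_eq_set.2 ⟨hnull, by rw [Set.sdiff_eq_empty.2 hsub, measure_empty]⟩

/-- Integration over the circle in the parameters of the strip. -/
theorem integral_circle_eq_integral_edges {f : ℂ → ℝ}
    (hf : ContinuousOn f (Metric.sphere (0 : ℂ) 1)) :
    ∫ z, f z ∂circleMeasure = ∫ t, (f (circleEdge 1 t) + f (circleEdge (-1) t)) / Real.cosh t := by
  have h0 : ∀ {σ : ℝ}, σ = 1 ∨ σ = -1 → ∀ t, circleEdgeDeriv σ t ≠ 0 := fun hσ t => by
    rw [← norm_pos_iff, norm_circleEdgeDeriv hσ]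
    exact inv_pos.2 (Real.cosh_pos t)
  have hFint : IntegrableOn f (Metric.sphere (0 : ℂ) 1) μH[1] :=
    memLp_one_iff_integrable.1 (memLp_restrict_of_isCompact (isCompact_sphere 0 1)
      hausdorffMeasure_sphere_ne_top hf)
  have hi : ∀ {σ : ℝ}, σ = 1 ∨ σ = -1 → IntegrableOn f (circleEdge σ '' Set.univ) μH[1] := by
    intro σ hσ
    refine hFint.mono_set ?_
    rintro _ ⟨t, -, rfl⟩
    exact circleEdge_mem_sphere hσ t
  have key : ∀ {σ : ℝ}, σ = 1 ∨ σ = -1 → ∀ t, ‖circleEdgeDeriv σ t‖ * f (circleEdge σ t)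
      = f (circleEdge σ t) / Real.cosh t := fun hσ t => by
    rw [norm_circleEdgeDeriv hσ, div_eq_inv_mul]
  have hI : ∀ {σ : ℝ}, σ = 1 ∨ σ = -1 →
      Integrable fun t => f (circleEdge σ t) / Real.cosh t := by
    intro σ hσ
    have := (integrableOn_image_curve (hasDerivAt_circleEdge σ) (continuous_circleEdgeDeriv σ)
      (h0 hσ) MeasurableSet.univ (injOn_circleEdge σ) f).1 (hi hσ)
    simpa only [key hσ, integrableOn_univ] using this
  have he : ∀ {σ : ℝ}, σ = 1 ∨ σ = -1 → ∫ z in circleEdge σ '' Set.univ, f z ∂μH[1]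
      = ∫ t, f (circleEdge σ t) / Real.cosh t := by
    intro σ hσ
    rw [setIntegral_image_curve (hasDerivAt_circleEdge σ) (continuous_circleEdgeDeriv σ)
      (h0 hσ) MeasurableSet.univ (injOn_circleEdge σ), setIntegral_univ]
    simp only [key hσ]
  have hm : MeasurableSet (circleEdge (-1) '' Set.univ) :=
    MeasurableSet.univ.image_of_continuousOn_injOn
      (fun t _ => (hasDerivAt_circleEdge _ t).continuousAt.continuousWithinAt) (injOn_circleEdge _)
  rw [circleMeasure, setIntegral_congr_set sphere_ae_eq_circleEdges,
    setIntegral_union disjoint_circleEdges hm (hi (Or.inl rfl)) (hi (Or.inr rfl)),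
    he (Or.inl rfl), he (Or.inr rfl), ← integral_add (hI (Or.inl rfl)) (hI (Or.inr rfl))]
  simp only [add_div]

end HairpinBoundary

/-! ### Pulling the double hairpin back to the disk -/

section DiskToHairpin

/-- The conformal map from the unit disk onto the strip. -/
def diskToStrip (ξ : ℂ) : ℂ := Complex.log ((1 + ξ) / (1 - ξ))

/-- The conformal map from the strip onto the unit disk. -/
def stripToDisk (w : ℂ) : ℂ := (Complex.exp w - 1) / (Complex.exp w + 1)

/-- The conformal map from the unit disk onto the positive phase of the double hairpin. -/
def diskToHairpin (ξ : ℂ) : ℂ := hairpinMap (diskToStrip ξ)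

theorem cayley_re (ξ : ℂ) :
    ((1 + ξ) / (1 - ξ)).re = (1 - ‖ξ‖ ^ 2) / Complex.normSq (1 - ξ) := by
  rw [← Complex.normSq_eq_norm_sq, Complex.div_re, ← add_div, Complex.normSq_apply,
    Complex.normSq_apply]
  simp only [Complex.add_re, Complex.sub_re, Complex.add_im, Complex.sub_im, Complex.one_re,
    Complex.one_im]
  ring

theorem cayley_ne_zero {ξ : ℂ} (h1 : ξ ≠ 1) (h2 : ξ ≠ -1) : (1 + ξ) / (1 - ξ) ≠ 0 := by
  refine div_ne_zero (fun h => h2 ?_) (sub_ne_zero.2 h1.symm)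
  linear_combination h

theorem cayley_re_nonneg {ξ : ℂ} (hξ : ξ ∈ Metric.closedBall (0 : ℂ) 1) :
    0 ≤ ((1 + ξ) / (1 - ξ)).re := by
  rw [cayley_re]
  have := mem_closedBall_zero_iff.1 hξ
  exact div_nonneg (by nlinarith [norm_nonneg ξ]) (Complex.normSq_nonneg _)

theorem cayley_re_pos {ξ : ℂ} (hξ : ξ ∈ Metric.ball (0 : ℂ) 1) : 0 < ((1 + ξ) / (1 - ξ)).re := by
  rw [cayley_re]
  have := mem_ball_zero_iff.1 hξ
  refine div_pos (by nlinarith [norm_nonneg ξ]) (Complex.normSq_pos.2 fun h => ?_)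
  rw [← sub_eq_zero.1 h, norm_one] at this
  exact lt_irrefl _ this

theorem cayley_mem_slitPlane {ξ : ℂ} (hξ : ξ ∈ Metric.closedBall (0 : ℂ) 1) (h1 : ξ ≠ 1)
    (h2 : ξ ≠ -1) : (1 + ξ) / (1 - ξ) ∈ Complex.slitPlane := by
  rw [Complex.mem_slitPlane_iff]
  rcases (cayley_re_nonneg hξ).eq_or_lt with h | h
  · refine Or.inr fun h' => cayley_ne_zero h1 h2 (Complex.ext h.symm h')
  · exact Or.inl h

theorem ne_one_of_mem_ball {ξ : ℂ} (hξ : ξ ∈ Metric.ball (0 : ℂ) 1) : ξ ≠ 1 ∧ ξ ≠ -1 := by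
  have := mem_ball_zero_iff.1 hξ
  constructor <;> rintro rfl <;> simp at this

theorem diskToStrip_mem_closedStrip {ξ : ℂ} (hξ : ξ ∈ Metric.closedBall (0 : ℂ) 1) :
    diskToStrip ξ ∈ closedStrip := by
  rw [closedStrip, Set.mem_ofPred, diskToStrip, Complex.log_im]
  exact Complex.abs_arg_le_pi_div_two_iff.2 (cayley_re_nonneg hξ)

theorem diskToStrip_mem_strip {ξ : ℂ} (hξ : ξ ∈ Metric.ball (0 : ℂ) 1) :
    diskToStrip ξ ∈ strip := by
  rw [strip, Set.mem_ofPred, diskToStrip, Complex.log_im]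
  exact Complex.abs_arg_lt_pi_div_two_iff.2 (Or.inl (cayley_re_pos hξ))

theorem stripToDisk_diskToStrip {ξ : ℂ} (h1 : ξ ≠ 1) (h2 : ξ ≠ -1) :
    stripToDisk (diskToStrip ξ) = ξ := by
  have h3 : 1 - ξ ≠ 0 := sub_ne_zero.2 h1.symm
  rw [stripToDisk, diskToStrip, Complex.exp_log (cayley_ne_zero h1 h2)]
  have e1 : (1 + ξ) / (1 - ξ) - 1 = 2 * ξ / (1 - ξ) := by field_simp; ring
  have e2 : (1 + ξ) / (1 - ξ) + 1 = 2 / (1 - ξ) := by field_simp; ring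
  rw [e1, e2]
  field_simp

theorem exp_re_nonneg {w : ℂ} (hw : w ∈ closedStrip) : 0 ≤ (Complex.exp w).re := by
  rw [Complex.exp_re]
  exact mul_nonneg (Real.exp_pos _).le (Real.cos_nonneg_of_mem_Icc (abs_le.1 hw))

theorem exp_add_one_ne_zero {w : ℂ} (hw : w ∈ closedStrip) : Complex.exp w + 1 ≠ 0 := by
  intro h
  have h1 := congrArg Complex.re h
  have h2 := exp_re_nonneg hw
  simp only [Complex.add_re, Complex.one_re, Complex.zero_re] at h1
  linarith

theorem stripToDisk_ne {w : ℂ} (hw : w ∈ closedStrip) : stripToDisk w ≠ 1 ∧ stripToDisk w ≠ -1 := by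
  have h := exp_add_one_ne_zero hw
  constructor <;> rw [stripToDisk, ne_eq, div_eq_iff h] <;> intro h'
  · have : (2 : ℂ) = 0 := by linear_combination -h'
    exact two_ne_zero this
  · exact Complex.exp_ne_zero w (by linear_combination h' / 2)

theorem log_exp_of_mem_closedStrip {w : ℂ} (hw : w ∈ closedStrip) :
    Complex.log (Complex.exp w) = w := by
  have hpi := Real.pi_pos
  have := abs_le.1 (Set.mem_ofPred.1 hw)
  exact Complex.log_exp (by linarith) (by linarith)

theorem diskToStrip_stripToDisk {w : ℂ} (hw : w ∈ closedStrip) :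
    diskToStrip (stripToDisk w) = w := by
  have h := exp_add_one_ne_zero hw
  have e : (1 + stripToDisk w) / (1 - stripToDisk w) = Complex.exp w := by
    have e1 : 1 + stripToDisk w = 2 * Complex.exp w / (Complex.exp w + 1) := by
      rw [stripToDisk]; field_simp; ring
    have e2 : 1 - stripToDisk w = 2 / (Complex.exp w + 1) := by
      rw [stripToDisk]; field_simp; ring
    rw [e1, e2]
    field_simp
  rw [diskToStrip, e, log_exp_of_mem_closedStrip hw]

theorem stripToDisk_mem_ball {w : ℂ} (hw : w ∈ strip) :
    stripToDisk w ∈ Metric.ball (0 : ℂ) 1 := by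
  have h := exp_add_one_ne_zero (strip_subset_closedStrip hw)
  have hre : 0 < (Complex.exp w).re := by
    rw [Complex.exp_re]
    exact mul_pos (Real.exp_pos _) (Real.cos_pos_of_mem_Ioo (abs_lt.1 hw))
  rw [mem_ball_zero_iff, stripToDisk, norm_div, div_lt_one (norm_pos_iff.2 h),
    ← sq_lt_sq₀ (norm_nonneg _) (norm_nonneg _), ← Complex.normSq_eq_norm_sq,
    ← Complex.normSq_eq_norm_sq, Complex.normSq_apply, Complex.normSq_apply]
  simp only [Complex.sub_re, Complex.one_re, Complex.sub_im, Complex.one_im, Complex.add_re,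
    Complex.add_im]
  nlinarith

/-- On the edge e^w = iσe^t, and (e^w - 1)/(e^w + 1) = tanh t + iσ/cosh t; this is the origin of the
formula for `circleEdge`. -/
theorem diskToStrip_circleEdge {σ : ℝ} (hσ : σ = 1 ∨ σ = -1) (t : ℝ) :
    diskToStrip (circleEdge σ t) = stripEdge σ t := by
  have hmem := stripEdge_mem hσ t
  have h := exp_add_one_ne_zero hmem
  rw [← diskToStrip_stripToDisk hmem]
  congr 1
  rw [stripToDisk, eq_div_iff h]
  have he : Complex.exp (stripEdge σ t) = σ * Complex.exp t * Complex.I := by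
    rw [← Complex.cosh_add_sinh, cosh_stripEdge hσ, sinh_stripEdge hσ, ← Complex.cosh_add_sinh]
    push_cast
    ring
  have hσ2 : (σ : ℂ) ^ 2 = 1 := by rcases hσ with rfl | rfl <;> simp
  have hc : Complex.cosh t ≠ 0 := by
    rw [← Complex.ofReal_cosh]
    exact_mod_cast (Real.cosh_pos t).ne'
  rw [he, circleEdge, ← Complex.cosh_add_sinh]
  push_cast
  field_simp
  have h2 := Complex.cosh_sq (t : ℂ)
  have hI := Complex.I_sq
  linear_combination (Complex.cosh t + Complex.sinh t) * (Complex.I ^ 2 * hσ2 + hI)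
    - σ * Complex.I * h2

theorem contDiffAt_diskToHairpin {ξ : ℂ} (hξ : ξ ∈ Metric.closedBall (0 : ℂ) 1) (h1 : ξ ≠ 1)
    (h2 : ξ ≠ -1) : ContDiffAt ℂ ∞ diskToHairpin ξ := by
  have h3 : ContDiffAt ℂ ∞ (fun ξ : ℂ => (1 + ξ) / (1 - ξ)) ξ :=
    (contDiffAt_const.add contDiffAt_id).div (contDiffAt_const.sub contDiffAt_id)
      (sub_ne_zero.2 h1.symm)
  exact contDiff_hairpinMap.contDiffAt.comp ξ 
    ((Complex.contDiffAt_log (cayley_mem_slitPlane hξ h1 h2)).comp ξ h3)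

theorem image_diskToHairpin_ball : diskToHairpin '' Metric.ball 0 1 = hairpinMap '' strip := by
  ext z
  constructor
  · rintro ⟨ξ, hξ, rfl⟩
    exact ⟨_, diskToStrip_mem_strip hξ, rfl⟩
  · rintro ⟨w, hw, rfl⟩
    refine ⟨stripToDisk w, stripToDisk_mem_ball hw, ?_⟩
    rw [diskToHairpin, diskToStrip_stripToDisk (strip_subset_closedStrip hw)]

theorem injOn_diskToHairpin : Set.InjOn diskToHairpin (Metric.ball 0 1) := by
  intro a ha b hb h
  have h' := hairpinMap_injOn (diskToStrip_mem_strip ha) (diskToStrip_mem_strip hb) h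
  rw [← stripToDisk_diskToStrip (ne_one_of_mem_ball ha).1 (ne_one_of_mem_ball ha).2, h',
    stripToDisk_diskToStrip (ne_one_of_mem_ball hb).1 (ne_one_of_mem_ball hb).2]

/-- The pull-back to the disk of a function on the closed positive phase of the double hairpin. -/
def diskPullback (φ : ℂ → ℝ) : ℂ → ℝ := ({1, -1}ᶜ : Set ℂ).indicator (φ ∘ diskToHairpin)

theorem diskPullback_of_ne {φ : ℂ → ℝ} {ξ : ℂ} (h1 : ξ ≠ 1) (h2 : ξ ≠ -1) :
    diskPullback φ ξ = φ (diskToHairpin ξ) :=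
  Set.indicator_of_mem (by simp [h1, h2]) _

theorem diskPullback_eventuallyEq (φ : ℂ → ℝ) {ξ : ℂ} (h1 : ξ ≠ 1) (h2 : ξ ≠ -1) :
    diskPullback φ =ᶠ[𝓝 ξ] φ ∘ diskToHairpin := by
  have : ({1, -1}ᶜ : Set ℂ) ∈ 𝓝 ξ :=
    (Set.toFinite ({1, -1} : Set ℂ)).isClosed.isOpen_compl.mem_nhds (by simp [h1, h2])
  filter_upwards [this] with y hy
  exact Set.indicator_of_mem hy _

variable (φ : testSpace doubleHairpin)

theorem testSpace_doubleHairpin_contDiffOn :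
    ContDiffOn ℝ ∞ (φ : ℂ → ℝ) (hairpinMap '' closedStrip) := by
  have := φ.2.1
  rwa [closure_posPhase_doubleHairpin] at this

/-- The points ±1 correspond to the two ends of the hairpin. Because |w| ≤ |w + sinh w|, a bounded
support comes from a compact part of the closed strip, whose image in the disk stays away from ±1.
Setting the pull-back to 0 at ±1 is therefore the smooth choice. -/
theorem diskPullback_eventuallyEq_zero {ξ : ℂ} (hξ : ξ = 1 ∨ ξ = -1) :
    diskPullback (φ : ℂ → ℝ) =ᶠ[𝓝[Metric.closedBall 0 1] ξ] fun _ => 0 := by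
  obtain ⟨R, hR⟩ := φ.2.2.1.isCompact.isBounded.subset_closedBall (0 : ℂ)
  have hK : IsCompact (stripToDisk '' (closedStrip ∩ Metric.closedBall 0 R)) := by
    refine ((isCompact_closedBall 0 R).inter_left isClosed_closedStrip).image_of_continuousOn ?_
    intro w hw
    exact ((Complex.continuous_exp.sub continuous_const).continuousAt.div
      (Complex.continuous_exp.add continuous_const).continuousAt
      (exp_add_one_ne_zero hw.1)).continuousWithinAt
  have hnot : ξ ∉ stripToDisk '' (closedStrip ∩ Metric.closedBall 0 R) := by
    rintro ⟨w, hw, rfl⟩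
    rcases hξ with h | h
    · exact (stripToDisk_ne hw.1).1 h
    · exact (stripToDisk_ne hw.1).2 h
  filter_upwards [self_mem_nhdsWithin,
    nhdsWithin_le_nhds (hK.isClosed.isOpen_compl.mem_nhds hnot)] with y hy hy'
  by_contra h0
  have hy2 : y ≠ 1 ∧ y ≠ -1 := by
    constructor <;> rintro rfl <;> simp [diskPullback] at h0
  rw [diskPullback_of_ne hy2.1 hy2.2] at h0
  refine hy' ⟨diskToStrip y, ⟨diskToStrip_mem_closedStrip hy, ?_⟩,
    stripToDisk_diskToStrip hy2.1 hy2.2⟩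
  have h3 := hR (subset_tsupport _ h0)
  rw [mem_closedBall_zero_iff] at h3 ⊢
  exact (norm_le_norm_hairpinMap (diskToStrip_mem_closedStrip hy)).trans h3

theorem contDiffOn_diskPullback :
    ContDiffOn ℝ ∞ (diskPullback (φ : ℂ → ℝ)) (Metric.closedBall 0 1) := by
  intro ξ hξ
  by_cases h : ξ = 1 ∨ ξ = -1
  · exact contDiffWithinAt_const.congr_of_eventuallyEq (diskPullback_eventuallyEq_zero φ h)
      ((diskPullback_eventuallyEq_zero φ h).eq_of_nhdsWithin hξ)
  · rw [not_or] at h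
    have h1 := ((contDiffAt_diskToHairpin hξ h.1 h.2).restrict_scalars ℝ).contDiffWithinAt
      (s := Metric.closedBall 0 1)
    have h2 := (testSpace_doubleHairpin_contDiffOn φ (diskToHairpin ξ)
      ⟨_, diskToStrip_mem_closedStrip hξ, rfl⟩).comp ξ h1
      fun y hy => ⟨_, diskToStrip_mem_closedStrip hy, rfl⟩
    exact h2.congr_of_eventuallyEq
      (nhdsWithin_le_nhds (diskPullback_eventuallyEq _ h.1 h.2))
      (diskPullback_of_ne h.1 h.2)

theorem setIntegral_sq_gradient_diskPullback :
    ∫ z in hairpinMap '' strip, ‖gradient (φ : ℂ → ℝ) z‖ ^ 2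
      = ∫ ξ, ‖gradient (diskPullback (φ : ℂ → ℝ)) ξ‖ ^ 2 ∂diskMeasure := by
  rw [← image_diskToHairpin_ball, setIntegral_image_sq_gradient (g' := deriv diskToHairpin)
    Metric.isOpen_ball.measurableSet _ injOn_diskToHairpin]
  · refine setIntegral_congr_fun Metric.isOpen_ball.measurableSet fun ξ hξ => ?_
    have := ne_one_of_mem_ball hξ
    simp only [(diskPullback_eventuallyEq (φ : ℂ → ℝ) this.1 this.2).gradient_eq]
  · intro ξ hξ
    exact ((testSpace_doubleHairpin_contDiffOn φ).contDiffAt (mem_of_superset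
      (isOpen_image_hairpinMap_strip.mem_nhds ⟨_, diskToStrip_mem_strip hξ, rfl⟩)
      (Set.image_mono strip_subset_closedStrip))).differentiableAt (by simp)
  · intro ξ hξ
    have := ne_one_of_mem_ball hξ
    exact ((contDiffAt_diskToHairpin (Metric.ball_subset_closedBall hξ) this.1
      this.2).differentiableAt (by simp)).hasDerivAt

theorem circleEdge_ne {σ : ℝ} (hσ : σ = 1 ∨ σ = -1) (t : ℝ) :
    circleEdge σ t ≠ 1 ∧ circleEdge σ t ≠ -1 := by
  have hc := Real.cosh_pos t
  have hne : σ / Real.cosh t ≠ 0 := by rcases hσ with rfl | rfl <;> positivity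
  constructor <;> intro h <;> have h' := congrArg Complex.im h <;>
    rw [circleEdge_im] at h' <;> exact hne (by simpa using h')

theorem diskPullback_circleEdge {σ : ℝ} (hσ : σ = 1 ∨ σ = -1) (t : ℝ) :
    diskPullback (φ : ℂ → ℝ) (circleEdge σ t) = (φ : ℂ → ℝ) (hairpinMap (stripEdge σ t)) := by
  rw [diskPullback_of_ne (circleEdge_ne hσ t).1 (circleEdge_ne hσ t).2, diskToHairpin,
    diskToStrip_circleEdge hσ]

theorem continuous_testSpace_edge {σ : ℝ} (hσ : σ = 1 ∨ σ = -1) :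
    Continuous fun t => (φ : ℂ → ℝ) (hairpinMap (stripEdge σ t)) :=
  (testSpace_doubleHairpin_contDiffOn φ).continuousOn.comp_continuous
    (continuous_hairpinMap.comp (continuous_stripEdge σ)) fun t => ⟨_, stripEdge_mem hσ t, rfl⟩

theorem hasCompactSupport_testSpace_edge {σ : ℝ} (hσ : σ = 1 ∨ σ = -1) :
    HasCompactSupport fun t => (φ : ℂ → ℝ) (hairpinMap (stripEdge σ t)) := by
  obtain ⟨R, hR⟩ := φ.2.2.1.isCompact.isBounded.subset_closedBall (0 : ℂ)
  refine HasCompactSupport.intro (isCompact_closedBall (0 : ℝ) R) fun t ht => ?_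
  by_contra h0
  refine ht ?_
  have h1 := mem_closedBall_zero_iff.1 (hR (subset_tsupport _ h0))
  have h2 := norm_le_norm_hairpinMap (stripEdge_mem hσ t)
  have h3 := Complex.abs_re_le_norm (stripEdge σ t)
  rw [stripEdge_re] at h3
  rw [mem_closedBall_zero_iff, Real.norm_eq_abs]
  linarith

theorem continuous_inv_cosh : Continuous fun t => (Real.cosh t)⁻¹ :=
  Real.continuous_cosh.inv₀ fun t => (Real.cosh_pos t).ne'

theorem integrable_testSpace_edge {σ : ℝ} (hσ : σ = 1 ∨ σ = -1) :
    Integrable fun t => (φ : ℂ → ℝ) (hairpinMap (stripEdge σ t)) / Real.cosh t := by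
  simp only [div_eq_mul_inv]
  exact ((continuous_testSpace_edge φ hσ).mul continuous_inv_cosh).integrable_of_hasCompactSupport
    (hasCompactSupport_testSpace_edge φ hσ).mul_right

theorem integrable_sq_testSpace_edge {σ : ℝ} (hσ : σ = 1 ∨ σ = -1) :
    Integrable fun t => (φ : ℂ → ℝ) (hairpinMap (stripEdge σ t)) ^ 2 / Real.cosh t := by
  simp only [div_eq_mul_inv, sq]
  exact (((continuous_testSpace_edge φ hσ).mul (continuous_testSpace_edge φ hσ)).mul
    continuous_inv_cosh).integrable_of_hasCompactSupport
    ((hasCompactSupport_testSpace_edge φ hσ).mul_right.mul_right)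

/-- The boundary mean of a test function, weighted by the curvature. -/
def edgeMean : testSpace doubleHairpin →ₗ[ℝ] ℝ where
  toFun φ := (∫ t, (φ : ℂ → ℝ) (hairpinMap (stripEdge 1 t)) / Real.cosh t)
    + ∫ t, (φ : ℂ → ℝ) (hairpinMap (stripEdge (-1) t)) / Real.cosh t
  map_add' φ ψ := by
    simp only [Submodule.coe_add, Pi.add_apply, add_div]
    rw [integral_add (integrable_testSpace_edge φ (Or.inl rfl))
      (integrable_testSpace_edge ψ (Or.inl rfl)),
      integral_add (integrable_testSpace_edge φ (Or.inr rfl))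
      (integrable_testSpace_edge ψ (Or.inr rfl))]
    ring
  map_smul' c φ := by
    simp only [Submodule.coe_smul, Pi.smul_apply, smul_eq_mul, mul_div_assoc, integral_const_mul,
      RingHom.id_apply, mul_add]

theorem edgeMean_eq : edgeMean φ = ∫ ξ, diskPullback (φ : ℂ → ℝ) ξ ∂circleMeasure := by
  rw [integral_circle_eq_integral_edges ((contDiffOn_diskPullback φ).continuousOn.mono
    Metric.sphere_subset_closedBall)]
  simp only [diskPullback_circleEdge φ (Or.inl rfl), diskPullback_circleEdge φ (Or.inr rfl), add_div]
  rw [integral_add (integrable_testSpace_edge φ (Or.inl rfl))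
      (integrable_testSpace_edge φ (Or.inr rfl))]
  rfl

theorem secondVariation_doubleHairpin : secondVariation doubleHairpin φ φ
    = (∫ z in hairpinMap '' strip, ‖gradient (φ : ℂ → ℝ) z‖ ^ 2)
      - ∫ t, ((φ : ℂ → ℝ) (hairpinMap (stripEdge 1 t)) ^ 2
        + (φ : ℂ → ℝ) (hairpinMap (stripEdge (-1) t)) ^ 2) / Real.cosh t := by
  rw [secondVariation, posPhase_doubleHairpin]
  congr 1
  · simp only [real_inner_self_eq_norm_sq]
  · rw [← integral_freeBoundary_doubleHairpin (f := fun z => (φ : ℂ → ℝ) z ^ 2)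
      (integrable_sq_testSpace_edge φ (Or.inl rfl)) (integrable_sq_testSpace_edge φ (Or.inr rfl))]
    simp only [mul_assoc, sq]

/-- Energy and curvature term both become their disk counterparts for the pull-back, so the sharp
trace inequality on the disk applies to it, with vanishing mean. -/
theorem secondVariation_doubleHairpin_nonneg (h : edgeMean φ = 0) :
    0 ≤ secondVariation doubleHairpin φ φ := by
  have h1 := integral_circle_sq_sub_le ((contDiffOn_diskPullback φ).of_le
    (by exact_mod_cast le_top))
  rw [← edgeMean_eq, h, ← setIntegral_sq_gradient_diskPullback,
    integral_circle_eq_integral_edges (f := fun z => diskPullback (φ : ℂ → ℝ) z ^ 2)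
      (((contDiffOn_diskPullback φ).continuousOn.mono
      Metric.sphere_subset_closedBall).pow 2)] at h1
  simp only [diskPullback_circleEdge φ (Or.inl rfl), diskPullback_circleEdge φ (Or.inr rfl), ne_eq,
    OfNat.ofNat_ne_zero, not_false_eq_true, zero_pow, zero_div, sub_zero] at h1
  rw [secondVariation_doubleHairpin]
  linarith

end DiskToHairpin

/-! ### A negative direction for the double hairpin -/

section HairpinCutoff

/-- The horizontal cut-off in the strip, transplanted to the closed positive phase of the double
hairpin. -/
def hairpinCutoff (ε : ℝ) : ℂ → ℝ :=
  (hairpinMap '' closedStrip).indicator fun z =>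
    reCutoff ε (Function.invFunOn hairpinMap closedStrip z)

theorem hairpinCutoff_hairpinMap (ε : ℝ) {w : ℂ} (hw : w ∈ closedStrip) :
    hairpinCutoff ε (hairpinMap w) = reCutoff ε w := by
  rw [hairpinCutoff, Set.indicator_of_mem (Set.mem_image_of_mem _ hw),
    injOn_hairpinMap_closedStrip.leftInvOn_invFunOn hw]

theorem contDiffOn_hairpinCutoff (ε : ℝ) :
    ContDiffOn ℝ ∞ (hairpinCutoff ε) (hairpinMap '' closedStrip) := by
  rintro _ ⟨w, hw, rfl⟩
  obtain ⟨e, he, -, hew, hev⟩ := exists_local_inverse hw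
  have h1 : hairpinCutoff ε =ᶠ[𝓝[hairpinMap '' closedStrip] hairpinMap w] reCutoff ε ∘ e := by
    filter_upwards [hev] with y hy
    rw [Function.comp_apply, ← hairpinCutoff_hairpinMap ε hy.1, hy.2]
  exact ((contDiff_reCutoff ε).contDiffAt.comp _ he).contDiffWithinAt.congr_of_eventuallyEq h1
    (h1.eq_of_nhdsWithin ⟨w, hw, rfl⟩)

theorem reCutoff_eq_zero {ε : ℝ} (hε : 0 < ε) {w : ℂ} (hw : 2 / ε ≤ |w.re|) :
    reCutoff ε w = 0 := by
  refine cutoff_eq_zero ?_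
  rw [abs_mul, abs_of_pos hε]
  rwa [div_le_iff₀ hε, mul_comm] at hw

theorem hasCompactSupport_hairpinCutoff {ε : ℝ} (hε : 0 < ε) :
    HasCompactSupport (hairpinCutoff ε) := by
  refine HasCompactSupport.intro (((isCompact_Icc (a := -(2 / ε)) (b := 2 / ε)).reProdIm
    (isCompact_Icc (a := -(Real.pi / 2)) (b := Real.pi / 2))).image continuous_hairpinMap)
    fun z hz => ?_
  by_cases h : z ∈ hairpinMap '' closedStrip
  · obtain ⟨w, hw, rfl⟩ := h
    rw [hairpinCutoff_hairpinMap ε hw]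
    refine reCutoff_eq_zero hε ?_
    by_contra! h'
    exact hz ⟨w, ⟨abs_le.1 h'.le, abs_le.1 hw⟩, rfl⟩
  · exact Set.indicator_of_notMem h _

/-- The transplanted cut-off as a test function. -/
def hairpinCutoffTest {ε : ℝ} (hε : 0 < ε) : testSpace doubleHairpin :=
  ⟨hairpinCutoff ε, by rw [closure_posPhase_doubleHairpin]; exact contDiffOn_hairpinCutoff ε,
    hasCompactSupport_hairpinCutoff hε,
    fun z hz => Set.indicator_of_notMem (by rwa [closure_posPhase_doubleHairpin] at hz) _⟩

/-- By conformal invariance the energy is computed in the strip: slope at most εC on a rectangle of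
width π and length 6/ε. -/
theorem setIntegral_sq_gradient_hairpinCutoff_le {C : ℝ} (hC : ∀ x, ‖deriv cutoff x‖ ≤ C) {ε : ℝ}
    (hε : 0 < ε) :
    ∫ z in hairpinMap '' strip, ‖gradient (hairpinCutoff ε) z‖ ^ 2 ≤ 6 * Real.pi * C ^ 2 * ε := by
  have hpi := Real.pi_pos
  have heq : ∀ w ∈ strip, gradient (hairpinCutoff ε ∘ hairpinMap) w = gradient (reCutoff ε) w := by
    intro w hw
    refine Filter.EventuallyEq.gradient_eq ?_
    filter_upwards [isOpen_strip.mem_nhds hw] with y hy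
    exact hairpinCutoff_hairpinMap ε (strip_subset_closedStrip hy)
  rw [setIntegral_image_sq_gradient isOpen_strip.measurableSet
    (fun w _ => hasDerivAt_hairpinMap w) hairpinMap_injOn fun w hw =>
      ((contDiffOn_hairpinCutoff ε).contDiffAt (mem_of_superset
        (isOpen_image_hairpinMap_strip.mem_nhds ⟨w, hw, rfl⟩)
        (Set.image_mono strip_subset_closedStrip))).differentiableAt (by simp)]
  rw [setIntegral_congr_fun (g := fun w => ‖gradient (reCutoff ε) w‖ ^ 2)
    isOpen_strip.measurableSet fun w hw => by simp only [heq w hw]]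
  -- The window 3/ε strictly exceeds the cut-off radius 2/ε, so that off the window the function
  -- vanishes on a whole neighbourhood and its gradient is zero.
  have hsub : strip ∩ Complex.re ⁻¹' Set.Ioc (-(3 / ε)) (3 / ε) ⊆ strip := Set.inter_subset_left
  rw [setIntegral_eq_of_subset_of_forall_sdiff_eq_zero isOpen_strip.measurableSet hsub]
  · have h3 : 0 < 3 / ε := by positivity
    have h := setIntegral_sq_gradient_le (a := -(3 / ε)) (b := 3 / ε) (c := -(Real.pi / 2))
      (d := Real.pi / 2) (by linarith) (by linarith)
      (s := strip ∩ Complex.re ⁻¹' Set.Ioc (-(3 / ε)) (3 / ε))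
      (fun w hw => ⟨hw.2, Set.Ioo_subset_Ioc_self (abs_lt.1 hw.1)⟩)
      (fun w _ => norm_gradient_reCutoff_le hC hε.le w)
    refine h.trans (le_of_eq ?_)
    field_simp
    ring
  · intro w hw
    have h23 : 2 / ε < 3 / ε := by gcongr; norm_num
    have hre : 2 / ε < |w.re| := by
      by_contra! h
      have := abs_le.1 h
      exact hw.2 ⟨hw.1, by linarith, by linarith⟩
    have h0 : reCutoff ε =ᶠ[𝓝 w] fun _ => 0 := by
      filter_upwards [(isOpen_lt continuous_const
        (continuous_abs.comp Complex.continuous_re)).mem_nhds hre] with y hy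
      exact reCutoff_eq_zero hε (le_of_lt hy)
    rw [h0.gradient_eq, gradient_fun_const]
    simp

/-- Any positive lower bound independent of ε suffices; it is read off |t| ≤ 1, where the cut-off
equals 1 for ε ≤ 1 and cosh t ≤ cosh 1. -/
theorem le_integral_edge_hairpinCutoff {ε : ℝ} (hε : 0 < ε) (hε1 : ε ≤ 1) :
    4 / Real.cosh 1 ≤ ∫ t, (hairpinCutoff ε (hairpinMap (stripEdge 1 t)) ^ 2
        + hairpinCutoff ε (hairpinMap (stripEdge (-1) t)) ^ 2) / Real.cosh t := by
  have hFint : Integrable fun t => (hairpinCutoff ε (hairpinMap (stripEdge 1 t)) ^ 2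
      + hairpinCutoff ε (hairpinMap (stripEdge (-1) t)) ^ 2) / Real.cosh t := by
    simp only [add_div]
    exact (integrable_sq_testSpace_edge (hairpinCutoffTest hε) (Or.inl rfl)).add
      (integrable_sq_testSpace_edge (hairpinCutoffTest hε) (Or.inr rfl))
  have h1 : ∫ t in Set.Icc (-1 : ℝ) 1, 2 / Real.cosh 1 = 4 / Real.cosh 1 := by
    simp
    ring
  rw [← h1]
  refine le_trans (setIntegral_mono_on (by simp) hFint.integrableOn measurableSet_Icc
    fun t ht => ?_) (setIntegral_le_integral hFint (Eventually.of_forall fun t => ?_))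
  · have ht1 : |t| ≤ 1 := abs_le.2 ht
    have hc : ∀ σ : ℝ, σ = 1 ∨ σ = -1 → hairpinCutoff ε (hairpinMap (stripEdge σ t)) = 1 := by
      intro σ hσ
      rw [hairpinCutoff_hairpinMap ε (stripEdge_mem hσ t), reCutoff, stripEdge_re]
      refine cutoff_eq_one ?_
      rw [abs_mul, abs_of_pos hε]
      nlinarith [abs_nonneg t]
    rw [hc 1 (Or.inl rfl), hc (-1) (Or.inr rfl), one_pow, one_add_one_eq_two]
    refine div_le_div_of_nonneg_left zero_le_two (Real.cosh_pos t) ?_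
    rw [Real.cosh_le_cosh]
    simpa using ht1
  · have := Real.cosh_pos t
    simp only [Pi.zero_apply]
    positivity

theorem morseIndex_doubleHairpin : morseIndex doubleHairpin = 1 := by
  obtain ⟨C, hC⟩ := exists_deriv_cutoff_le
  have hpi := Real.pi_pos
  have hcosh := Real.cosh_pos 1
  have hA : 0 ≤ 6 * Real.pi * C ^ 2 * Real.cosh 1 := by positivity
  -- With A = 6πC² cosh 1 and ε = 1/(A+1), the energy bound times cosh 1 is A/(A+1) < 4, and ε ≤ 1
  -- as the boundary estimate requires.
  have hε : 0 < (6 * Real.pi * C ^ 2 * Real.cosh 1 + 1)⁻¹ := by positivity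
  refine morseIndex_eq_one edgeMean (fun φ h => secondVariation_doubleHairpin_nonneg φ h)
    (φ := hairpinCutoffTest hε) ?_
  rw [secondVariation_doubleHairpin]
  have h1 := setIntegral_sq_gradient_hairpinCutoff_le hC hε
  have h2 := le_integral_edge_hairpinCutoff hε (inv_le_one_of_one_le₀ (by linarith))
  have h3 : 6 * Real.pi * C ^ 2 * (6 * Real.pi * C ^ 2 * Real.cosh 1 + 1)⁻¹ < 4 / Real.cosh 1 := by
    rw [← div_eq_mul_inv, div_lt_div_iff₀ (by positivity) hcosh]
    linarith
  exact sub_neg.2 (h1.trans_lt (h3.trans_le h2))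

end HairpinCutoff

end OnePhase

end

theorem proposition5p2 (u : ℂ → ℝ)
    (hu : u = OnePhase.diskComplement ∨ u = OnePhase.doubleHairpin) :
    OnePhase.morseIndex u = OnePhase.formIndex OnePhase.Q0 := by
  rcases hu with rfl | rfl
  · rw [OnePhase.morseIndex_diskComplement, OnePhase.formIndex_Q0]
  · rw [OnePhase.morseIndex_doubleHairpin, OnePhase.formIndex_Q0]
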